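/- Graphs may have loops and multiple edges. For integers $g,p\ge 0$ with $2g-2+p>0$ let $\mathrm{Graph}(g,p)$ be the set of finite connected graphs of rank (first Betti number) $g$ with $p$ valence-1 vertices, marked by $p$ distinct labels, and $2g-2+p$ trivalent vertices and no other vertices, up to label-preserving isomorphism; let $\mathrm{Graph}(g,p)/\mathrm{Sym}_p$ be the set of such graphs with unmarked valence-1 vertices, up to isomorphism. For $n\ge 2$ let $\mathrm{Tree}(n)$ be the set of finite trees with all valences $1$ or $3$ and with $n+2$ ends, one of which is the root while the other ones are labeled by $0,\dots,n$, up to isomorphisms preserving the root and the labels. A Whitehead move on an edge with two distinct trivalent end points collapses this edge and reopens the resulting 4-valent vertex in one of the two other directions. A simultaneous Whitehead move on a graph is a composition of Whitehead moves on any number of pairwise disjoint edges of it (edges that share no vertex). Let $d_S$ be the path metric on each of these three spaces in which two distinct points have distance $1$ if and only if they differ by a simultaneous Whitehead move, and let $\operatorname{diam}_S$ be the diameter. Then there is a constant $K>0$ such that for all $g,p\ge 0$ with $2g-2+p>0$ the three spaces $\mathrm{Graph}(g,p)$, $\mathrm{Graph}(g,p)/\mathrm{Sym}_p$ and $\mathrm{Tree}(g+p)$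 have finite diameter, and $$\tfrac1K\log(g+p)\le \operatorname{diam}_S\big(\mathrm{Graph}(g,p)\big)\le K\log(g+p),$$ $$\tfrac1K\log(g+p)\le \operatorname{diam}_S\big(\mathrm{Graph}(g,p)/\mathrm{Sym}_p\big)\le K\log(g+p),$$ $$\tfrac1K\log(g+p)\le \operatorname{diam}_S\big(\mathrm{Tree}(g+p)\big)\le K\log(g+p),$$ except that the lower bound is not asserted for those spaces that consist of a single point, namely for $\mathrm{Graph}(g,p)$ if $(g,p)\in\{(0,3),(1,1)\}$ and for $\mathrm{Graph}(g,p)/\mathrm{Sym}_p$ if $(g,p)\in\{(0,3),(0,4),(0,5),(1,1)\}$. -/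

import Mathlib

/-- A graph (loops and multiple edges allowed) with vertex set `V`, given by its set `H` of
half-edges: `inv` sends a half-edge to the other half of the same edge, and `base` sends a
half-edge to the vertex it is attached to. The edges are the pairs `{h, inv h}`. -/
@[ext] structure HalfEdgeGraph (V H : Type) where
  inv : H → H
  base : H → V
  inv_inv : ∀ h, inv (inv h) = h
  inv_ne : ∀ h, inv h ≠ h

namespace HalfEdgeGraph

variable {V H V' H' V'' H'' L : Type}

/-- The valence of a vertex; a loop counts twice. -/
noncomputable def valence (G : HalfEdgeGraph V H) (v : V) : ℕ :=
  Nat.card {h : H // G.base h = v}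

/-- The set of edges. -/
def edges (G : HalfEdgeGraph V H) : Set (Sym2 H) :=
  Set.range fun h => s(h, G.inv h)

/-- Any two vertices are joined by an edge path, and there is at least one vertex. -/
def Connected (G : HalfEdgeGraph V H) : Prop :=
  Nonempty V ∧ ∀ u v : V,
    Relation.ReflTransGen (fun x y => ∃ h, G.base h = x ∧ G.base (G.inv h) = y) u v

/-- The rank (first Betti number) of a finite connected graph. -/
noncomputable def rank (G : HalfEdgeGraph V H) : ℤ :=
  (Nat.card G.edges : ℤ) - (Nat.card V : ℤ) + 1

/-- Two graphs are isomorphic. -/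
def Isomorphic (G : HalfEdgeGraph V H) (G' : HalfEdgeGraph V' H') : Prop :=
  ∃ (φ : V ≃ V') (η : H ≃ H'),
    (∀ h, G'.base (η h) = φ (G.base h)) ∧ (∀ h, G'.inv (η h) = η (G.inv h))

/-- Two graphs with labeled vertices are isomorphic by a label-preserving isomorphism. -/
def LabeledIsomorphic (G : HalfEdgeGraph V H) (l : L → V)
    (G' : HalfEdgeGraph V' H') (l' : L → V') : Prop :=
  ∃ (φ : V ≃ V') (η : H ≃ H'),
    (∀ h, G'.base (η h) = φ (G.base h)) ∧ (∀ h, G'.inv (η h) = η (G.inv h)) ∧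
    (∀ i, l' i = φ (l i))

/-- The edges containing the half-edges `e` and `f` are disjoint: they share no vertex. -/
def DisjointEdges (G : HalfEdgeGraph V H) (e f : H) : Prop :=
  Disjoint ({G.base e, G.base (G.inv e)} : Set V) {G.base f, G.base (G.inv f)}

open Classical in
/-- `G'` arises from `G` by a Whitehead move on the edge `{e, inv e}`. This edge has to be
interior (both ends of valence three) with distinct end points `u = base e` and
`w = base (inv e)`. Let `a₁, a₂` be the other two half-edges at `u`, and `b₁, b₂` those at `w`.
Collapsing the edge gives a vertex with the half-edges `a₁, a₂, b₁, b₂`, and reopening it in a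
different direction separates them as `a₂, b₁ | a₁, b₂` or as `a₂, b₂ | a₁, b₁`. This amounts to
exchanging the points of attachment of one `a` at `u` and one `b` at `w`; up to the names of the
two ends of the new edge, the four choices of `a` and `b` yield exactly the two reopenings. -/
def WhiteheadMove (G : HalfEdgeGraph V H) (e : H) (G' : HalfEdgeGraph V H) : Prop :=
  G.base e ≠ G.base (G.inv e) ∧
  G.valence (G.base e) = 3 ∧ G.valence (G.base (G.inv e)) = 3 ∧
  ∃ a b : H,
    (G.base a = G.base e ∧ a ≠ e) ∧
    (G.base b = G.base (G.inv e) ∧ b ≠ G.inv e) ∧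
    G'.inv = G.inv ∧ G'.base = G.base ∘ Equiv.swap a b

/-- `G'` arises from `G` by Whitehead moves on the edges of a list, one after the other. -/
def WhiteheadMoves : List H → HalfEdgeGraph V H → HalfEdgeGraph V H → Prop
  | [], G, G' => G' = G
  | e :: es, G, G' => ∃ G₁, G.WhiteheadMove e G₁ ∧ WhiteheadMoves es G₁ G'

/-- `G'` arises from `G` by a simultaneous Whitehead move: a composition of Whitehead moves on
any number of pairwise disjoint edges of `G`. -/
def SimultaneousWhiteheadMove (G G' : HalfEdgeGraph V H) : Prop :=
  ∃ es : List H, es.Pairwise G.DisjointEdges ∧ WhiteheadMoves es G G'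

theorem LabeledIsomorphic.refl (G : HalfEdgeGraph V H) (l : L → V) :
    G.LabeledIsomorphic l G l :=
  ⟨Equiv.refl V, Equiv.refl H, fun _ => rfl, fun _ => rfl, fun _ => rfl⟩

theorem LabeledIsomorphic.symm {G : HalfEdgeGraph V H} {l : L → V}
    {G' : HalfEdgeGraph V' H'} {l' : L → V'} :
    G.LabeledIsomorphic l G' l' → G'.LabeledIsomorphic l' G l := by
  rintro ⟨φ, η, h1, h2, h3⟩
  refine ⟨φ.symm, η.symm, fun h => ?_, fun h => ?_, fun i => ?_⟩
  · rw [Equiv.eq_symm_apply, ← h1, Equiv.apply_symm_apply]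
  · rw [Equiv.eq_symm_apply, ← h2, Equiv.apply_symm_apply]
  · rw [Equiv.eq_symm_apply, h3]

theorem LabeledIsomorphic.trans {G : HalfEdgeGraph V H} {l : L → V}
    {G' : HalfEdgeGraph V' H'} {l' : L → V'} {G'' : HalfEdgeGraph V'' H''} {l'' : L → V''} :
    G.LabeledIsomorphic l G' l' → G'.LabeledIsomorphic l' G'' l'' →
      G.LabeledIsomorphic l G'' l'' := by
  rintro ⟨φ, η, h1, h2, h3⟩ ⟨φ', η', h1', h2', h3'⟩
  exact ⟨φ.trans φ', η.trans η', fun h => by simp [h1', h1], fun h => by simp [h2', h2],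
    fun i => by simp [h3', h3]⟩

theorem isomorphic_iff (G : HalfEdgeGraph V H) (G' : HalfEdgeGraph V' H') :
    G.Isomorphic G' ↔ G.LabeledIsomorphic Empty.elim G' Empty.elim := by
  constructor
  · rintro ⟨φ, η, h1, h2⟩
    exact ⟨φ, η, h1, h2, fun i => i.elim⟩
  · rintro ⟨φ, η, h1, h2, -⟩
    exact ⟨φ, η, h1, h2⟩

end HalfEdgeGraph

/-- A finite connected graph of rank `g` all of whose vertices have valence 1 or 3, with `p`
vertices of valence 1 and `2g - 2 + p` vertices of valence 3. -/
structure TrivalentGraph (g p : ℕ) where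
  V : Type
  H : Type
  finite_V : Finite V
  finite_H : Finite H
  graph : HalfEdgeGraph V H
  connected : graph.Connected
  rank_eq : graph.rank = g
  valence_eq : ∀ v, graph.valence v = 1 ∨ graph.valence v = 3
  card_one : Nat.card {v : V // graph.valence v = 1} = p
  card_three : (Nat.card {v : V // graph.valence v = 3} : ℤ) = 2 * (g : ℤ) - 2 + (p : ℤ)

/-- Such a graph with its valence-1 vertices marked: they are labeled bijectively by `L`. -/
structure MarkedTrivalentGraph (g p : ℕ) (L : Type) extends TrivalentGraph g p where
  label : L → V
  label_injective : Function.Injective label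
  range_label : Set.range label = {v | graph.valence v = 1}

/-- Isomorphism of unmarked graphs. -/
instance TrivalentGraph.setoid (g p : ℕ) : Setoid (TrivalentGraph g p) where
  r A B := A.graph.Isomorphic B.graph
  iseqv :=
    { refl := fun A => (A.graph.isomorphic_iff A.graph).2 (.refl _ _)
      symm := fun h =>
        (HalfEdgeGraph.isomorphic_iff _ _).2 ((HalfEdgeGraph.isomorphic_iff _ _).1 h).symm
      trans := fun h h' => (HalfEdgeGraph.isomorphic_iff _ _).2
        (((HalfEdgeGraph.isomorphic_iff _ _).1 h).trans
          ((HalfEdgeGraph.isomorphic_iff _ _).1 h')) }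

/-- Label-preserving isomorphism of marked graphs. -/
instance MarkedTrivalentGraph.setoid (g p : ℕ) (L : Type) :
    Setoid (MarkedTrivalentGraph g p L) where
  r A B := A.graph.LabeledIsomorphic A.label B.graph B.label
  iseqv :=
    { refl := fun _ => .refl _ _
      symm := fun h => h.symm
      trans := fun h h' => h.trans h' }

/-- The space of unmarked graphs, up to isomorphism. -/
def UnmarkedGraphSpace (g p : ℕ) : Type 1 :=
  Quotient (TrivalentGraph.setoid g p)

/-- The space of marked graphs with labels in `L`, up to label-preserving isomorphism. -/
def LabeledGraphSpace (g p : ℕ) (L : Type) : Type 1 :=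
  Quotient (MarkedTrivalentGraph.setoid g p L)

/-- The class `Y` contains a graph that arises by a simultaneous Whitehead move from a graph in
the class `X`. -/
def UnmarkedGraphSpace.Move {g p : ℕ} (X Y : UnmarkedGraphSpace g p) : Prop :=
  ∃ A B : TrivalentGraph g p,
    Quotient.mk _ A = X ∧ Quotient.mk _ B = Y ∧
    ∃ G : HalfEdgeGraph A.V A.H,
      A.graph.SimultaneousWhiteheadMove G ∧ G.Isomorphic B.graph

/-- The class `Y` contains a graph that arises by a simultaneous Whitehead move from a graph in
the class `X`; the labels of the valence-1 vertices are carried along. -/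
def LabeledGraphSpace.Move {g p : ℕ} {L : Type} (X Y : LabeledGraphSpace g p L) : Prop :=
  ∃ A B : MarkedTrivalentGraph g p L,
    Quotient.mk _ A = X ∧ Quotient.mk _ B = Y ∧
    ∃ G : HalfEdgeGraph A.V A.H,
      A.graph.SimultaneousWhiteheadMove G ∧ G.LabeledIsomorphic A.label B.graph B.label

/-- Two distinct classes of unmarked graphs are adjacent when they differ by a simultaneous
Whitehead move. The metric of simultaneous Whitehead moves is the path metric
`SimpleGraph.edist` of this graph. -/
def unmarkedMoves (g p : ℕ) : SimpleGraph (UnmarkedGraphSpace g p) :=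
  SimpleGraph.fromRel UnmarkedGraphSpace.Move

/-- The same for graphs marked by `L`. -/
def labeledMoves (g p : ℕ) (L : Type) : SimpleGraph (LabeledGraphSpace g p L) :=
  SimpleGraph.fromRel LabeledGraphSpace.Move

/-- The same for graphs with `p` valence-1 vertices marked by `0, …, p - 1`. -/
abbrev markedMoves (g p : ℕ) : SimpleGraph (LabeledGraphSpace g p (Fin p)) :=
  labeledMoves g p (Fin p)

/-- The same for labeled binary trees of complexity `n`: trees with all valences 1 or 3 and
`n + 2` ends, one of which (labeled `none`) is the root, while the other ones are labeled by
`0, …, n`. -/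
abbrev treeMoves (n : ℕ) : SimpleGraph (LabeledGraphSpace 0 (n + 2) (Option (Fin (n + 1)))) :=
  labeledMoves 0 (n + 2) (Option (Fin (n + 1)))

/-- The diameter of `S` (in its path metric) is finite and at most `c`. -/
def DiamAtMost {α : Type*} (S : SimpleGraph α) (c : ℝ) : Prop :=
  S.ediam ≠ ⊤ ∧ (S.diam : ℝ) ≤ c

/-- The diameter of `S` (in its path metric) is finite and at least `c`. -/
def DiamAtLeast {α : Type*} (S : SimpleGraph α) (c : ℝ) : Prop :=
  S.ediam ≠ ⊤ ∧ c ≤ (S.diam : ℝ)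

/-! Put N = 2g + p, which is comparable to g + p. Cutting a graph at g suitable edges leaves a
binary tree with N ends, of which 2g are to be glued back in pairs. On such a tree a Whitehead move
is a rotation, and exchanging two siblings costs nothing because the tree is not planar. The upper
bounds thus reduce to one fact: two binary trees with the same N distinct labels are O(log N)
parallel rewriting steps apart (`exists_common_reach`).

This is shown in two stages. Parallel contraction: in three steps enough leaves are paired into
cherries that the number of blobs drops to at most 3/4 (`exists_contraction`); O(log N) rounds give
a tree of height O(log N). Sorting: number the labels with L = O(log N) bits and aim at the binary
trie of the label set, which does not depend on the tree. Merging the tries of two sibling subtrees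
takes one interchange ((ab)(cd)) to ((ac)(bd)) per level. Merges at different heights are pipelined:
a node starts on its top level as soon as its children have formed theirs, so the time is of order
height + L and not height times L (`reachO_sortStage`).

The transfer to graphs rests on three facts: every marked graph is cut to a tree
(`MarkedTrivalentGraph.exists_isTree`), a rewriting step is one simultaneous Whitehead move
(`IsTree.exists_move`), and graphs glued from the same labeled tree are isomorphic
(`labeledIsomorphic_of_isTree`).

For the lower bounds, a simultaneous move carries each half-edge at most along one edge common to
both graphs, so the diameter of the graph itself changes by a factor of at most 3. A suitably glued
caterpillar has diameter at least N - 3, a graph glued from a shallow tree only O(log N); hence 3^D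
O(log N) ≥ N - 3 for the diameter D of the space (`le_three_pow_diam`). For small N the estimate is
void and D ≥ 1 is used, which needs two distinct points. Forgetting labels is a surjection that does
not increase distances: upper bounds pass to unmarked graphs, lower bounds to marked ones. Trees are
the case of rank 0. -/

/-- Binary trees with labeled leaves. -/
inductive LeafTree (α : Type) : Type
  | leaf : α → LeafTree α
  | node : LeafTree α → LeafTree α → LeafTree α

/-! ### Parallel rewriting of labeled binary trees -/

namespace LeafTree

variable {α β : Type}

/-- The list of the labels of the leaves. -/
def labels : LeafTree α → List α
  | leaf a => [a]
  | node l r => l.labels ++ r.labels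

/-- Substitution of trees for the leaves. -/
def bind : LeafTree α → (α → LeafTree β) → LeafTree β
  | leaf a, f => f a
  | node l r, f => node (l.bind f) (r.bind f)

/-- Relabeling of the leaves. -/
def map (f : α → β) : LeafTree α → LeafTree β
  | leaf a => leaf (f a)
  | node l r => node (l.map f) (r.map f)

/-- The height of a tree; a leaf has height zero. -/
def height : LeafTree α → ℕ
  | leaf _ => 0
  | node l r => max l.height r.height + 1

/-- Simultaneous rewriting of a tree by disjoint rotations and exchanges of siblings. -/
inductive Step : LeafTree α → LeafTree α → Prop
  | leaf (a : α) : Step (leaf a) (leaf a)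
  | node {l l' r r' : LeafTree α} : Step l l' → Step r r' → Step (node l r) (node l' r')
  | swap {l l' r r' : LeafTree α} : Step l l' → Step r r' → Step (node l r) (node r' l')
  | rot {a a' b b' c c' : LeafTree α} : Step a a' → Step b b' → Step c c' →
      Step (node (node a b) c) (node a' (node b' c'))
  | rotInv {a a' b b' c c' : LeafTree α} : Step a a' → Step b b' → Step c c' →
      Step (node a (node b c)) (node (node a' b') c')

theorem Step.refl (t : LeafTree α) : Step t t := by
  induction t with
  | leaf a => exact .leaf a
  | node l r hl hr => exact .node hl hr

theorem Step.symm {s t : LeafTree α} (h : Step s t) : Step t s := by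
  induction h with
  | leaf a => exact .leaf a
  | node _ _ h1 h2 => exact .node h1 h2
  | swap _ _ h1 h2 => exact .swap h2 h1
  | rot _ _ _ h1 h2 h3 => exact .rotInv h1 h2 h3
  | rotInv _ _ _ h1 h2 h3 => exact .rot h1 h2 h3

/-- The rewriting of the pattern and that of the substituted trees touch different nodes, so both
fit into a single step. -/
theorem Step.bind {P Q : LeafTree β} (h : Step P Q) {f f' : β → LeafTree α}
    (hf : ∀ b, Step (f b) (f' b)) : Step (P.bind f) (Q.bind f') := by
  induction h with
  | leaf a => exact hf a
  | node _ _ h1 h2 => exact .node h1 h2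
  | swap _ _ h1 h2 => exact .swap h1 h2
  | rot _ _ _ h1 h2 h3 => exact .rot h1 h2 h3
  | rotInv _ _ _ h1 h2 h3 => exact .rotInv h1 h2 h3

/-- Reachability by a given number of rewriting steps. -/
def Reach : ℕ → LeafTree α → LeafTree α → Prop
  | 0, s, t => s = t
  | n + 1, s, t => ∃ u, Step s u ∧ Reach n u t

theorem Reach.refl (n : ℕ) (t : LeafTree α) : Reach n t t := by
  induction n with
  | zero => rfl
  | succ n ih => exact ⟨t, .refl t, ih⟩

theorem Reach.trans {m n : ℕ} {s t u : LeafTree α} (h : Reach m s t) (h' : Reach n t u) :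
    Reach (m + n) s u := by
  induction m generalizing s with
  | zero => cases h; simpa using h'
  | succ m ih =>
    obtain ⟨v, hv, h⟩ := h
    rw [Nat.succ_add]
    exact ⟨v, hv, ih h⟩

theorem Step.reach {s t : LeafTree α} (h : Step s t) : Reach 1 s t := ⟨t, h, rfl⟩

theorem Reach.symm {n : ℕ} {s t : LeafTree α} (h : Reach n s t) : Reach n t s := by
  induction n generalizing s with
  | zero => exact Eq.symm h
  | succ n ih =>
    obtain ⟨v, hv, h⟩ := h
    exact (ih h).trans hv.symm.reach

theorem Reach.mono {m n : ℕ} {s t : LeafTree α} (h : Reach m s t) (hmn : m ≤ n) :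
    Reach n s t := by
  obtain ⟨k, rfl⟩ := Nat.exists_eq_add_of_le hmn
  exact h.trans (.refl k t)

/-- Pattern and substituted trees evolve during the same `n` steps, so their costs do not add up.
All parallelism below comes from this. -/
theorem Reach.bind {n : ℕ} {P Q : LeafTree β} (h : Reach n P Q) {f f' : β → LeafTree α}
    (hf : ∀ b, Reach n (f b) (f' b)) : Reach n (P.bind f) (Q.bind f') := by
  induction n generalizing P f with
  | zero =>
    cases h
    have : f = f' := funext hf
    rw [this]; rfl
  | succ n ih =>
    obtain ⟨u, hu, h⟩ := h
    choose g hg hg' using hf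
    exact ⟨u.bind g, hu.bind hg, ih h hg'⟩

theorem bind_leaf (t : LeafTree α) (f : α → β) : t.bind (fun a => leaf (f a)) = t.map f := by
  induction t with
  | leaf a => rfl
  | node l r hl hr => simp [LeafTree.bind, map, hl, hr]

theorem Reach.map {n : ℕ} {s t : LeafTree α} (h : Reach n s t) (f : α → β) :
    Reach n (s.map f) (t.map f) := by
  rw [← bind_leaf, ← bind_leaf]
  exact h.bind fun _ => .refl _ _

theorem map_map {γ : Type} (t : LeafTree α) (f : α → β) (g : β → γ) :
    (t.map f).map g = t.map (g ∘ f) := by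
  induction t with
  | leaf a => rfl
  | node l r hl hr => simp [map, hl, hr]

theorem map_id' (t : LeafTree α) (f : α → α) (hf : ∀ a ∈ t.labels, f a = a) : t.map f = t := by
  induction t with
  | leaf a => simp [map, hf a (by simp [labels])]
  | node l r hl hr =>
    rw [map, hl fun a ha => hf a (by simp [labels, ha]),
      hr fun a ha => hf a (by simp [labels, ha])]

theorem labels_map (t : LeafTree α) (f : α → β) : (t.map f).labels = t.labels.map f := by
  induction t with
  | leaf a => rfl
  | node l r hl hr => simp [labels, map, hl, hr]

theorem height_map (t : LeafTree α) (f : α → β) : (t.map f).height = t.height := by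
  induction t with
  | leaf a => rfl
  | node l r hl hr => simp [height, map, hl, hr]

theorem Step.labels_perm {s t : LeafTree α} (h : Step s t) : s.labels.Perm t.labels := by
  induction h with
  | leaf a => exact .refl _
  | node _ _ h1 h2 => exact h1.append h2
  | swap _ _ h1 h2 => exact (h1.append h2).trans List.perm_append_comm
  | rot _ _ _ h1 h2 h3 =>
    simp only [labels, List.append_assoc]; exact h1.append (h2.append h3)
  | rotInv _ _ _ h1 h2 h3 =>
    simp only [labels, List.append_assoc]; exact h1.append (h2.append h3)

theorem Reach.labels_perm {n : ℕ} {s t : LeafTree α} (h : Reach n s t) :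
    s.labels.Perm t.labels := by
  induction n generalizing s with
  | zero => cases h; exact .refl _
  | succ n ih =>
    obtain ⟨u, hu, h⟩ := h
    exact hu.labels_perm.trans (ih h)

theorem labels_length_pos (t : LeafTree α) : 0 < t.labels.length := by
  induction t with
  | leaf a => simp [labels]
  | node l r hl hr => simp [labels]; omega

/-! ### Parallel rewriting inside fixed patterns -/

theorem Reach.node {n : ℕ} {l l' r r' : LeafTree α} (hl : Reach n l l') (hr : Reach n r r') :
    Reach n (node l r) (node l' r') :=
  Reach.bind (P := .node (.leaf true) (.leaf false)) (Q := .node (.leaf true) (.leaf false))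
    (f := fun b => if b then l else r) (f' := fun b => if b then l' else r') (.refl _ _)
    (by rintro (_ | _) <;> assumption)

theorem Reach.pattern {n : ℕ} {P Q : LeafTree (Fin 4)} (h : Reach n P Q)
    {a a' b b' c c' d d' : LeafTree α} (ha : Reach n a a') (hb : Reach n b b')
    (hc : Reach n c c') (hd : Reach n d d') :
    Reach n (P.bind ![a, b, c, d]) (Q.bind ![a', b', c', d']) :=
  h.bind (by intro i; fin_cases i <;> assumption)

/-- Rotate to the comb a(b(cd)), exchange b and c inside it, and rotate back. These five steps are
the cost of one time unit of sorting. -/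
theorem reach_interchange (a b c d : α) :
    Reach 5 (node (node (leaf a) (leaf b)) (node (leaf c) (leaf d)))
      (node (node (leaf a) (leaf c)) (node (leaf b) (leaf d))) :=
  ⟨_, .rot (.leaf _) (.leaf _) (.refl _), _, .node (.leaf _) (.rotInv (.leaf _) (.leaf _) (.leaf _)),
    _, .node (.leaf _) (.node (.swap (.leaf _) (.leaf _)) (.leaf _)),
    _, .node (.leaf _) (.rot (.leaf _) (.leaf _) (.leaf _)),
    _, .rotInv (.leaf _) (.leaf _) (.refl _), rfl⟩

/-- `node` for possibly empty trees. -/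
def nodeO : Option (LeafTree α) → Option (LeafTree α) → Option (LeafTree α)
  | none, t => t
  | some s, none => some s
  | some s, some t => some (node s t)

/-- `Reach` for possibly empty trees. -/
def ReachO (n : ℕ) : Option (LeafTree α) → Option (LeafTree α) → Prop
  | none, none => True
  | some s, some t => Reach n s t
  | _, _ => False

theorem ReachO.nodeO {n : ℕ} {l l' r r' : Option (LeafTree α)} (hl : ReachO n l l')
    (hr : ReachO n r r') : ReachO n (nodeO l r) (nodeO l' r') := by
  rcases l with _ | l <;> rcases l' with _ | l' <;> rcases r with _ | r <;>
    rcases r' with _ | r' <;> simp_all [ReachO, LeafTree.nodeO]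
  exact hl.node hr

theorem ReachO.refl (n : ℕ) (t : Option (LeafTree α)) : ReachO n t t := by
  rcases t with _ | t
  · trivial
  · exact Reach.refl n t

/-- Any of the four corners may be empty. In each of the sixteen cases what remains of the
interchange still takes at most five steps. -/
theorem ReachO.interchange {a a' b b' c c' d d' : Option (LeafTree α)} (ha : ReachO 5 a a')
    (hb : ReachO 5 b b') (hc : ReachO 5 c c') (hd : ReachO 5 d d') :
    ReachO 5 (LeafTree.nodeO (LeafTree.nodeO a b) (LeafTree.nodeO c d))
      (LeafTree.nodeO (LeafTree.nodeO a' c') (LeafTree.nodeO b' d')) := by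
  have L := @Step.leaf (Fin 4)
  rcases a with _ | a <;> rcases a' with _ | a' <;> try exact ha.elim
  all_goals rcases b with _ | b <;> rcases b' with _ | b' <;> try exact hb.elim
  all_goals rcases c with _ | c <;> rcases c' with _ | c' <;> try exact hc.elim
  all_goals rcases d with _ | d <;> rcases d' with _ | d' <;> try exact hd.elim
  · trivial
  · exact hd
  · exact hc
  · exact Reach.node hc hd
  · exact hb
  · exact Reach.node hb hd
  -- Positions that do not occur in the patterns are filled with some tree at hand.
  · exact Reach.pattern (P := .node (.leaf 1) (.leaf 2)) (Q := .node (.leaf 2) (.leaf 1))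
      (Reach.mono (m := 1) ⟨_, .swap (L _) (L _), rfl⟩ (by norm_num)) hb hb hc hc
  · exact Reach.pattern (P := .node (.leaf 1) (.node (.leaf 2) (.leaf 3)))
      (Q := .node (.leaf 2) (.node (.leaf 1) (.leaf 3)))
      (Reach.mono (m := 3) ⟨_, .rotInv (L _) (L _) (L _), _, .node (.swap (L _) (L _)) (L _), _,
        .rot (L _) (L _) (L _), rfl⟩ (by norm_num)) hb hb hc hd
  · exact ha
  · exact Reach.node ha hd
  · exact Reach.node ha hc
  · exact Reach.pattern (P := .node (.leaf 0) (.node (.leaf 2) (.leaf 3)))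
      (Q := .node (.node (.leaf 0) (.leaf 2)) (.leaf 3))
      (Reach.mono (m := 1) ⟨_, .rotInv (L _) (L _) (L _), rfl⟩ (by norm_num)) ha hd hc hd
  · exact Reach.node ha hb
  · exact Reach.pattern (P := .node (.node (.leaf 0) (.leaf 1)) (.leaf 3))
      (Q := .node (.leaf 0) (.node (.leaf 1) (.leaf 3)))
      (Reach.mono (m := 1) ⟨_, .rot (L _) (L _) (L _), rfl⟩ (by norm_num)) ha hb hb hd
  · exact Reach.pattern (P := .node (.node (.leaf 0) (.leaf 1)) (.leaf 2))
      (Q := .node (.node (.leaf 0) (.leaf 2)) (.leaf 1))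
      (Reach.mono (m := 3) ⟨_, .rot (L _) (L _) (L _), _, .node (L _) (.swap (L _) (L _)), _,
        .rotInv (L _) (L _) (L _), rfl⟩ (by norm_num)) ha hb hc hc
  · exact Reach.pattern (reach_interchange 0 1 2 3) ha hb hc hd

/-! ### Sorting the labels of a shallow tree by pipelined merging of tries -/

/-- The part of the tree `t` at time `τ` of the sorting process that carries the labels `x` with
`x / 2 ^ r = w`. -/
def sortStage (L τ : ℕ) : LeafTree ℕ → ℕ → ℕ → Option (LeafTree ℕ)
  | leaf x, r, w => if x / 2 ^ r = w then some (leaf x) else none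
  | node a b, 0, w => nodeO (sortStage L τ a 0 w) (sortStage L τ b 0 w)
  | node a b, r + 1, w =>
    -- Level `r + 1` of the trie of a node of height `h` is formed from time `h + L - r` on; before
    -- that the two subtrees still contribute separately. The frontier descends by one bit per time
    -- unit, and children are at least one unit ahead of their parent.
    if (node a b).height + L ≤ τ + r then
      nodeO (sortStage L τ (node a b) r (2 * w)) (sortStage L τ (node a b) r (2 * w + 1))
    else nodeO (sortStage L τ a (r + 1) w) (sortStage L τ b (r + 1) w)
termination_by t r => (t, r)

/-- A single leaf is a trie at all times, since it lies in exactly one of the two halves of its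
class; leaves and nodes can therefore be treated alike. -/
theorem sortStage_formed {L τ r : ℕ} {t : LeafTree ℕ} (h : t.height + L ≤ τ + r) (w : ℕ) :
    sortStage L τ t (r + 1) w =
      nodeO (sortStage L τ t r (2 * w)) (sortStage L τ t r (2 * w + 1)) := by
  cases t with
  | leaf x =>
    have h2 : x / 2 ^ (r + 1) = x / 2 ^ r / 2 := by rw [pow_succ, Nat.div_div_eq_div_mul]
    simp only [sortStage, h2]
    generalize x / 2 ^ r = y
    split_ifs <;> first | rfl | omega
  | node a b => rw [sortStage, if_pos h]

/-- The summand 1 accounts for the definition being indexed by `r + 1`. At level 0 there is no bit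
left to split by. -/
theorem sortStage_unformed {L τ r : ℕ} {a b : LeafTree ℕ}
    (h : τ + r < (node a b).height + L + 1) (w : ℕ) :
    sortStage L τ (node a b) r w = nodeO (sortStage L τ a r w) (sortStage L τ b r w) := by
  cases r with
  | zero => rw [sortStage]
  | succ r => rw [sortStage, if_neg (by omega)]

/-- At a given node only the level with `height + L = τ + r + 1` changes its shape during the time
unit. There both children have already split by the next bit, and a single interchange regroups the
four parts by this bit instead of by child. All smaller parts evolve simultaneously by induction. -/
theorem reachO_sortStage (L τ : ℕ) (t : LeafTree ℕ) (r w : ℕ) :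
    ReachO 5 (sortStage L τ t r w) (sortStage L (τ + 1) t r w) := by
  induction t generalizing r w with
  | leaf x => simp only [sortStage]; exact .refl _ _
  | node a b iha ihb =>
    induction r generalizing w with
    | zero => simp only [sortStage]; exact (iha _ _).nodeO (ihb _ _)
    | succ r ih =>
      rcases Nat.lt_trichotomy ((node a b).height + L) (τ + r + 1) with h | h | h
      · rw [sortStage_formed (by omega), sortStage_formed (by omega)]
        exact (ih _).nodeO (ih _)
      · have ha : a.height + 1 ≤ (node a b).height := by simp [height]
        have hb : b.height + 1 ≤ (node a b).height := by simp [height]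
        rw [sortStage_unformed (by omega), sortStage_formed (t := node a b) (by omega),
          sortStage_formed (t := a) (by omega), sortStage_formed (t := b) (by omega),
          sortStage_unformed (by omega), sortStage_unformed (by omega)]
        exact .interchange (iha _ _) (iha _ _) (ihb _ _) (ihb _ _)
      · rw [sortStage_unformed (by omega), sortStage_unformed (by omega)]
        exact (iha _ _).nodeO (ihb _ _)

theorem sortStage_zero {L : ℕ} {t : LeafTree ℕ} (ht : ∀ x ∈ t.labels, x < 2 ^ L) :
    sortStage L 0 t L 0 = some t := by
  induction t with
  | leaf x =>
    have := ht x (by simp [labels])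
    rw [sortStage, if_pos (Nat.div_eq_of_lt this)]
  | node a b iha ihb =>
    rw [sortStage_unformed (by simp [height]),
      iha fun x hx => ht x (by simp [labels, hx]), ihb fun x hx => ht x (by simp [labels, hx])]
    rfl

open Classical in
/-- The binary trie of the elements `x` of `S` with `x / 2 ^ r = w`. -/
noncomputable def trie (S : Set ℕ) : ℕ → ℕ → Option (LeafTree ℕ)
  | 0, w => if w ∈ S then some (leaf w) else none
  | r + 1, w => nodeO (trie S r (2 * w)) (trie S r (2 * w + 1))

/-- After time `height + L` every level is formed. At level 0 distinctness of the labels prevents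
both subtrees from contributing. -/
theorem sortStage_eq_trie {L τ r : ℕ} {t : LeafTree ℕ} (ht : t.labels.Nodup)
    (h : t.height + L ≤ τ) (w : ℕ) : sortStage L τ t r w = trie {x | x ∈ t.labels} r w := by
  induction r generalizing w with
  | zero =>
    clear h
    induction t with
    | leaf x => simp [sortStage, trie, labels, eq_comm]; split_ifs <;> simp_all
    | node a b iha ihb =>
      simp only [labels, List.nodup_append] at ht
      rw [sortStage, iha ht.1, ihb ht.2.1]
      simp only [trie, labels, Set.mem_ofPred_eq, List.mem_append]
      by_cases h1 : w ∈ a.labels <;> by_cases h2 : w ∈ b.labels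
      · exact absurd rfl (ht.2.2 _ h1 _ h2)
      all_goals simp [h1, h2, nodeO]
  | succ r ih => rw [sortStage_formed (by omega), trie, ih, ih]

theorem reachO_sortStage_zero (L τ : ℕ) (t : LeafTree ℕ) (r w : ℕ) :
    ReachO (5 * τ) (sortStage L 0 t r w) (sortStage L τ t r w) := by
  induction τ with
  | zero => exact .refl _ _
  | succ τ ih =>
    have := reachO_sortStage L τ t r w
    revert ih this
    rcases sortStage L 0 t r w with _ | a <;> rcases sortStage L τ t r w with _ | b <;>
      rcases sortStage L (τ + 1) t r w with _ | c <;> simp [ReachO]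
    intro h1 h2
    exact h1.trans h2

theorem trie_height {S : Set ℕ} {r w : ℕ} {t : LeafTree ℕ} (h : trie S r w = some t) :
    t.height ≤ r := by
  induction r generalizing w t with
  | zero =>
    rw [trie] at h
    split_ifs at h
    cases h; simp [height]
  | succ r ih =>
    rw [trie] at h
    rcases h1 : trie S r (2 * w) with _ | a <;> rcases h2 : trie S r (2 * w + 1) with _ | b <;>
      rw [h1, h2] at h <;> simp only [nodeO] at h <;> cases h
    · exact (ih h2).trans (by omega)
    · exact (ih h1).trans (by omega)
    · have := ih h1; have := ih h2; simp [height]; omega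

/-- A shallow tree is sorted quickly. -/
theorem exists_reach_trie {L : ℕ} {t : LeafTree ℕ} (ht : t.labels.Nodup)
    (hL : ∀ x ∈ t.labels, x < 2 ^ L) :
    ∃ s, trie {x | x ∈ t.labels} L 0 = some s ∧ Reach (5 * (t.height + L)) t s := by
  have h := reachO_sortStage_zero L (t.height + L) t L 0
  rw [sortStage_zero hL, sortStage_eq_trie ht le_rfl] at h
  revert h
  rcases trie {x | x ∈ t.labels} L 0 with _ | s
  · exact fun h => h.elim
  · exact fun h => ⟨s, rfl, h⟩

/-! ### Making a tree shallow by parallel contraction -/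

theorem Reach.pattern_compress {P : LeafTree (Fin 4)}
    (h : Reach 3 P (.node (.leaf 0) (.node (.leaf 1) (.leaf 2)))) {a a' : LeafTree α}
    (ha : Reach 3 a a') (b c : LeafTree α) :
    Reach 3 (P.bind ![a, b, c, c]) (.node a' (.node b c)) :=
  Reach.pattern h ha (.refl _ b) (.refl _ c) (.refl _ c)

/-- `s` is a tree of blobs of height at most one, with a definite proportion of blobs less than
the number of leaves of `t`. -/
def Contraction (t : LeafTree α) (s : LeafTree (LeafTree α)) : Prop :=
  Reach 3 t (s.bind id) ∧ (∀ b ∈ s.labels, b.height ≤ 1) ∧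
    -- The summand 1 is slack that pays for a leaf left unpaired beside two contracted trees. The
    -- bound is attained by three leaves in two blobs.
    (4 * s.labels.length + 1 ≤ 3 * t.labels.length ∨
      s.labels.length = 1 ∧ t.labels.length = 1)

theorem Contraction.node {t t' : LeafTree α} {s s' : LeafTree (LeafTree α)}
    (h : Contraction t s) (h' : Contraction t' s')
    (h2 : 2 ≤ t.labels.length) (h2' : 2 ≤ t'.labels.length) :
    Contraction (.node t t') (.node s s') := by
  refine ⟨h.1.node h'.1, fun b hb => ?_, ?_⟩
  · rcases List.mem_append.1 hb with hb | hb
    exacts [h.2.1 b hb, h'.2.1 b hb]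
  · have := h.2.2; have := h'.2.2; simp [labels]; omega

/-- Two leaves that follow each other along a path become a cherry while the rest `a` is contracted
during the same steps. Trading two leaves for one blob is better than the ratio requires, which
covers the case of a single leaf `a`. -/
theorem Contraction.compress {P : LeafTree (Fin 4)}
    (h : Reach 3 P (.node (.leaf 0) (.node (.leaf 1) (.leaf 2)))) {a : LeafTree α}
    {s : LeafTree (LeafTree α)} (ha : Contraction a s) (x y : α) :
    Contraction (P.bind ![a, .leaf x, .leaf y, .leaf y])
      (.node s (.leaf (.node (.leaf x) (.leaf y)))) := by
  have h3 := Reach.pattern_compress h ha.1 (.leaf x) (.leaf y)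
  refine ⟨h3, fun b hb => ?_, ?_⟩
  · rcases List.mem_append.1 hb with hb | hb
    · exact ha.2.1 b hb
    · simp [labels] at hb; subst hb; simp [height]
  · have h4 := h3.labels_perm.length_eq
    have h5 := ha.1.labels_perm.length_eq
    have := ha.2.2
    rw [h4]
    simp [labels]; omega

theorem two_le_length (l r : LeafTree α) : 2 ≤ (node l r).labels.length := by
  have := l.labels_length_pos; have := r.labels_length_pos
  simp [labels]; omega

/-- If a leaf hangs at the top and another one just below, the two are brought together. If a leaf
hangs above two trees with at least two leaves each, it stays alone and the slack of these trees
pays for it. If no leaf hangs at the top, both sides contract independently. -/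
theorem exists_contraction : (t : LeafTree α) → ∃ s, Contraction t s
  | leaf x => ⟨.leaf (.leaf x), .refl _ _, by simp [labels, height], by simp [labels]⟩
  | node (leaf x) (leaf y) =>
    ⟨.leaf (.node (.leaf x) (.leaf y)), .refl _ _, by simp [labels, height], by simp [labels]⟩
  | node (node a (leaf x)) (leaf y) =>
    let ⟨_, h⟩ := exists_contraction a
    ⟨_, h.compress (P := .node (.node (.leaf 0) (.leaf 1)) (.leaf 2))
      (.mono (m := 1) ⟨_, .rot (.leaf _) (.leaf _) (.leaf _), rfl⟩ (by norm_num)) x y⟩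
  | node (node (leaf x) (node a b)) (leaf y) =>
    let ⟨_, h⟩ := exists_contraction (node a b)
    ⟨_, h.compress (P := .node (.node (.leaf 1) (.leaf 0)) (.leaf 2))
      (.mono (m := 2) ⟨_, .node (.swap (.leaf _) (.leaf _)) (.leaf _),
        _, .rot (.leaf _) (.leaf _) (.leaf _), rfl⟩ (by norm_num)) x y⟩
  | node (leaf y) (node a (leaf x)) =>
    let ⟨_, h⟩ := exists_contraction a
    ⟨_, h.compress (P := .node (.leaf 2) (.node (.leaf 0) (.leaf 1)))
      (.mono (m := 2) ⟨_, .swap (.leaf _) (.refl _),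
        _, .rot (.leaf _) (.leaf _) (.leaf _), rfl⟩ (by norm_num)) x y⟩
  | node (leaf y) (node (leaf x) (node a b)) =>
    let ⟨_, h⟩ := exists_contraction (node a b)
    ⟨_, h.compress (P := .node (.leaf 2) (.node (.leaf 1) (.leaf 0)))
      (.mono (m := 2) ⟨_, .swap (.leaf _) (.swap (.leaf _) (.leaf _)),
        _, .rot (.leaf _) (.leaf _) (.leaf _), rfl⟩ (by norm_num)) x y⟩
  | node (node (node a b) (node c d)) (leaf y) =>
    let ⟨s, h⟩ := exists_contraction (node a b)
    let ⟨s', h'⟩ := exists_contraction (node c d)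
    ⟨.node (.node s s') (.leaf (.leaf y)), (h.1.node h'.1).node (.refl _ _), by
      intro b hb
      simp only [labels, List.mem_append, List.mem_singleton] at hb
      rcases hb with (hb | hb) | rfl
      exacts [h.2.1 b hb, h'.2.1 b hb, by simp [height]], by
      have := h.2.2; have := h'.2.2
      have := two_le_length a b; have := two_le_length c d
      simp only [labels, List.length_append, List.length_singleton] at *; omega⟩
  | node (leaf y) (node (node a b) (node c d)) =>
    let ⟨s, h⟩ := exists_contraction (node a b)
    let ⟨s', h'⟩ := exists_contraction (node c d)
    ⟨.node (.leaf (.leaf y)) (.node s s'), .node (.refl _ _) (h.1.node h'.1), by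
      intro b hb
      simp only [labels, List.mem_append, List.mem_singleton] at hb
      rcases hb with rfl | hb | hb
      exacts [by simp [height], h.2.1 b hb, h'.2.1 b hb], by
      have := h.2.2; have := h'.2.2
      have := two_le_length a b; have := two_le_length c d
      simp only [labels, List.length_append, List.length_singleton] at *; omega⟩
  | node (node a b) (node c d) =>
    let ⟨_, h⟩ := exists_contraction (node a b)
    let ⟨_, h'⟩ := exists_contraction (node c d)
    ⟨_, h.node h' (two_le_length a b) (two_le_length c d)⟩

theorem bind_bind_id (s : LeafTree (LeafTree (LeafTree α))) :
    (s.bind id).bind id = (s.map fun b => b.bind id).bind id := by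
  induction s with
  | leaf b => rfl
  | node l r hl hr => simp [bind, map, hl, hr]

theorem height_bind_le {t : LeafTree (LeafTree α)} {k : ℕ} (h : ∀ b ∈ t.labels, b.height ≤ k) :
    (t.bind id).height ≤ t.height + k := by
  induction t with
  | leaf b => simpa [bind, height, labels] using h
  | node l r hl hr =>
    have := hl fun b hb => h b (by simp [labels, hb])
    have := hr fun b hb => h b (by simp [labels, hb])
    simp [bind, height]; omega

theorem mem_labels_bind {t : LeafTree (LeafTree α)} {x : α} :
    x ∈ (t.bind id).labels ↔ ∃ b ∈ t.labels, x ∈ b.labels := by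
  induction t with
  | leaf b => simp [bind, labels]
  | node l r hl hr => simp [bind, labels, hl, hr, or_and_right, exists_or]

/-- Each round takes three steps, multiplies the number of blobs by at most 3/4, and raises their
height by at most one, as new blobs are single old blobs or cherries of old ones. -/
theorem exists_reach_shallow_blobs (R k : ℕ) (T : LeafTree (LeafTree α))
    (hk : ∀ b ∈ T.labels, b.height ≤ k) (hR : 3 ^ R * T.labels.length ≤ 4 ^ R) :
    ∃ t, Reach (3 * R) (T.bind id) t ∧ t.height ≤ k + R := by
  induction R generalizing k T with
  | zero =>
    cases T with
    | leaf b => exact ⟨b, .refl _ _, by simpa using hk b (by simp [labels])⟩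
    | node l r => have := two_le_length l r; omega
  | succ R ih =>
    obtain ⟨s, h1, h2, h3⟩ := exists_contraction T
    rcases h3 with h3 | h3
    · obtain ⟨t, ht, hh⟩ := ih (k + 1) (s.map fun b => b.bind id) (by
        rw [labels_map]
        intro b hb
        obtain ⟨c, hc, rfl⟩ := List.mem_map.1 hb
        have hck := height_bind_le (t := c) (k := k) fun b hb => by
          refine hk b (h1.labels_perm.mem_iff.2 (mem_labels_bind.2 ⟨c, hc, hb⟩))
        have := h2 c hc
        omega) (by
        rw [labels_map, List.length_map]
        rw [pow_succ, pow_succ] at hR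
        have : 3 ^ R * (4 * s.labels.length) ≤ 3 ^ R * (3 * T.labels.length) :=
          Nat.mul_le_mul_left _ (by omega)
        nlinarith)
      refine ⟨t, ?_, by omega⟩
      have h4 := Reach.bind h1 (f := id) (f' := id) fun b => .refl _ _
      rw [bind_bind_id] at h4
      exact (h4.trans ht).mono (by omega)
    · cases T with
      | leaf b =>
        exact ⟨b, .refl _ _, (hk b (by simp [labels])).trans (by omega)⟩
      | node l r => have := two_le_length l r; omega

theorem exists_reach_shallow {L : ℕ} (t : LeafTree α) (hL : t.labels.length ≤ 2 ^ L) :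
    ∃ s, Reach (9 * L) t s ∧ s.height ≤ 3 * L := by
  -- Three rounds halve the number of blobs, as 2 · 3³ ≤ 4³.
  obtain ⟨s, hs, hh⟩ := exists_reach_shallow_blobs (3 * L) 0 (t.map leaf) (by
      rw [labels_map]
      intro b hb
      obtain ⟨c, -, rfl⟩ := List.mem_map.1 hb
      rfl) (by
      rw [labels_map, List.length_map, pow_mul, pow_mul]
      calc (3 ^ 3) ^ L * t.labels.length ≤ (3 ^ 3) ^ L * 2 ^ L := Nat.mul_le_mul_left _ hL
        _ = (3 ^ 3 * 2) ^ L := (mul_pow ..).symm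
        _ ≤ (4 ^ 3) ^ L := Nat.pow_le_pow_left (by norm_num) L)
  have h2 : (t.map leaf).bind id = t := by
    clear hs hL
    induction t with
    | leaf a => rfl
    | node l r hl hr => simp [map, bind, hl, hr]
  rw [h2] at hs
  exact ⟨s, hs.mono (by omega), by omega⟩

/-- Any labeled tree is quickly rewritten as a shallow tree that only depends on the labels. -/
theorem exists_common_reach {L : ℕ} (S : Finset α) (hS : S.card ≤ 2 ^ L) (hne : S.Nonempty) :
    ∃ s : LeafTree α, s.height ≤ L ∧
      ∀ t : LeafTree α, t.labels.Nodup → (∀ a, a ∈ t.labels ↔ a ∈ S) → Reach (29 * L) t s := by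
  classical
  obtain ⟨a₀, ha₀⟩ := hne
  -- `c` numbers the elements of `S` with `L` bits and `d` inverts it; the values `0` and `a₀`
  -- elsewhere are irrelevant defaults.
  let c : α → ℕ := fun a => if h : a ∈ S then S.equivFin ⟨a, h⟩ else 0
  have hc : ∀ a ∈ S, ∀ b ∈ S, c a = c b → a = b := by
    intro a ha b hb hab
    simp only [c, dif_pos ha, dif_pos hb] at hab
    simpa using S.equivFin.injective (Fin.ext hab)
  have hlt : ∀ a ∈ S, c a < 2 ^ L := by
    intro a ha
    simp only [c, dif_pos ha]
    exact (Fin.is_lt _).trans_le hS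
  let d : ℕ → α := fun n => if h : ∃ a ∈ S, c a = n then h.choose else a₀
  have hd : ∀ a ∈ S, d (c a) = a := by
    intro a ha
    have h : ∃ b ∈ S, c b = c a := ⟨a, ha, rfl⟩
    simp only [d, dif_pos h]
    exact hc _ h.choose_spec.1 _ ha h.choose_spec.2
  have key : ∀ t : LeafTree α, t.labels.Nodup → (∀ a, a ∈ t.labels ↔ a ∈ S) →
      ∃ s, trie (c '' S) L 0 = some s ∧ Reach (29 * L) t (s.map d) := by
    intro t ht htS
    have hlen : t.labels.length = S.card := by
      rw [← List.toFinset_card_of_nodup ht]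
      congr 1; ext a; simp [htS]
    obtain ⟨u, hu, hh⟩ := exists_reach_shallow (L := L) t (by omega)
    have hp := hu.labels_perm
    have hset : {x | x ∈ (u.map c).labels} = c '' S := by
      ext x
      simp [labels_map, ← hp.mem_iff, htS]
    obtain ⟨s, hs, hr⟩ := exists_reach_trie (L := L) (t := u.map c) (by
        rw [labels_map]
        refine (List.nodup_map_iff_inj_on (hp.nodup_iff.1 ht)).2 fun a ha b hb hab => ?_
        rw [← hp.mem_iff, htS] at ha hb
        exact hc a ha b hb hab) (by
        rw [labels_map]
        intro x hx
        obtain ⟨a, ha, rfl⟩ := List.mem_map.1 hx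
        rw [← hp.mem_iff, htS] at ha
        exact hlt a ha)
    rw [hset] at hs
    refine ⟨s, hs, ?_⟩
    have h1 := hr.map d
    rw [map_map, map_id' u (d ∘ c) fun a ha => hd a ((htS a).1 (hp.mem_iff.2 ha))] at h1
    have h2 := height_map u c
    -- `9 * L` steps reach height at most `3 * L`, and sorting takes `5 * (3 * L + L)` more.
    exact (hu.trans h1).mono (by omega)
  rcases h : trie (c '' S) L 0 with _ | s
  -- An empty trie means that no tree has these labels, so any tree serves.
  · refine ⟨leaf a₀, by simp [height], fun t ht htS => ?_⟩
    obtain ⟨s, hs, -⟩ := key t ht htS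
    rw [h] at hs; cases hs
  · refine ⟨s.map d, ?_, fun t ht htS => ?_⟩
    · rw [height_map]; exact trie_height h
    · obtain ⟨s', hs', hr⟩ := key t ht htS
      rw [h] at hs'; cases hs'; exact hr

end LeafTree

/-! ### Rewriting steps as simultaneous Whitehead moves -/

namespace HalfEdgeGraph

variable {V H Λ : Type}

/-- The vertex `v` is trivalent with half-edges `a`, `b`, `c`. -/
structure IsTripod (G : HalfEdgeGraph V H) (v : V) (a b c : H) : Prop where
  ne_ab : a ≠ b
  ne_ac : a ≠ c
  ne_bc : b ≠ c
  base_iff : ∀ h, G.base h = v ↔ h = a ∨ h = b ∨ h = c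

namespace IsTripod

variable {G : HalfEdgeGraph V H} {v : V} {a b c : H}

theorem rotate (h : G.IsTripod v a b c) : G.IsTripod v b c a :=
  ⟨h.ne_bc, h.ne_ab.symm, h.ne_ac.symm, fun x => by rw [h.base_iff]; tauto⟩

theorem swap (h : G.IsTripod v a b c) : G.IsTripod v a c b :=
  ⟨h.ne_ac, h.ne_ab, h.ne_bc.symm, fun x => by rw [h.base_iff]; tauto⟩

theorem base_a (h : G.IsTripod v a b c) : G.base a = v := (h.base_iff a).2 (by simp)

theorem base_b (h : G.IsTripod v a b c) : G.base b = v := (h.base_iff b).2 (by simp)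

theorem base_c (h : G.IsTripod v a b c) : G.base c = v := (h.base_iff c).2 (by simp)

theorem valence_eq (h : G.IsTripod v a b c) : G.valence v = 3 := by
  classical
  have h1 : {x : H // G.base x = v} ≃ ({a, b, c} : Finset H) :=
    Equiv.subtypeEquivRight fun x => by simp [h.base_iff]
  rw [valence, Nat.card_congr h1, Nat.card_eq_fintype_card, Fintype.card_coe,
    Finset.card_eq_three.2 ⟨a, b, c, h.ne_ab, h.ne_ac, h.ne_bc, rfl⟩]

end IsTripod

theorem exists_isTripod {G : HalfEdgeGraph V H} {v : V} (h : G.valence v = 3) :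
    ∃ a b c, G.IsTripod v a b c := by
  have h' : Set.ncard {x : H | G.base x = v} = 3 := h
  obtain ⟨a, b, c, hab, hac, hbc, heq⟩ := Set.ncard_eq_three.1 h'
  refine ⟨a, b, c, hab, hac, hbc, fun x => ?_⟩
  have : x ∈ {x : H | G.base x = v} ↔ x ∈ ({a, b, c} : Set H) := by rw [heq]
  simpa using this

theorem exists_isTripod_of_base {G : HalfEdgeGraph V H} {h : H} (hv : G.valence (G.base h) = 3) :
    ∃ b c, G.IsTripod (G.base h) h b c := by
  obtain ⟨a, b, c, ht⟩ := exists_isTripod hv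
  rcases (ht.base_iff h).1 rfl with rfl | rfl | rfl
  exacts [⟨b, c, ht⟩, ⟨c, a, ht.rotate⟩, ⟨a, b, ht.rotate.rotate⟩]

theorem WhiteheadMove.valence_eq {G G' : HalfEdgeGraph V H} {e : H} (h : G.WhiteheadMove e G')
    (v : V) : G'.valence v = G.valence v := by
  classical
  obtain ⟨-, -, -, a, b, -, -, -, hb⟩ := h
  refine Nat.card_congr ((Equiv.swap a b).subtypeEquiv fun x => ?_)
  rw [hb]
  simp only [Function.comp_apply]

theorem WhiteheadMoves.valence_eq {es : List H} {G G' : HalfEdgeGraph V H}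
    (h : WhiteheadMoves es G G') (v : V) : G'.valence v = G.valence v := by
  induction es generalizing G with
  | nil => cases h; rfl
  | cons e es ih =>
    obtain ⟨G₁, h1, h2⟩ := h
    rw [ih h2, h1.valence_eq]

theorem WhiteheadMoves.inv_eq {es : List H} {G G' : HalfEdgeGraph V H}
    (h : WhiteheadMoves es G G') : G'.inv = G.inv := by
  induction es generalizing G with
  | nil => cases h; rfl
  | cons e es ih =>
    obtain ⟨G₁, ⟨-, -, -, a, b, -, -, h1, -⟩, h2⟩ := h
    rw [ih h2, h1]

theorem WhiteheadMoves.append {es fs : List H} {G G' G'' : HalfEdgeGraph V H}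
    (h : WhiteheadMoves es G G') (h' : WhiteheadMoves fs G' G'') :
    WhiteheadMoves (es ++ fs) G G'' := by
  induction es generalizing G with
  | nil => cases h; exact h'
  | cons e es ih =>
    obtain ⟨G₁, h1, h2⟩ := h
    exact ⟨G₁, h1, ih h2⟩

/-- The edge of a Whitehead move is unchanged, and any other half-edge is either unmoved, or
moves from one end of this edge to the other one. -/
theorem WhiteheadMove.base_eq_or {G G' : HalfEdgeGraph V H} {e : H} (h : G.WhiteheadMove e G') :
    G'.base e = G.base e ∧ G'.base (G.inv e) = G.base (G.inv e) ∧ ∀ x, G'.base x = G.base x ∨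
      G.base x = G.base e ∧ G'.base x = G.base (G.inv e) ∨
      G.base x = G.base (G.inv e) ∧ G'.base x = G.base e := by
  classical
  obtain ⟨hne, -, -, a, b, ⟨ha, hae⟩, ⟨hb, hbe⟩, -, hbase⟩ := h
  have hx : ∀ x, x ≠ a → x ≠ b → G'.base x = G.base x := by
    intro x h1 h2
    rw [hbase, Function.comp_apply, Equiv.swap_apply_of_ne_of_ne h1 h2]
  refine ⟨hx _ hae.symm ?_, hx _ ?_ hbe.symm, fun x => ?_⟩
  · rintro rfl; exact hne hb
  · rintro h; rw [← h] at ha; exact hne ha.symm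
  · by_cases h1 : x = a
    · subst h1
      refine .inr (.inl ⟨ha, ?_⟩)
      rw [hbase, Function.comp_apply, Equiv.swap_apply_left, hb]
    · by_cases h2 : x = b
      · subst h2
        refine .inr (.inr ⟨hb, ?_⟩)
        rw [hbase, Function.comp_apply, Equiv.swap_apply_right, ha]
      · exact .inl (hx x h1 h2)

/-- Half-edges move only between vertices of a set that contains the ends of all edges of the
moves. -/
theorem WhiteheadMoves.frame {S : Set V} {es : List H} {G G' : HalfEdgeGraph V H}
    (hS : ∀ e ∈ es, G.base e ∈ S ∧ G.base (G.inv e) ∈ S) (h : WhiteheadMoves es G G') :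
    ∀ x, (G'.base x ∈ S ↔ G.base x ∈ S) ∧ (G.base x ∉ S → G'.base x = G.base x) := by
  induction es generalizing G with
  | nil => cases h; exact fun x => ⟨.rfl, fun _ => rfl⟩
  | cons e es ih =>
    obtain ⟨G₁, h1, h2⟩ := h
    obtain ⟨-, -, h3⟩ := h1.base_eq_or
    have hinv : G₁.inv = G.inv := by
      obtain ⟨-, -, -, a, b, -, -, h, -⟩ := h1; exact h
    have he := hS e (by simp)
    have h4 : ∀ x, (G₁.base x ∈ S ↔ G.base x ∈ S) ∧ (G.base x ∉ S → G₁.base x = G.base x) := by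
      intro x
      rcases h3 x with h | ⟨h, h'⟩ | ⟨h, h'⟩
      · simp [h]
      · simp [h, h', he]
      · simp [h, h', he]
    have h5 := ih (G := G₁) (fun f hf => by
      rw [(h4 _).1, hinv, (h4 _).1]; exact hS f (by simp [hf])) h2
    exact fun x => ⟨(h5 x).1.trans (h4 x).1, fun hx => by
      rw [(h5 x).2 (by rwa [(h4 x).1]), (h4 x).2 hx]⟩

/-- A simultaneous Whitehead move on edges with end points in `S`. -/
def MoveWithin (S : Set V) (G G' : HalfEdgeGraph V H) : Prop :=
  ∃ es : List H, es.Pairwise G.DisjointEdges ∧ (∀ e ∈ es, G.base e ∈ S ∧ G.base (G.inv e) ∈ S) ∧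
    WhiteheadMoves es G G'

namespace MoveWithin

variable {S T : Set V} {G G' G'' : HalfEdgeGraph V H}

theorem refl (S : Set V) (G : HalfEdgeGraph V H) : MoveWithin S G G :=
  ⟨[], .nil, by simp, rfl⟩

theorem inv_eq (h : MoveWithin S G G') : G'.inv = G.inv := by
  obtain ⟨es, -, -, h⟩ := h; exact h.inv_eq

theorem base_mem_iff (h : MoveWithin S G G') (x : H) : G'.base x ∈ S ↔ G.base x ∈ S := by
  obtain ⟨es, -, hS, h⟩ := h; exact (h.frame hS x).1

theorem base_eq (h : MoveWithin S G G') {x : H} (hx : G.base x ∉ S) : G'.base x = G.base x := by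
  obtain ⟨es, -, hS, h⟩ := h; exact (h.frame hS x).2 hx

theorem base_eq_iff (h : MoveWithin S G G') {x : H} {v : V} (hv : v ∉ S) :
    G'.base x = v ↔ G.base x = v := by
  constructor
  · rintro rfl
    rw [h.base_mem_iff] at hv
    exact (h.base_eq hv).symm
  · rintro rfl
    exact h.base_eq hv

/-- Moves inside `S` leave the half-edges at vertices of `T` alone, so the edges of the second list
have the same end points in `G` as in `G'`. Hence the joined list is pairwise disjoint in `G`. This
turns moves in separate subtrees into one simultaneous move. -/
theorem trans (h : MoveWithin S G G') (h' : MoveWithin T G' G'') (hST : Disjoint S T) :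
    MoveWithin (S ∪ T) G G'' := by
  have key : ∀ x, G'.base x ∈ T → G'.base x = G.base x := by
    intro x hx
    refine h.base_eq fun hS => ?_
    rw [← h.base_mem_iff] at hS
    exact Set.disjoint_left.1 hST hS hx
  have hinv := h.inv_eq
  obtain ⟨es, hp, hS, hm⟩ := h
  obtain ⟨fs, hp', hS', hm'⟩ := h'
  rw [hinv] at hS'
  refine ⟨es ++ fs, ?_, ?_, hm.append hm'⟩
  · rw [List.pairwise_append]
    refine ⟨hp, ?_, ?_⟩
    · refine hp'.imp_of_mem fun {a b} ha hb hab => ?_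
      unfold DisjointEdges at hab ⊢
      rwa [hinv, key _ (hS' a ha).1, key _ (hS' a ha).2, key _ (hS' b hb).1,
        key _ (hS' b hb).2] at hab
    · intro a ha b hb
      refine hST.mono ?_ ?_
      · rintro v (rfl | rfl)
        exacts [(hS a ha).1, (hS a ha).2]
      · have h1 := hS' b hb
        rw [key _ h1.1, key _ h1.2] at h1
        rintro v (rfl | rfl)
        exacts [h1.1, h1.2]
  · intro e he
    rcases List.mem_append.1 he with he | he
    · exact ⟨.inl (hS e he).1, .inl (hS e he).2⟩
    · have h1 := hS' e he
      rw [key _ h1.1, key _ h1.2] at h1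
      exact ⟨.inr h1.1, .inr h1.2⟩

theorem mono (h : MoveWithin S G G') (hST : S ⊆ T) : MoveWithin T G G' := by
  obtain ⟨es, hp, hS, hm⟩ := h
  exact ⟨es, hp, fun e he => ⟨hST (hS e he).1, hST (hS e he).2⟩, hm⟩

theorem simultaneous (h : MoveWithin S G G') : G.SimultaneousWhiteheadMove G' := by
  obtain ⟨es, hp, -, hm⟩ := h
  exact ⟨es, hp, hm⟩

theorem isTripod (h : MoveWithin S G G') {v : V} {a b c : H} (hv : v ∉ S)
    (ht : G.IsTripod v a b c) : G'.IsTripod v a b c :=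
  ⟨ht.ne_ab, ht.ne_ac, ht.ne_bc, fun x => by rw [h.base_eq_iff hv, ht.base_iff]⟩

end MoveWithin

/-- The Whitehead move on the edge of `z` that exchanges `y` and `c`. -/
theorem exists_move_exchange {G : HalfEdgeGraph V H} {v w : V} {p z y c d : H} (hvw : v ≠ w)
    (hv : G.IsTripod v p z y) (hw : G.IsTripod w (G.inv z) c d) :
    ∃ G', MoveWithin {v, w} G G' ∧ G'.IsTripod v p z c ∧ G'.IsTripod w (G'.inv z) y d := by
  classical
  have hne : ∀ {a b : H}, G.base a = v → G.base b = w → a ≠ b := by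
    rintro a b h1 h2 rfl; exact hvw (h1.symm.trans h2)
  let G' : HalfEdgeGraph V H := ⟨G.inv, G.base ∘ Equiv.swap y c, G.inv_inv, G.inv_ne⟩
  refine ⟨G', ⟨[z], by simp, by simp [hv.base_b, hw.base_a], G', ⟨?_, ?_, ?_, y, c, ?_, ?_, rfl, ?_⟩, rfl⟩,
    ⟨hv.ne_ab, hne hv.base_a hw.base_b, hne hv.base_b hw.base_b, fun x => ?_⟩,
    ⟨(hne hv.base_c hw.base_a).symm, hw.ne_ac, hne hv.base_c hw.base_c, fun x => ?_⟩⟩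
  · rw [hv.base_b, hw.base_a]; exact hvw
  · rw [hv.base_b, hv.valence_eq]
  · rw [hw.base_a, hw.valence_eq]
  · exact ⟨by rw [hv.base_b, hv.base_c], hv.ne_bc.symm⟩
  · exact ⟨by rw [hw.base_a, hw.base_b], hw.ne_ab.symm⟩
  · simp only [G']
  · simp only [G', Function.comp_apply]
    by_cases h1 : x = y
    · subst h1
      simp [hw.base_b, hvw.symm, hv.ne_ac.symm, hv.ne_bc.symm, hne hv.base_c hw.base_b]
    · by_cases h2 : x = c
      · subst h2; simp [hv.base_c]
      · rw [Equiv.swap_apply_of_ne_of_ne h1 h2, hv.base_iff]; simp [h1, h2]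
  · simp only [G', Function.comp_apply]
    by_cases h1 : x = y
    · subst h1; simp [hw.base_b]
    · by_cases h2 : x = c
      · subst h2
        simp [hv.base_c, hvw, hw.ne_ab.symm, hw.ne_bc, (hne hv.base_c hw.base_b).symm]
      · rw [Equiv.swap_apply_of_ne_of_ne h1 h2, hw.base_iff]; simp [h1, h2]

/-- The part of the graph beyond the half-edge `k` (seen from its base), cut at the half-edges
`e a`, is the tree `t`, whose leaf `a` is reached by `e a`; the list consists of the vertices of
this part. -/
inductive Branch (G : HalfEdgeGraph V H) (e : Λ → H) : H → LeafTree Λ → List V → Prop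
  | leaf (a : Λ) : Branch G e (e a) (.leaf a) []
  | node {k x y : H} {l r : LeafTree Λ} {v : V} {vs ws : List V} :
      G.IsTripod v (G.inv k) x y → Branch G e x l vs → Branch G e y r ws →
      Branch G e k (.node l r) (v :: (vs ++ ws))

theorem Branch.frame {G G' : HalfEdgeGraph V H} {e : Λ → H} {k : H} {t : LeafTree Λ}
    {vs : List V} {S : Set V} (h : G.Branch e k t vs) (hm : MoveWithin S G G')
    (hS : ∀ v ∈ vs, v ∉ S) : G'.Branch e k t vs := by
  induction h with
  | leaf a => exact .leaf a
  | node ht _ _ h1 h2 =>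
    refine .node ?_ (h1 fun v hv => hS v (by simp [hv])) (h2 fun v hv => hS v (by simp [hv]))
    rw [hm.inv_eq]
    exact hm.isTripod (hS _ (by simp)) ht

/-- Whenever a branch of a graph is the tree `t`, a simultaneous Whitehead move inside of the
branch turns it into the tree `t'`. -/
def Movable (V : Type) (e : Λ → H) (t t' : LeafTree Λ) : Prop :=
  ∀ (G : HalfEdgeGraph V H) (k : H) (vs : List V), G.Branch e k t vs → vs.Nodup →
    ∃ G' vs', MoveWithin {v | v ∈ vs} G G' ∧ G'.Branch e k t' vs' ∧ vs'.Perm vs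

theorem Movable.pair {e : Λ → H} {l l' r r' : LeafTree Λ} (hl : Movable V e l l')
    (hr : Movable V e r r') {G : HalfEdgeGraph V H} {x y : H} {vs ws : List V}
    (h1 : G.Branch e x l vs) (h2 : G.Branch e y r ws) (hd : (vs ++ ws).Nodup) :
    ∃ G' vs' ws', MoveWithin {v | v ∈ vs ++ ws} G G' ∧ G'.Branch e x l' vs' ∧
      G'.Branch e y r' ws' ∧ vs'.Perm vs ∧ ws'.Perm ws := by
  obtain ⟨d1, d2, d3⟩ := List.nodup_append.1 hd
  obtain ⟨G₁, vs', m1, b1, p1⟩ := hl G x vs h1 d1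
  obtain ⟨G₂, ws', m2, b2, p2⟩ := hr G₁ y ws
    (h2.frame m1 fun v hv hv' => d3 _ hv' _ hv rfl) d2
  refine ⟨G₂, vs', ws', (m1.trans m2 ?_).mono ?_, b1.frame m2 ?_, b2, p1, p2⟩
  · exact Set.disjoint_left.2 fun v hv hv' => d3 _ hv _ hv' rfl
  · intro v hv; simpa using hv
  · exact fun v hv hv' => d3 _ (p1.mem_iff.1 hv) _ hv' rfl

theorem Movable.triple {e : Λ → H} {a a' b b' c c' : LeafTree Λ} (ha : Movable V e a a')
    (hb : Movable V e b b') (hc : Movable V e c c') {G : HalfEdgeGraph V H} {x y z : H}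
    {us vs ws : List V} (h1 : G.Branch e x a us) (h2 : G.Branch e y b vs)
    (h3 : G.Branch e z c ws) (hd : (us ++ vs ++ ws).Nodup) :
    ∃ G' us' vs' ws', MoveWithin {v | v ∈ us ++ vs ++ ws} G G' ∧ G'.Branch e x a' us' ∧
      G'.Branch e y b' vs' ∧ G'.Branch e z c' ws' ∧ us'.Perm us ∧ vs'.Perm vs ∧ ws'.Perm ws := by
  obtain ⟨d1, d2, d3⟩ := List.nodup_append.1 hd
  obtain ⟨G₁, us', vs', m1, b1, b1', p1, p1'⟩ := ha.pair hb h1 h2 d1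
  obtain ⟨G₂, ws', m2, b2, p2⟩ := hc G₁ z ws
    (h3.frame m1 fun v hv hv' => d3 _ hv' _ hv rfl) d2
  refine ⟨G₂, us', vs', ws', (m1.trans m2 ?_).mono ?_, b1.frame m2 ?_, b1'.frame m2 ?_, b2,
    p1, p1', p2⟩
  · exact Set.disjoint_left.2 fun v hv hv' => d3 _ hv _ hv' rfl
  · intro v hv; simpa [or_assoc] using hv
  · exact fun v hv hv' => d3 _ (List.mem_append_left _ (p1.mem_iff.1 hv)) _ hv' rfl
  · exact fun v hv hv' => d3 _ (List.mem_append_right _ (p1'.mem_iff.1 hv)) _ hv' rfl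

/-- Exchanging siblings only changes the order in which two half-edges are listed and needs no move.
A rotation is a Whitehead move on the edge joining its two nodes; the moves inside the subtrees
avoid these nodes, so everything is one simultaneous move. -/
theorem movable_of_step {e : Λ → H} {t t' : LeafTree Λ} (h : t.Step t') : Movable V e t t' := by
  induction h with
  | leaf a => exact fun G k vs h _ => ⟨G, vs, .refl _ _, h, .refl _⟩
  | node _ _ ihl ihr =>
    intro G k vs h hd
    cases h with
    | @node _ x y _ _ v vs ws ht h1 h2 =>
    obtain ⟨d1, d2⟩ := List.nodup_cons.1 hd
    obtain ⟨G', vs', ws', m, b1, b2, p1, p2⟩ := ihl.pair ihr h1 h2 d2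
    refine ⟨G', _, m.mono fun v hv => List.mem_cons_of_mem _ hv, .node (v := v) ?_ b1 b2,
      (p1.append p2).cons _⟩
    rw [m.inv_eq]; exact m.isTripod d1 ht
  | swap _ _ ihl ihr =>
    intro G k vs h hd
    cases h with
    | @node _ x y _ _ v vs ws ht h1 h2 =>
    obtain ⟨d1, d2⟩ := List.nodup_cons.1 hd
    obtain ⟨G', vs', ws', m, b1, b2, p1, p2⟩ := ihl.pair ihr h1 h2 d2
    refine ⟨G', _, m.mono fun v hv => List.mem_cons_of_mem _ hv, .node (v := v) ?_ b2 b1,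
      (List.perm_append_comm.trans (p1.append p2)).cons _⟩
    rw [m.inv_eq]; exact (m.isTripod d1 ht).swap
  | rot _ _ _ iha ihb ihc =>
    intro G k vs h hd
    cases h with
    | @node _ x y _ _ v vs ws ht h1 h2 =>
    cases h1 with
    | @node _ x' y' _ _ w us vs ht' h1 h1' =>
    simp only [List.cons_append, List.nodup_cons, List.mem_cons, not_or] at hd
    obtain ⟨⟨d1, d2⟩, d3, d4⟩ := hd
    obtain ⟨G₁, us', vs', ws', m, b1, b2, b3, p1, p2, p3⟩ := iha.triple ihb ihc h1 h1' h2 d4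
    have t1 := m.isTripod d2 ht
    have t2 := m.isTripod d3 ht'
    rw [← m.inv_eq] at t1 t2
    -- Exchanging `y` with `x'` attaches the subtree `a` to `v` and leaves `b` and `c` at `w`.
    obtain ⟨G₂, m', t1', t2'⟩ := exists_move_exchange d1 t1 t2
    have hS : ∀ u ∈ us ++ vs ++ ws, u ∉ ({v, w} : Set V) := by
      rintro u hu (rfl | rfl) <;> contradiction
    refine ⟨G₂, _, (m.trans m' ?_).mono ?_, .node (v := v) ?_ (b1.frame m' fun u hu => ?_)
      (.node (v := w) t2'.swap (b2.frame m' fun u hu => ?_) (b3.frame m' fun u hu => ?_)), ?_⟩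
    · exact Set.disjoint_left.2 hS
    · intro u hu; simp at hu ⊢; tauto
    · rw [m'.inv_eq]; exact t1'.swap
    · exact hS u (by simp [p1.mem_iff.1 hu])
    · exact hS u (by simp [p2.mem_iff.1 hu])
    · exact hS u (by simp [p3.mem_iff.1 hu])
    · refine .cons _ (List.perm_middle.trans ?_)
      simp only [List.cons_append, List.append_assoc]
      exact .cons _ (p1.append (p2.append p3))
  | rotInv _ _ _ iha ihb ihc =>
    intro G k vs h hd
    cases h with
    | @node _ x y _ _ v us ws ht h1 h2 =>
    cases h2 with
    | @node _ x' y' _ _ w vs ws ht' h2 h2' =>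
    have hd := (List.Perm.cons v (List.perm_middle (l₁ := us))).nodup_iff.1 hd
    rw [← List.append_assoc] at hd
    simp only [List.nodup_cons, List.mem_cons, not_or] at hd
    obtain ⟨⟨d1, d2⟩, d3, d4⟩ := hd
    obtain ⟨G₁, us', vs', ws', m, b1, b2, b3, p1, p2, p3⟩ := iha.triple ihb ihc h1 h2 h2' d4
    have t1 := m.isTripod d2 ht
    have t2 := m.isTripod d3 ht'
    rw [← m.inv_eq] at t1 t2
    obtain ⟨G₂, m', t1', t2'⟩ := exists_move_exchange d1 t1.swap t2.swap
    have hS : ∀ u ∈ us ++ vs ++ ws, u ∉ ({v, w} : Set V) := by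
      rintro u hu (rfl | rfl) <;> contradiction
    refine ⟨G₂, _, (m.trans m' ?_).mono ?_, .node (v := v) ?_
      (.node (v := w) t2' (b1.frame m' fun u hu => ?_) (b2.frame m' fun u hu => ?_))
      (b3.frame m' fun u hu => ?_), ?_⟩
    · exact Set.disjoint_left.2 hS
    · intro u hu; simp at hu ⊢; tauto
    · rw [m'.inv_eq]; exact t1'
    · exact hS u (by simp [p1.mem_iff.1 hu])
    · exact hS u (by simp [p2.mem_iff.1 hu])
    · exact hS u (by simp [p3.mem_iff.1 hu])
    · refine .cons _ (.trans ?_ List.perm_middle.symm)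
      simp only [List.cons_append, List.append_assoc]
      exact .cons _ (p1.append (p2.append p3))

/-- The graph `G`, cut at the half-edges `e a`, is the tree obtained from `t` by omitting the
root. -/
def IsTree (G : HalfEdgeGraph V H) (e : Λ → H) (t : LeafTree Λ) : Prop :=
  ∃ l r k vs ws, t = .node l r ∧ G.Branch e k l vs ∧ G.Branch e (G.inv k) r ws ∧
    (vs ++ ws).Nodup ∧ ∀ v, v ∈ vs ++ ws ↔ G.valence v = 3

theorem SimultaneousWhiteheadMove.valence_eq {G G' : HalfEdgeGraph V H}
    (h : G.SimultaneousWhiteheadMove G') (v : V) : G'.valence v = G.valence v := by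
  obtain ⟨es, -, h⟩ := h; exact h.valence_eq v

theorem MoveWithin.valence_eq {S : Set V} {G G' : HalfEdgeGraph V H}
    (h : MoveWithin S G G') (v : V) : G'.valence v = G.valence v :=
  h.simultaneous.valence_eq v

/-- A rewriting step of trees is realized by a simultaneous Whitehead move of graphs. -/
theorem IsTree.exists_move {G : HalfEdgeGraph V H} {e : Λ → H} {t t' : LeafTree Λ}
    (h : G.IsTree e t) (hs : t.Step t') :
    ∃ G', MoveWithin {v | G.valence v = 3} G G' ∧ G'.IsTree e t' := by
  obtain ⟨l, r, k, vs, ws, rfl, h1, h2, hd, hv⟩ := h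
  cases hs with
  | node sl sr =>
    obtain ⟨G', vs', ws', m, b1, b2, p1, p2⟩ :=
      (movable_of_step sl).pair (movable_of_step sr) h1 h2 hd
    refine ⟨G', m.mono fun v hm => (hv v).1 hm, _, _, k, vs', ws', rfl, b1, ?_,
      (p1.append p2).nodup_iff.2 hd, fun v => ?_⟩
    · rwa [m.inv_eq]
    · rw [(p1.append p2).mem_iff, hv, m.valence_eq]
  | swap sl sr =>
    obtain ⟨G', vs', ws', m, b1, b2, p1, p2⟩ :=
      (movable_of_step sl).pair (movable_of_step sr) h1 h2 hd
    refine ⟨G', m.mono fun v hm => (hv v).1 hm, _, _, G.inv k, ws', vs', rfl, b2, ?_,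
      (List.perm_append_comm.trans (p1.append p2)).nodup_iff.2 hd, fun v => ?_⟩
    · rwa [m.inv_eq, G.inv_inv]
    · rw [(List.perm_append_comm.trans (p1.append p2)).mem_iff, hv, m.valence_eq]
  -- The root is not a vertex of the graph, so a rotation at the root only shifts the root edge,
  -- here from `k` to `x`, and costs no move.
  | rot sa sb sc =>
    cases h1 with
    | @node _ x y _ _ v us vs ht h1 h1' =>
    simp only [List.cons_append, List.nodup_cons] at hd
    obtain ⟨G', us', vs', ws', m, b1, b2, b3, p1, p2, p3⟩ :=
      (movable_of_step sa).triple (movable_of_step sb) (movable_of_step sc) h1 h1' h2 hd.2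
    have hp : (us' ++ v :: (vs' ++ ws')).Perm (v :: (us ++ vs) ++ ws) := by
      refine List.perm_middle.trans ?_
      simp only [List.cons_append, List.append_assoc]
      exact .cons _ (p1.append (p2.append p3))
    refine ⟨G', m.mono fun u hm => (hv u).1 (List.mem_cons_of_mem _ hm), _, _, x, us', _, rfl, b1,
      .node (v := v) ?_ b2 b3, hp.nodup_iff.2 (List.nodup_cons.2 hd), fun u => ?_⟩
    · rw [G'.inv_inv]; exact (m.isTripod hd.1 ht).rotate
    · rw [hp.mem_iff, hv, m.valence_eq]
  | rotInv sa sb sc =>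
    obtain ⟨k', hk⟩ : ∃ k', k' = G.inv k := ⟨_, rfl⟩
    rw [← hk] at h2
    cases h2 with
    | @node _ x y _ _ v ws us ht h2 h2' =>
    have hd' := List.perm_middle.nodup_iff.1 hd
    rw [← List.append_assoc, List.nodup_cons] at hd'
    obtain ⟨G', vs', ws', us', m, b1, b2, b3, p1, p2, p3⟩ :=
      (movable_of_step sa).triple (movable_of_step sb) (movable_of_step sc) h1 h2 h2' hd'.2
    rw [hk, G.inv_inv] at ht
    have hp : ((v :: (vs' ++ ws')) ++ us').Perm (vs ++ v :: (ws ++ us)) := by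
      refine .trans ?_ List.perm_middle.symm
      simp only [List.cons_append, List.append_assoc]
      exact .cons _ (p1.append (p2.append p3))
    refine ⟨G', m.mono fun u hm => (hv u).1 ?_, _, _, G'.inv y, _, us', rfl,
      .node (v := v) ?_ b1 b2, ?_, hp.nodup_iff.2 hd, fun u => ?_⟩
    · exact List.perm_middle.mem_iff.2 (List.mem_cons_of_mem _ (by simpa using hm))
    · rw [G'.inv_inv]; exact (m.isTripod hd'.1 ht).rotate.rotate
    · rwa [G'.inv_inv]
    · rw [hp.mem_iff, hv, m.valence_eq]

end HalfEdgeGraph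

/-! ### Cutting a graph to a tree -/

namespace HalfEdgeGraph

variable {V H Λ L : Type}

theorem Branch.labels_length {G : HalfEdgeGraph V H} {e : Λ → H} {k : H} {t : LeafTree Λ}
    {vs : List V} (h : G.Branch e k t vs) : t.labels.length = vs.length + 1 := by
  induction h with
  | leaf a => rfl
  | node _ _ _ h1 h2 => simp [LeafTree.labels, h1, h2]; omega

theorem Branch.map {G : HalfEdgeGraph V H} {e : Λ → H} {k : H} {t : LeafTree H}
    {vs : List V} (h : G.Branch id k t vs) (f : H → Λ) (hf : ∀ a ∈ t.labels, e (f a) = a) :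
    G.Branch e k (t.map f) vs := by
  induction h with
  | leaf a =>
    have := Branch.leaf (G := G) (e := e) (f a)
    rwa [hf a (by simp [LeafTree.labels])] at this
  | node ht _ _ h1 h2 =>
    exact .node ht (h1 fun a ha => hf a (by simp [LeafTree.labels, ha]))
      (h2 fun a ha => hf a (by simp [LeafTree.labels, ha]))

theorem Branch.top {G : HalfEdgeGraph V H} {e : Λ → H} {k : H} {t : LeafTree Λ}
    {vs : List V} (h : G.Branch e k t vs) (hv : vs ≠ []) : G.base (G.inv k) ∈ vs := by
  cases h with
  | leaf a => exact absurd rfl hv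
  | node ht _ _ => simp [ht.base_a]

theorem Branch.mem_labels_of_nil {G : HalfEdgeGraph V H} {k : H} {t : LeafTree H}
    (h : G.Branch id k t []) : k ∈ t.labels := by
  cases h; simp [LeafTree.labels]

theorem Branch.base_label {G : HalfEdgeGraph V H} {k : H} {t : LeafTree H} {vs : List V}
    (h : G.Branch id k t vs) : ∀ a ∈ t.labels, vs = [] ∧ a = k ∨ G.base a ∈ vs := by
  induction h with
  | leaf a => intro b hb; simpa [LeafTree.labels] using hb
  | node ht _ _ h1 h2 =>
    intro a ha
    right
    rcases List.mem_append.1 ha with ha | ha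
    · rcases h1 a ha with ⟨-, rfl⟩ | h
      · simp [ht.base_b]
      · simp [h]
    · rcases h2 a ha with ⟨-, rfl⟩ | h
      · simp [ht.base_c]
      · simp [h]

theorem Branch.inv_not_mem {G : HalfEdgeGraph V H} {k : H} {t : LeafTree H} {vs : List V}
    (h : G.Branch id k t vs) (hd : vs.Nodup) (hv : vs ≠ []) : G.inv k ∉ t.labels := by
  cases h with
  | leaf a => exact absurd rfl hv
  | node ht h1 h2 =>
    simp only [List.nodup_cons, List.mem_append, not_or] at hd
    intro hk
    rcases List.mem_append.1 hk with hk | hk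
    · rcases h1.base_label _ hk with ⟨-, h⟩ | h
      · exact ht.ne_ab h
      · exact hd.1.1 (ht.base_a ▸ h)
    · rcases h2.base_label _ hk with ⟨-, h⟩ | h
      · exact ht.ne_ac h
      · exact hd.1.2 (ht.base_a ▸ h)

theorem Branch.labels_nodup {G : HalfEdgeGraph V H} {k : H} {t : LeafTree H} {vs : List V}
    (h : G.Branch id k t vs) (hd : vs.Nodup) : t.labels.Nodup := by
  induction h with
  | leaf a => simp [LeafTree.labels]
  | node ht b1 b2 h1 h2 =>
    simp only [List.nodup_cons, List.mem_append, not_or, List.nodup_append] at hd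
    refine List.nodup_append.2 ⟨h1 hd.2.1, h2 hd.2.2.1, ?_⟩
    rintro a ha _ hb rfl
    rcases b1.base_label _ ha with ⟨-, h⟩ | h <;> rcases b2.base_label _ hb with ⟨-, h'⟩ | h'
    · exact ht.ne_bc (h.symm.trans h')
    · rw [h, ht.base_b] at h'; exact hd.1.2 h'
    · rw [h', ht.base_c] at h; exact hd.1.1 h
    · exact hd.2.2.2 _ h _ h' rfl

/-- A half-edge of a branch that is neither cut nor its root belongs to an edge of the branch. -/
theorem Branch.inner {G : HalfEdgeGraph V H} {k : H} {t : LeafTree H} {vs : List V}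
    (h : G.Branch id k t vs) (hd : vs.Nodup) {x : H} (hx : G.base x ∈ vs) (hxt : x ∉ t.labels)
    (hxk : x ≠ G.inv k) : G.base (G.inv x) ∈ vs ∧ G.inv x ∉ t.labels ∧ x ≠ k := by
  induction h with
  | leaf a => simp at hx
  | @node k y z l r v vs ws ht b1 b2 h1 h2 =>
    simp only [List.nodup_cons, List.mem_append, not_or, List.nodup_append] at hd
    obtain ⟨⟨d1, d2⟩, d3, d4, d5⟩ := hd
    simp only [LeafTree.labels, List.mem_append, not_or] at hxt
    -- The argument for `x` on the side of `y`; the other side follows by exchanging the two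
    -- subtrees.
    have key : ∀ {y z : H} {l r : LeafTree H} {vs ws : List V}, G.IsTripod v (G.inv k) y z →
        G.Branch id y l vs → G.Branch id z r ws → v ∉ vs → v ∉ ws → vs.Nodup →
        (∀ a ∈ vs, ∀ b ∈ ws, a ≠ b) → (x = y ∨ G.base x ∈ vs) → x ∉ l.labels →
        (G.base x ∈ vs → x ∉ l.labels → x ≠ G.inv y →
          G.base (G.inv x) ∈ vs ∧ G.inv x ∉ l.labels ∧ x ≠ y) →
        G.base (G.inv x) ∈ v :: (vs ++ ws) ∧ (G.inv x ∉ l.labels ∧ G.inv x ∉ r.labels) ∧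
          x ≠ k := by
      clear * -
      intro y z l r vs ws ht b1 b2 d1 d2 d3 d5 hx hxl ih
      have hr : ∀ {u}, u ∈ r.labels → G.base u = v ∧ u = z ∨ G.base u ∈ ws := by
        intro u hu
        rcases b2.base_label _ hu with ⟨-, rfl⟩ | h
        exacts [.inl ⟨ht.base_c, rfl⟩, .inr h]
      have aux : G.base (G.inv x) ∈ vs → G.inv x ∉ r.labels ∧ x ≠ k := by
        intro h
        refine ⟨fun h' => ?_, ?_⟩
        · rcases hr h' with ⟨h', -⟩ | h'
          · exact d1 (h' ▸ h)
          · exact d5 _ h _ h' rfl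
        · rintro rfl
          rw [ht.base_a] at h; exact d1 h
      by_cases hxy : x = y
      · subst hxy
        have hvs : vs ≠ [] := by
          rintro rfl; exact hxl b1.mem_labels_of_nil
        have h1 := b1.top hvs
        exact ⟨by simp [h1], ⟨b1.inv_not_mem d3 hvs, (aux h1).1⟩, (aux h1).2⟩
      · have hx := hx.resolve_left hxy
        by_cases hxy' : x = G.inv y
        · subst hxy'
          rw [G.inv_inv]
          refine ⟨by simp [ht.base_b], ⟨fun h => ?_, fun h => ?_⟩, ?_⟩
          · rcases b1.base_label _ h with ⟨rfl, -⟩ | h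
            · simp at hx
            · rw [ht.base_b] at h; exact d1 h
          · rcases hr h with ⟨-, h⟩ | h
            · exact ht.ne_bc h
            · rw [ht.base_b] at h; exact d2 h
          · rintro rfl
            exact ht.ne_ab (G.inv_inv y)
        · obtain ⟨h1, h2, -⟩ := ih hx hxl hxy'
          exact ⟨by simp [h1], ⟨h2, (aux h1).1⟩, (aux h1).2⟩
    rw [show G.inv x ∉ (LeafTree.node l r).labels ↔ G.inv x ∉ l.labels ∧ G.inv x ∉ r.labels by
      simp [LeafTree.labels]]
    have hx' : (x = y ∨ G.base x ∈ vs) ∨ (x = z ∨ G.base x ∈ ws) := by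
      rcases List.mem_cons.1 hx with h | h
      · rcases (ht.base_iff x).1 h with h | h | h
        exacts [absurd h hxk, .inl (.inl h), .inr (.inl h)]
      · rcases List.mem_append.1 h with h | h
        exacts [.inl (.inr h), .inr (.inr h)]
    rcases hx' with hx' | hx'
    · exact key ht b1 b2 d1 d2 d3 d5 hx' hxt.1 (h1 d3)
    · have := key ht.swap b2 b1 d2 d1 d4 (fun a ha b hb => (d5 b hb a ha).symm) hx' hxt.2 (h2 d4)
      refine ⟨?_, this.2.1.symm, this.2.2⟩
      have h := this.1
      simp only [List.mem_cons, List.mem_append] at h ⊢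
      tauto

theorem Branch.expand {G : HalfEdgeGraph V H} {k x y z : H} {t : LeafTree H} {vs : List V}
    {w : V} (h : G.Branch id k t vs) (hx : x ∈ t.labels) (hw : G.IsTripod w (G.inv x) y z) :
    ∃ t' vs', G.Branch id k t' vs' ∧ vs'.Perm (w :: vs) := by
  induction h with
  | leaf a =>
    simp only [LeafTree.labels, List.mem_singleton] at hx
    subst hx
    exact ⟨_, _, .node hw (.leaf y) (.leaf z), .refl _⟩
  | @node k a b l r v vs ws ht b1 b2 h1 h2 =>
    rcases List.mem_append.1 hx with hx | hx
    · obtain ⟨t', vs', b, p⟩ := h1 hx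
      exact ⟨_, _, .node ht b b2, ((p.append_right _).cons _).trans (.swap ..)⟩
    · obtain ⟨t', vs', b, p⟩ := h2 hx
      exact ⟨_, _, .node ht b1 b,
        (((p.append_left _).trans List.perm_middle).cons _).trans (.swap ..)⟩

/-- A part of the graph that is a tree after cutting. -/
def PartialTree (G : HalfEdgeGraph V H) (k : H) (l r : LeafTree H) (vs ws : List V) : Prop :=
  G.Branch id k l vs ∧ G.Branch id (G.inv k) r ws ∧ (vs ++ ws).Nodup ∧ vs ++ ws ≠ []

namespace PartialTree

variable {G : HalfEdgeGraph V H} {k : H} {l r : LeafTree H} {vs ws : List V}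

theorem symm (h : G.PartialTree k l r vs ws) : G.PartialTree (G.inv k) r l ws vs := by
  obtain ⟨h1, h2, h3, h4⟩ := h
  refine ⟨h2, by rwa [G.inv_inv], List.perm_append_comm.nodup_iff.1 h3, ?_⟩
  simp only [ne_eq, List.append_eq_nil_iff] at h4 ⊢; tauto

theorem labels_nodup (h : G.PartialTree k l r vs ws) : (l.labels ++ r.labels).Nodup := by
  obtain ⟨h1, h2, h3, h4⟩ := h
  obtain ⟨d1, d2, d3⟩ := List.nodup_append.1 h3
  refine List.nodup_append.2 ⟨h1.labels_nodup d1, h2.labels_nodup d2, ?_⟩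
  rintro a ha _ hb rfl
  rcases h1.base_label _ ha with ⟨h, rfl⟩ | h <;> rcases h2.base_label _ hb with ⟨h', hk⟩ | h'
  · exact G.inv_ne _ hk.symm
  · have := h2.inv_not_mem d2 (List.ne_nil_of_mem h')
    rw [G.inv_inv] at this
    exact this hb
  · subst hk
    exact h1.inv_not_mem d1 (List.ne_nil_of_mem h) ha
  · exact d3 _ h _ h' rfl

theorem base_label_left (h : G.PartialTree k l r vs ws) {a : H} (ha : a ∈ l.labels) :
    G.base a ∈ vs ∨ G.base a ∈ ws := by
  obtain ⟨h1, h2, h3, h4⟩ := h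
  rcases h1.base_label _ ha with ⟨rfl, rfl⟩ | h
  · have := h2.top (by simpa using h4)
    rw [G.inv_inv] at this
    exact .inr this
  · exact .inl h

theorem base_label (h : G.PartialTree k l r vs ws) {a : H} (ha : a ∈ l.labels ++ r.labels) :
    G.base a ∈ vs ++ ws := by
  rcases List.mem_append.1 ha with ha | ha
  · exact List.mem_append.2 (h.base_label_left ha)
  · exact List.mem_append.2 (h.symm.base_label_left ha).symm

theorem inner_left (h : G.PartialTree k l r vs ws) {x : H} (hx : G.base x ∈ vs)
    (hxl : x ∉ l.labels) (hxr : x ∉ r.labels) :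
    (G.base (G.inv x) ∈ vs ∨ G.base (G.inv x) ∈ ws) ∧ G.inv x ∉ l.labels ∧
      G.inv x ∉ r.labels := by
  obtain ⟨h1, h2, h3, h4⟩ := h
  obtain ⟨d1, d2, d3⟩ := List.nodup_append.1 h3
  by_cases hk : x = G.inv k
  · subst hk
    have hws : ws ≠ [] := by
      rintro rfl; exact hxr h2.mem_labels_of_nil
    have h5 := h2.top hws
    refine ⟨.inr h5, fun h => ?_, h2.inv_not_mem d2 hws⟩
    rcases h1.base_label _ h with ⟨rfl, -⟩ | h
    · simp at hx
    · exact d3 _ h _ h5 rfl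
  · obtain ⟨h5, h6, h7⟩ := h1.inner d1 hx hxl hk
    refine ⟨.inl h5, h6, fun h => ?_⟩
    rcases h2.base_label _ h with ⟨-, h⟩ | h
    · rw [← G.inv_inv x, h, G.inv_inv] at h7; exact h7 rfl
    · exact d3 _ h5 _ h rfl

theorem inner (h : G.PartialTree k l r vs ws) {x : H} (hx : G.base x ∈ vs ++ ws)
    (hxt : x ∉ l.labels ++ r.labels) :
    G.base (G.inv x) ∈ vs ++ ws ∧ G.inv x ∉ l.labels ++ r.labels := by
  simp only [List.mem_append, not_or] at hx hxt ⊢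
  rcases hx with hx | hx
  · exact h.inner_left hx hxt.1 hxt.2
  · have := h.symm.inner_left hx hxt.2 hxt.1
    exact ⟨this.1.symm, this.2.symm⟩

theorem exists_expand (h : G.PartialTree k l r vs ws) {x y z : H} {w : V}
    (hx : x ∈ l.labels ++ r.labels) (hw : G.IsTripod w (G.inv x) y z) (hwv : w ∉ vs ++ ws) :
    ∃ l' r' vs' ws', G.PartialTree k l' r' vs' ws' ∧
      (vs' ++ ws').length = (vs ++ ws).length + 1 := by
  obtain ⟨h1, h2, h3, h4⟩ := h
  rcases List.mem_append.1 hx with hx | hx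
  · obtain ⟨l', vs', b, p⟩ := h1.expand hx hw
    have p' : (vs' ++ ws).Perm (w :: (vs ++ ws)) := p.append_right _
    exact ⟨l', r, vs', ws, ⟨b, h2, p'.nodup_iff.2 (List.nodup_cons.2 ⟨hwv, h3⟩),
      fun h => by simp [h] at p'⟩, by simpa using p'.length_eq⟩
  · obtain ⟨r', ws', b, p⟩ := h2.expand hx hw
    have p' : (vs ++ ws').Perm (w :: (vs ++ ws)) := (p.append_left _).trans List.perm_middle
    exact ⟨l, r', vs, ws', ⟨h1, b, p'.nodup_iff.2 (List.nodup_cons.2 ⟨hwv, h3⟩),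
      fun h => by simp [h] at p'⟩, by simpa using p'.length_eq⟩

end PartialTree

theorem Branch.valence_eq {G : HalfEdgeGraph V H} {e : Λ → H} {k : H} {t : LeafTree Λ}
    {vs : List V} (h : G.Branch e k t vs) : ∀ v ∈ vs, G.valence v = 3 := by
  induction h with
  | leaf a => simp
  | node ht _ _ h1 h2 =>
    intro v hv
    simp only [List.mem_cons, List.mem_append] at hv
    rcases hv with rfl | hv | hv
    exacts [ht.valence_eq, h1 v hv, h2 v hv]

/-- A partial tree that cannot be expanded, in a connected graph. -/
theorem exists_spanning {G : HalfEdgeGraph V H} [Finite V] (hc : G.Connected)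
    (hval : ∀ v, G.valence v = 1 ∨ G.valence v = 3) (h3 : ∃ v, G.valence v = 3) :
    ∃ k l r vs ws, G.PartialTree k l r vs ws ∧ (∀ v, v ∈ vs ++ ws ↔ G.valence v = 3) ∧
      ∀ h, G.valence (G.base h) = 1 → G.valence (G.base (G.inv h)) = 3 := by
  classical
  have := Fintype.ofFinite V
  -- A partial tree with the largest possible number of vertices is taken.
  let P : ℕ → Prop := fun n => ∃ k l r vs ws, G.PartialTree k l r vs ws ∧ (vs ++ ws).length = n
  have hP1 : P 1 := by
    obtain ⟨v, hv⟩ := h3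
    obtain ⟨a, b, c, ht⟩ := exists_isTripod hv
    refine ⟨G.inv a, .node (.leaf b) (.leaf c), .leaf a, [v], [],
      ⟨.node (vs := []) (ws := []) ?_ (.leaf b) (.leaf c), ?_, by simp, by simp⟩, rfl⟩
    · rwa [G.inv_inv]
    · rw [G.inv_inv]; exact .leaf a
  have hbound : ∀ n, P n → n ≤ Fintype.card V := by
    rintro _ ⟨k, l, r, vs, ws, h, rfl⟩
    exact h.2.2.1.length_le_card
  obtain ⟨k, l, r, vs, ws, h, hn⟩ :=
    Nat.findGreatest_spec (P := P) (hbound 1 hP1) hP1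
  have hval3 : ∀ v ∈ vs ++ ws, G.valence v = 3 := by
    intro v hv
    rcases List.mem_append.1 hv with hv | hv
    exacts [h.1.valence_eq v hv, h.2.1.valence_eq v hv]
  have huniq : ∀ {v} {a b : H}, G.valence v = 1 → G.base a = v → G.base b = v → a = b := by
    intro v a b hv ha hb
    have h' : Set.ncard {x : H | G.base x = v} = 1 := hv
    obtain ⟨c, hc⟩ := Set.ncard_eq_one.1 h'
    have h1 : a ∈ {x : H | G.base x = v} := ha
    have h2 : b ∈ {x : H | G.base x = v} := hb
    rw [hc] at h1 h2
    exact h1.trans h2.symm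
  -- Follow a path from the partial tree. An uncut half-edge stays inside by `inner`; a cut one
  -- leading to a new trivalent vertex would permit an expansion, against maximality. So the path
  -- can leave only to a vertex of valence 1, from where it must return.
  have key : ∀ v, v ∈ vs ++ ws ∨
      G.valence v = 1 ∧ ∃ x, G.base x = v ∧ G.base (G.inv x) ∈ vs ++ ws := by
    obtain ⟨u, hu⟩ := List.exists_mem_of_ne_nil _ h.2.2.2
    intro v
    induction hc.2 u v with
    | refl => exact .inl hu
    | @tail v w _ hvw ih =>
      obtain ⟨x, hx, hx'⟩ := hvw
      rcases ih with ih | ⟨ih, y, hy, hy'⟩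
      · by_cases hw : w ∈ vs ++ ws
        · exact .inl hw
        rcases hval w with hw1 | hw3
        · exact .inr ⟨hw1, G.inv x, hx', by rwa [G.inv_inv, hx]⟩
        · exfalso
          by_cases hxt : x ∈ l.labels ++ r.labels
          · rw [← hx'] at hw3
            obtain ⟨b, c, ht⟩ := exists_isTripod_of_base hw3
            obtain ⟨l', r', vs', ws', h', hlen⟩ := h.exists_expand hxt ht (by rwa [hx'])
            have hP' : P ((vs' ++ ws').length) := ⟨k, l', r', vs', ws', h', rfl⟩
            have := Nat.le_findGreatest (hbound _ hP') hP'
            omega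
          · have := (h.inner (by rwa [hx]) hxt).1
            rw [hx'] at this; exact hw this
      · have := huniq ih hx hy
        subst this
        rw [hx'] at hy'
        exact .inl hy'
  refine ⟨k, l, r, vs, ws, h, fun v => ⟨hval3 v, fun hv => ?_⟩, fun x hx => ?_⟩
  · rcases key v with h | ⟨h, -⟩
    · exact h
    · omega
  · rcases key (G.base x) with h | ⟨h, y, hy, hy'⟩
    · have := hval3 _ h; omega
    · rw [huniq h rfl hy]; exact hval3 _ hy'

/-- A fixed-point free involution of a finite set with `2 * g` elements. -/
theorem exists_pairing [DecidableEq H] (σ : H → H) (hσ : ∀ x, σ (σ x) = x) (hne : ∀ x, σ x ≠ x)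
    (g : ℕ) (A : Finset H) (hA : ∀ x ∈ A, σ x ∈ A) (hcard : A.card = 2 * g) :
    ∃ f : Fin g × Bool → H, Function.Injective f ∧ (∀ x, x ∈ A ↔ ∃ j, f j = x) ∧
      ∀ j b, σ (f (j, b)) = f (j, !b) := by
  induction g generalizing A with
  | zero =>
    have : A = ∅ := by simpa using hcard
    subst this
    exact ⟨fun j => j.1.elim0, fun j => j.1.elim0, fun x => by simp, fun j => j.elim0⟩
  | succ g ih =>
    obtain ⟨a, ha⟩ : A.Nonempty := Finset.card_pos.1 (by omega)
    obtain ⟨f, hf, hfA, hfσ⟩ := ih ((A.erase a).erase (σ a)) (by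
      intro x hx
      simp only [Finset.mem_erase] at hx ⊢
      refine ⟨fun h => hx.2.1 ?_, fun h => hx.1 ?_, hA x hx.2.2⟩
      · rw [← hσ x, h, hσ]
      · rw [← h, hσ]) (by
      rw [Finset.card_erase_of_mem (by simp [hne a, hA a ha]), Finset.card_erase_of_mem ha]
      omega)
    have hfa : ∀ j, f j ≠ σ a ∧ f j ≠ a ∧ f j ∈ A := by
      intro j
      simpa using (hfA (f j)).2 ⟨j, rfl⟩
    refine ⟨fun j => Fin.cases (bif j.2 then σ a else a) (fun i => f (i, j.2)) j.1, ?_, ?_, ?_⟩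
    · rintro ⟨i, b⟩ ⟨i', b'⟩ h
      refine Fin.cases ?_ (fun i => ?_) i h <;> refine Fin.cases ?_ (fun i' => ?_) i'
      · rcases b <;> rcases b' <;> simp [hne a, (hne a).symm]
      · rcases b
        · simp [(hfa (i', b')).2.1.symm]
        · simp [(hfa (i', b')).1.symm]
      · rcases b'
        · simp [(hfa (i, b)).2.1]
        · simp [(hfa (i, b)).1]
      · intro h
        have := hf h
        simp at this ⊢
        exact this
    · intro x
      constructor
      · intro hx
        by_cases h1 : x = a
        · exact ⟨(0, false), h1.symm⟩
        by_cases h2 : x = σ a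
        · exact ⟨(0, true), h2.symm⟩
        obtain ⟨⟨i, b⟩, hj⟩ := (hfA x).1 (by simp [h1, h2, hx])
        exact ⟨(i.succ, b), hj⟩
      · rintro ⟨⟨i, b⟩, rfl⟩
        refine Fin.cases ?_ (fun i => ?_) i
        · rcases b
          exacts [ha, hA a ha]
        · exact (hfa (i, b)).2.2
    · intro i b
      refine Fin.cases ?_ (fun i => ?_) i
      · rcases b <;> simp [hσ]
      · simp [hfσ]

/-- The cut half-edges `e` are those next to the labeled vertices and pairs of half-edges of the
same edge. -/
def IsCut {g : ℕ} (G : HalfEdgeGraph V H) (l : L → V) (e : L ⊕ (Fin g × Bool) → H) : Prop :=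
  (∀ i, G.base (G.inv (e (.inl i))) = l i) ∧
    ∀ j b, G.inv (e (.inr (j, b))) = e (.inr (j, !b))

end HalfEdgeGraph

/-- Every marked graph is obtained from a tree by gluing pairs of ends. -/
theorem MarkedTrivalentGraph.exists_isTree {g p : ℕ} {L : Type}
    (hgp : 0 < 2 * (g : ℤ) - 2 + (p : ℤ)) (A : MarkedTrivalentGraph g p L) :
    ∃ (e : L ⊕ (Fin g × Bool) → A.H) (t : LeafTree (L ⊕ (Fin g × Bool))),
      A.graph.IsCut A.label e ∧ A.graph.IsTree e t ∧ t.labels.Nodup ∧ ∀ a, a ∈ t.labels := by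
  classical
  have := A.finite_V
  have := A.finite_H
  have hinst := Fintype.ofFinite A.V
  have h3 : ∃ v, A.graph.valence v = 3 := by
    have h := A.card_three
    by_contra! hne
    have : IsEmpty {v // A.graph.valence v = 3} := ⟨fun v => hne v.1 v.2⟩
    rw [Nat.card_of_isEmpty] at h
    push_cast at h; omega
  obtain ⟨k, l, r, vs, ws, hp, hv3, hleg⟩ := A.graph.exists_spanning A.connected A.valence_eq h3
  have hd := hp.labels_nodup
  -- the legs
  have hlab : ∀ i, A.graph.valence (A.label i) = 1 := fun i => by
    have : A.label i ∈ Set.range A.label := ⟨i, rfl⟩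
    rw [A.range_label] at this; exact this
  have hex : ∀ i, ∃ m, A.graph.base m = A.label i := by
    intro i
    have h1 : Nat.card {h : A.H // A.graph.base h = A.label i} = 1 := hlab i
    obtain ⟨⟨m, hm⟩⟩ := (Nat.card_eq_one_iff_unique.1 h1).2
    exact ⟨m, hm⟩
  choose m hm using hex
  have huniq : ∀ i x, A.graph.base x = A.label i → x = m i := by
    intro i x hx
    have h1 : Nat.card {h : A.H // A.graph.base h = A.label i} = 1 := hlab i
    have := (Nat.card_eq_one_iff_unique.1 h1).1
    exact congrArg Subtype.val (Subsingleton.elim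
      (⟨x, hx⟩ : {h : A.H // A.graph.base h = A.label i}) ⟨m i, hm i⟩)
  set S := l.labels ++ r.labels with hS
  have hbase : ∀ a ∈ S, A.graph.valence (A.graph.base a) = 3 := fun a ha =>
    (hv3 _).1 (hp.base_label ha)
  have hinv : ∀ a ∈ S, A.graph.valence (A.graph.base (A.graph.inv a)) = 3 →
      A.graph.inv a ∈ S := by
    intro a ha h
    by_contra hn
    have := (hp.inner ((hv3 _).2 h) hn).2
    rw [A.graph.inv_inv] at this
    exact this ha
  have hmS : ∀ i, A.graph.inv (m i) ∈ S := by
    intro i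
    by_contra hn
    have h1 := hleg (m i) (by rw [hm, hlab])
    have := (hv3 _).1 (hp.inner ((hv3 _).2 h1) hn).1
    rw [A.graph.inv_inv, hm, hlab] at this
    omega
  have hminj : Function.Injective fun i => A.graph.inv (m i) := by
    intro i j hij
    have : m i = m j := by
      rw [← A.graph.inv_inv (m i), ← A.graph.inv_inv (m j)]; exact congrArg _ hij
    apply A.label_injective
    rw [← hm, ← hm, this]
  have : Finite L := Finite.of_injective _ A.label_injective
  have := Fintype.ofFinite L
  -- counting
  have hcardL : Fintype.card L = p := by
    rw [← A.card_one, ← Nat.card_eq_fintype_card,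
      Nat.card_congr (Equiv.ofInjective _ A.label_injective), A.range_label]
    rfl
  have hcard3 : (vs ++ ws).length = Nat.card {v // A.graph.valence v = 3} := by
    rw [← List.toFinset_card_of_nodup hp.2.2.1, Nat.card_eq_fintype_card, Fintype.card_subtype]
    congr 1; ext v; rw [List.mem_toFinset, hv3]; simp
  -- Each of the two branches has one end more than vertices, and there are `2g - 2 + p` trivalent
  -- vertices.
  have hlen : S.toFinset.card = 2 * g + p := by
    rw [List.toFinset_card_of_nodup hd]
    have h1 := hp.1.labels_length
    have h2 := hp.2.1.labels_length
    have h3 := A.card_three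
    rw [← hcard3] at h3
    simp only [hS, List.length_append] at h3 ⊢
    push_cast at h3
    omega
  -- `B` consists of the ends to be glued in pairs, `C` of the ends at the labeled vertices.
  let B := S.toFinset.filter fun a => A.graph.valence (A.graph.base (A.graph.inv a)) = 3
  let C := S.toFinset.filter fun a => ¬ A.graph.valence (A.graph.base (A.graph.inv a)) = 3
  have hC : C = Finset.univ.image fun i => A.graph.inv (m i) := by
    ext a
    simp only [C, Finset.mem_filter, List.mem_toFinset, Finset.mem_image, Finset.mem_univ,
      true_and]
    constructor
    · rintro ⟨ha, h⟩
      have h1 := (A.valence_eq (A.graph.base (A.graph.inv a))).resolve_right h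
      have : A.graph.base (A.graph.inv a) ∈ Set.range A.label := by
        rw [A.range_label]; exact h1
      obtain ⟨i, hi⟩ := this
      exact ⟨i, by rw [← huniq i _ hi.symm, A.graph.inv_inv]⟩
    · rintro ⟨i, rfl⟩
      refine ⟨hmS i, ?_⟩
      rw [A.graph.inv_inv, hm, hlab]; omega
  have hBcard : B.card = 2 * g := by
    have h1 := Finset.card_filter_add_card_filter_not (s := S.toFinset)
      (fun a => A.graph.valence (A.graph.base (A.graph.inv a)) = 3)
    have h2 : C.card = p := by
      rw [hC, Finset.card_image_of_injective _ hminj, Finset.card_univ, hcardL]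
    have h1 : B.card + C.card = S.toFinset.card := h1
    omega
  obtain ⟨f, hf, hfB, hfσ⟩ := HalfEdgeGraph.exists_pairing A.graph.inv A.graph.inv_inv
    A.graph.inv_ne g B (by
      intro a ha
      simp only [B, Finset.mem_filter, List.mem_toFinset] at ha ⊢
      exact ⟨hinv a ha.1 ha.2, by rw [A.graph.inv_inv]; exact hbase a ha.1⟩) hBcard
  let e : L ⊕ (Fin g × Bool) → A.H := Sum.elim (fun i => A.graph.inv (m i)) f
  have hmem : ∀ x, x ∈ S ↔ ∃ a, e a = x := by
    intro x
    have h1 : x ∈ S ↔ x ∈ C ∨ x ∈ B := by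
      simp only [B, C, Finset.mem_filter, List.mem_toFinset]; tauto
    rw [h1, hfB, hC]
    simp [e]
  have he : Function.Injective e := by
    refine hminj.sumElim hf fun i j h => ?_
    have h1 : A.graph.inv (m i) ∈ C := by rw [hC]; simp
    have h2 : f j ∈ B := (hfB _).2 ⟨j, rfl⟩
    simp only [B, C, Finset.mem_filter] at h1 h2
    rw [h] at h1
    exact h1.2 h2.2
  have hne : Nonempty (L ⊕ (Fin g × Bool)) := by
    obtain ⟨a, -⟩ := (hmem _).1 (List.mem_append_left r.labels
      (List.getElem_mem (l.labels_length_pos)))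
    exact ⟨a⟩
  let d := Function.invFun e
  have hde : ∀ x ∈ S, e (d x) = x := fun x hx => Function.invFun_eq ((hmem x).1 hx)
  refine ⟨e, (LeafTree.node l r).map d, ⟨fun i => ?_, hfσ⟩,
    ⟨l.map d, r.map d, k, vs, ws, rfl, hp.1.map d fun a ha => hde a (by simp [S, ha]),
      hp.2.1.map d fun a ha => hde a (by simp [S, ha]), hp.2.2.1, hv3⟩, ?_, ?_⟩
  · simp only [e, Sum.elim_inl, A.graph.inv_inv, hm]
  · rw [LeafTree.labels_map]
    refine (List.nodup_map_iff_inj_on hd).2 fun x hx y hy hxy => ?_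
    rw [← hde x hx, ← hde y hy, hxy]
  · intro a
    rw [LeafTree.labels_map, List.mem_map]
    exact ⟨e a, (hmem _).2 ⟨a, rfl⟩, Function.leftInverse_invFun he a⟩

/-! ### A graph is determined by its cut tree -/

namespace HalfEdgeGraph

variable {V H V' H' Λ : Type}

/-- The list `hs` consists of the half-edges at the vertices in `vs`. -/
def IsStar (G : HalfEdgeGraph V H) (vs : List V) (hs : List H) : Prop :=
  hs.Nodup ∧ ∀ h, h ∈ hs ↔ G.base h ∈ vs

theorem IsStar.append {G : HalfEdgeGraph V H} {vs ws : List V} {hs is : List H}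
    (h : G.IsStar vs hs) (h' : G.IsStar ws is) (hd : (vs ++ ws).Nodup) :
    G.IsStar (vs ++ ws) (hs ++ is) := by
  refine ⟨List.nodup_append.2 ⟨h.1, h'.1, ?_⟩, fun x => by simp [h.2, h'.2]⟩
  rintro x hx _ hx' rfl
  exact (List.nodup_append.1 hd).2.2 _ ((h.2 x).1 hx) _ ((h'.2 x).1 hx') rfl

theorem IsTripod.isStar {G : HalfEdgeGraph V H} {v : V} {a b c : H} (h : G.IsTripod v a b c) :
    G.IsStar [v] [a, b, c] := by
  refine ⟨by simp [h.ne_ab, h.ne_ac, h.ne_bc], fun x => by simp [h.base_iff]⟩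

/-- Corresponding vertices and half-edges of two branches with the same tree. -/
structure Matching (G : HalfEdgeGraph V H) (G' : HalfEdgeGraph V' H') (vs : List V)
    (vs' : List V') (P : List (V × V')) (Q : List (H × H')) : Prop where
  map_fst : P.map Prod.fst = vs
  map_snd : P.map Prod.snd = vs'
  star_fst : G.IsStar vs (Q.map Prod.fst)
  star_snd : G'.IsStar vs' (Q.map Prod.snd)
  base_mem : ∀ q ∈ Q, (G.base q.1, G'.base q.2) ∈ P

theorem Matching.append {G : HalfEdgeGraph V H} {G' : HalfEdgeGraph V' H'} {vs ws : List V}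
    {vs' ws' : List V'} {P R : List (V × V')} {Q S : List (H × H')}
    (h : Matching G G' vs vs' P Q) (h' : Matching G G' ws ws' R S) (hd : (vs ++ ws).Nodup)
    (hd' : (vs' ++ ws').Nodup) : Matching G G' (vs ++ ws) (vs' ++ ws') (P ++ R) (Q ++ S) where
  map_fst := by simp [h.map_fst, h'.map_fst]
  map_snd := by simp [h.map_snd, h'.map_snd]
  star_fst := by rw [List.map_append]; exact h.star_fst.append h'.star_fst hd
  star_snd := by rw [List.map_append]; exact h.star_snd.append h'.star_snd hd'
  base_mem q hq := by
    rcases List.mem_append.1 hq with hq | hq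
    exacts [List.mem_append_left _ (h.base_mem q hq), List.mem_append_right _ (h'.base_mem q hq)]

/-- The two branches are traversed in parallel. The resulting pairs are closed under `inv` except at
the root and at cut half-edges, whose opposite halves may lie outside. A bare leaf has no vertex at
which its half-edge could be listed, hence the alternatives with `vs = []`. -/
theorem Branch.exists_matching {G : HalfEdgeGraph V H} {G' : HalfEdgeGraph V' H'} {e : Λ → H}
    {e' : Λ → H'} {t : LeafTree Λ} {k : H} {k' : H'} {vs : List V} {vs' : List V'}
    (h : G.Branch e k t vs) (h' : G'.Branch e' k' t vs') (hd : vs.Nodup) (hd' : vs'.Nodup) :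
    ∃ P Q, Matching G G' vs vs' P Q ∧
      (vs = [] ∧ (∃ a, k = e a ∧ k' = e' a) ∨ (G.inv k, G'.inv k') ∈ Q) ∧
      (∀ a ∈ t.labels, vs = [] ∧ k = e a ∧ k' = e' a ∨ (e a, e' a) ∈ Q) ∧
      ∀ q ∈ Q, q = (G.inv k, G'.inv k') ∨ (∃ a, q = (e a, e' a)) ∨
        (G.inv q.1, G'.inv q.2) ∈ Q := by
  induction h generalizing k' vs' with
  | leaf a =>
    generalize ht : LeafTree.leaf a = t at h'
    cases h' with
    | leaf b =>
      cases ht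
      exact ⟨[], [], ⟨rfl, rfl, by simp [IsStar], by simp [IsStar], by simp⟩,
        .inl ⟨rfl, a, rfl, rfl⟩, by simp [LeafTree.labels], by simp⟩
    | node => cases ht
  | @node k x y l r v us ws ht b1 b2 ih1 ih2 =>
    cases h' with
    | @node _ x' y' _ _ v' us' ws' ht' b1' b2' =>
    have d := List.nodup_cons.1 hd
    have d' := List.nodup_cons.1 hd'
    obtain ⟨P₁, Q₁, m1, r1, l1, q1⟩ := ih1 b1' (List.nodup_append.1 d.2).1
      (List.nodup_append.1 d'.2).1
    obtain ⟨P₂, Q₂, m2, r2, l2, q2⟩ := ih2 b2' (List.nodup_append.1 d.2).2.1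
      (List.nodup_append.1 d'.2).2.1
    have m0 : Matching G G' [v] [v'] [(v, v')] [(G.inv k, G'.inv k'), (x, x'), (y, y')] :=
      ⟨rfl, rfl, ht.isStar, ht'.isStar, by
        simp [ht.base_a, ht.base_b, ht.base_c, ht'.base_a, ht'.base_b, ht'.base_c]⟩
    refine ⟨_, _, m0.append (m1.append m2 d.2 d'.2) hd hd', .inr (by simp), ?_, ?_⟩
    · intro a ha
      right
      rcases List.mem_append.1 ha with ha | ha
      · rcases l1 a ha with ⟨-, rfl, rfl⟩ | h
        · simp
        · simp [h]
      · rcases l2 a ha with ⟨-, rfl, rfl⟩ | h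
        · simp
        · simp [h]
    · intro q hq
      simp only [List.mem_append, List.mem_cons, List.not_mem_nil, or_false] at hq ⊢
      rcases hq with (rfl | rfl | rfl) | hq | hq
      · exact .inl rfl
      · rcases r1 with ⟨-, a, rfl, rfl⟩ | h
        · exact .inr (.inl ⟨a, rfl⟩)
        · exact .inr (.inr (.inr (.inl h)))
      · rcases r2 with ⟨-, a, rfl, rfl⟩ | h
        · exact .inr (.inl ⟨a, rfl⟩)
        · exact .inr (.inr (.inr (.inr h)))
      · rcases q1 q hq with rfl | h | h
        · simp [G.inv_inv, G'.inv_inv]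
        · exact .inr (.inl h)
        · exact .inr (.inr (.inr (.inl h)))
      · rcases q2 q hq with rfl | h | h
        · simp [G.inv_inv, G'.inv_inv]
        · exact .inr (.inl h)
        · exact .inr (.inr (.inr (.inr h)))

theorem exists_equiv_of_pairs {A B : Type} (P : List (A × B)) (h1 : (P.map Prod.fst).Nodup)
    (h2 : (P.map Prod.snd).Nodup) (h1' : ∀ a, a ∈ P.map Prod.fst)
    (h2' : ∀ b, b ∈ P.map Prod.snd) :
    ∃ φ : A ≃ B, (∀ a, (a, φ a) ∈ P) ∧ ∀ q ∈ P, φ q.1 = q.2 := by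
  have hex : ∀ a, ∃ b, (a, b) ∈ P := fun a => by simpa using h1' a
  choose f hf using hex
  have hf' : ∀ q ∈ P, f q.1 = q.2 := fun q hq =>
    congrArg Prod.snd (List.inj_on_of_nodup_map h1 (hf q.1) hq rfl)
  refine ⟨Equiv.ofBijective f ⟨fun a b hab => ?_, fun b => ?_⟩, hf, hf'⟩
  · exact congrArg Prod.fst (List.inj_on_of_nodup_map h2 (hf a) (hf b) hab)
  · obtain ⟨q, hq, rfl⟩ := List.mem_map.1 (h2' b)
    exact ⟨q.1, hf' q hq⟩

end HalfEdgeGraph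

namespace MarkedTrivalentGraph

open HalfEdgeGraph

variable {g p : ℕ} {L : Type}

theorem valence_label (A : MarkedTrivalentGraph g p L) (i : L) :
    A.graph.valence (A.label i) = 1 := by
  have : A.label i ∈ Set.range A.label := ⟨i, rfl⟩
  rw [A.range_label] at this; exact this

theorem exists_label (A : MarkedTrivalentGraph g p L) {v : A.V} (h : A.graph.valence v = 1) :
    ∃ i, A.label i = v := by
  have : v ∈ Set.range A.label := by rw [A.range_label]; exact h
  exact this

theorem finite_L (A : MarkedTrivalentGraph g p L) : Finite L := by
  have := A.finite_V
  exact Finite.of_injective _ A.label_injective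

theorem eq_of_base_label (A : MarkedTrivalentGraph g p L) {i : L} {x y : A.H}
    (hx : A.graph.base x = A.label i) (hy : A.graph.base y = A.label i) : x = y := by
  have h1 : Nat.card {h : A.H // A.graph.base h = A.label i} = 1 := A.valence_label i
  have := (Nat.card_eq_one_iff_unique.1 h1).1
  exact congrArg Subtype.val (Subsingleton.elim
    (⟨x, hx⟩ : {h : A.H // A.graph.base h = A.label i}) ⟨y, hy⟩)

/-- The legs of a cut marked graph. -/
theorem isStar_legs (A : MarkedTrivalentGraph g p L) [Fintype L]
    {e : L ⊕ (Fin g × Bool) → A.H} (he : A.graph.IsCut A.label e) :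
    A.graph.IsStar (Finset.univ.toList.map A.label)
      (Finset.univ.toList.map fun i => A.graph.inv (e (.inl i))) := by
  refine ⟨(List.nodup_map_iff_inj_on (Finset.nodup_toList _)).2 fun i _ j _ hij => ?_,
    fun h => ?_⟩
  · apply A.label_injective
    rw [← he.1, ← he.1, hij]
  · simp only [List.mem_map, Finset.mem_toList, Finset.mem_univ, true_and]
    constructor
    · rintro ⟨i, rfl⟩; exact ⟨i, (he.1 i).symm⟩
    · rintro ⟨i, hi⟩; exact ⟨i, A.eq_of_base_label (he.1 i) hi.symm⟩

/-- Marked graphs that are glued from the same tree are isomorphic. -/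
theorem labeledIsomorphic_of_isTree (hgp : 0 < 2 * (g : ℤ) - 2 + (p : ℤ))
    (A B : MarkedTrivalentGraph g p L) {e : L ⊕ (Fin g × Bool) → A.H}
    {e' : L ⊕ (Fin g × Bool) → B.H} {t : LeafTree (L ⊕ (Fin g × Bool))}
    (hA : A.graph.IsCut A.label e) (hB : B.graph.IsCut B.label e') (tA : A.graph.IsTree e t)
    (tB : B.graph.IsTree e' t) (ht : ∀ a, a ∈ t.labels) :
    A.graph.LabeledIsomorphic A.label B.graph B.label := by
  classical
  have := A.finite_L
  have := Fintype.ofFinite L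
  obtain ⟨l, r, k, vs, ws, rfl, a1, a2, ad, av⟩ := tA
  obtain ⟨l', r', k', vs', ws', heq, b1, b2, bd, bv⟩ := tB
  cases heq
  obtain ⟨P₁, Q₁, m1, r1, l1, q1⟩ := a1.exists_matching b1 (List.nodup_append.1 ad).1
    (List.nodup_append.1 bd).1
  obtain ⟨P₂, Q₂, m2, r2, l2, q2⟩ := a2.exists_matching b2 (List.nodup_append.1 ad).2.1
    (List.nodup_append.1 bd).2.1
  rw [A.graph.inv_inv, B.graph.inv_inv] at r2 q2
  have hne : vs ++ ws ≠ [] := by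
    intro h
    have h3 := A.card_three
    have : IsEmpty {v // A.graph.valence v = 3} := ⟨fun v => by
      have := (av v.1).2 v.2
      rw [h] at this; simp at this⟩
    rw [Nat.card_of_isEmpty] at h3
    push_cast at h3; omega
  let P₃ := (Finset.univ : Finset L).toList.map fun i => (A.label i, B.label i)
  let Q₃ := (Finset.univ : Finset L).toList.map fun i =>
    (A.graph.inv (e (.inl i)), B.graph.inv (e' (.inl i)))
  have m3 : Matching A.graph B.graph (Finset.univ.toList.map A.label)
      (Finset.univ.toList.map B.label) P₃ Q₃ := by
    refine ⟨by simp [P₃], by simp [P₃], ?_, ?_, ?_⟩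
    · rw [List.map_map]; exact A.isStar_legs hA
    · rw [List.map_map]; exact B.isStar_legs hB
    · simp only [Q₃, P₃, List.mem_map]
      rintro _ ⟨i, hi, rfl⟩
      exact ⟨i, hi, by rw [hA.1, hB.1]⟩
  have disj : ∀ (C : MarkedTrivalentGraph g p L) {us : List C.V}, us.Nodup →
      (∀ v, v ∈ us ↔ C.graph.valence v = 3) → (us ++ Finset.univ.toList.map C.label).Nodup ∧
        ∀ v, v ∈ us ++ Finset.univ.toList.map C.label := by
    intro C us hd hv
    refine ⟨List.nodup_append.2 ⟨hd, (Finset.nodup_toList _).map C.label_injective, ?_⟩, ?_⟩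
    · rintro v hv' _ hw rfl
      simp only [List.mem_map, Finset.mem_toList, Finset.mem_univ, true_and] at hw
      obtain ⟨i, rfl⟩ := hw
      have := (hv _).1 hv'
      rw [C.valence_label] at this; omega
    · intro v
      rw [List.mem_append, hv]
      rcases C.valence_eq v with h | h
      · obtain ⟨i, rfl⟩ := C.exists_label h
        exact .inr (List.mem_map.2 ⟨i, by simp, rfl⟩)
      · exact .inl h
  obtain ⟨ad', av'⟩ := disj A ad av
  obtain ⟨bd', bv'⟩ := disj B bd bv
  have m := (m1.append m2 ad bd).append m3 ad' bd'
  obtain ⟨φ, hφ, hφ'⟩ := exists_equiv_of_pairs _ (by rw [m.map_fst]; exact ad')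
    (by rw [m.map_snd]; exact bd') (by rw [m.map_fst]; exact av') (by rw [m.map_snd]; exact bv')
  obtain ⟨η, hη, hη'⟩ := exists_equiv_of_pairs _ m.star_fst.1 m.star_snd.1
    (fun h => (m.star_fst.2 h).2 (av' _)) (fun h => (m.star_snd.2 h).2 (bv' _))
  -- If one side is a bare leaf, its cut half-edge is the root half-edge of the other side, which
  -- has a vertex by `hne` and lists it.
  have hlab : ∀ a, (e a, e' a) ∈ Q₁ ++ Q₂ ++ Q₃ := by
    intro a
    refine List.mem_append_left _ ?_
    rcases List.mem_append.1 (ht a) with ha | ha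
    · rcases l1 a ha with ⟨rfl, rfl, rfl⟩ | h
      · rcases r2 with ⟨rfl, -⟩ | h
        · exact absurd rfl hne
        · exact List.mem_append_right _ h
      · exact List.mem_append_left _ h
    · rcases l2 a ha with ⟨rfl, h, h'⟩ | h
      · rcases r1 with ⟨rfl, -⟩ | h''
        · exact absurd rfl hne
        · rw [h, h'] at h''
          exact List.mem_append_left _ h''
      · exact List.mem_append_right _ h
  have hleg : ∀ a, (A.graph.inv (e a), B.graph.inv (e' a)) ∈ Q₁ ++ Q₂ ++ Q₃ := by
    rintro (i | ⟨j, b⟩)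
    · exact List.mem_append_right _ (List.mem_map.2 ⟨i, by simp, rfl⟩)
    · rw [hA.2, hB.2]; exact hlab _
  have hinv : ∀ q ∈ Q₁ ++ Q₂ ++ Q₃, (A.graph.inv q.1, B.graph.inv q.2) ∈ Q₁ ++ Q₂ ++ Q₃ := by
    intro q hq
    rcases List.mem_append.1 hq with hq | hq
    · rcases List.mem_append.1 hq with hq | hq
      · rcases q1 q hq with rfl | ⟨a, rfl⟩ | h
        · simp only [A.graph.inv_inv, B.graph.inv_inv]
          rcases r2 with ⟨-, a, h, h'⟩ | h
          · rw [← A.graph.inv_inv k, ← B.graph.inv_inv k', h, h']; exact hleg a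
          · simp [h]
        · exact hleg a
        · simp [h]
      · rcases q2 q hq with rfl | ⟨a, rfl⟩ | h
        · rcases r1 with ⟨-, a, h, h'⟩ | h
          · simp only [h, h']; exact hleg a
          · simp [h]
        · exact hleg a
        · simp [h]
    · obtain ⟨i, -, rfl⟩ := List.mem_map.1 hq
      simp only [A.graph.inv_inv, B.graph.inv_inv]
      exact hlab _
  refine ⟨φ, η, fun h => ?_, fun h => ?_, fun i => ?_⟩
  · exact (hφ' _ (m.base_mem _ (hη h))).symm
  · exact (hη' _ (hinv _ (hη h))).symm
  · exact (hφ' (A.label i, B.label i) (List.mem_append_right _ (List.mem_map.2 ⟨i, by simp, rfl⟩))).symm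

end MarkedTrivalentGraph

/-! ### The diameter of a graph under a simultaneous move -/

namespace SimpleGraph

variable {α β : Type*} {S : SimpleGraph α} {T : SimpleGraph β}

/-- For points that are not joined by a walk the right side must be `⊤`; this needs `c ≠ 0`, since
`0 * ⊤ = 0`. -/
theorem edist_map_le_mul {f : α → β} {c : ℕ} (hc : c ≠ 0)
    (h : ∀ x y, S.Adj x y → T.edist (f x) (f y) ≤ c) (x y : α) :
    T.edist (f x) (f y) ≤ c * S.edist x y := by
  by_cases hxy : S.Reachable x y
  · obtain ⟨w, hw⟩ := hxy.exists_walk_length_eq_edist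
    rw [← hw]
    clear hw hxy
    induction w with
    | nil => simp
    | @cons u v w huv p ih =>
      calc T.edist (f u) (f w) ≤ T.edist (f u) (f v) + T.edist (f v) (f w) := T.edist_triangle
        _ ≤ c + c * p.length := add_le_add (h _ _ huv) ih
        _ = c * (Walk.cons huv p).length := by
          rw [Walk.length_cons]; push_cast; ring
  · rw [edist_eq_top_of_not_reachable hxy, ENat.mul_top (by exact_mod_cast hc)]
    exact le_top

theorem ediam_le_mul_of_surjective {f : α → β} (hf : Function.Surjective f) {c : ℕ} (hc : c ≠ 0)
    (h : ∀ x y, S.Adj x y → T.edist (f x) (f y) ≤ c) : T.ediam ≤ c * S.ediam := by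
  refine ediam_le_iff.2 fun u v => ?_
  obtain ⟨x, rfl⟩ := hf u
  obtain ⟨y, rfl⟩ := hf v
  exact (edist_map_le_mul hc h x y).trans (by gcongr; exact edist_le_ediam)

end SimpleGraph

namespace HalfEdgeGraph

variable {V H V' H' : Type}

/-- The underlying simple graph. -/
def skeleton (G : HalfEdgeGraph V H) : SimpleGraph V :=
  SimpleGraph.fromRel fun x y => ∃ h, G.base h = x ∧ G.base (G.inv h) = y

theorem edist_skeleton_le (G : HalfEdgeGraph V H) (h : H) :
    G.skeleton.edist (G.base h) (G.base (G.inv h)) ≤ 1 := by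
  by_cases hne : G.base h = G.base (G.inv h)
  · rw [hne, SimpleGraph.edist_self]; simp
  · exact (SimpleGraph.edist_eq_one_iff_adj.2 (by
      rw [skeleton, SimpleGraph.fromRel_adj]; exact ⟨hne, .inl ⟨h, rfl, rfl⟩⟩)).le

theorem skeleton_adj_iff {G : HalfEdgeGraph V H} {x y : V} :
    G.skeleton.Adj x y ↔ x ≠ y ∧ ∃ h, G.base h = x ∧ G.base (G.inv h) = y := by
  rw [skeleton, SimpleGraph.fromRel_adj]
  refine and_congr_right fun _ => ⟨?_, .inl⟩
  rintro (h | ⟨h, h1, h2⟩)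
  · exact h
  · exact ⟨G.inv h, h2, by rw [G.inv_inv, h1]⟩

/-- A half-edge moves at most along an edge that is common to both graphs. -/
theorem WhiteheadMoves.base_eq_or {es : List H} {G G' : HalfEdgeGraph V H}
    (hp : es.Pairwise G.DisjointEdges) (h : WhiteheadMoves es G G') (x : H) :
    G'.base x = G.base x ∨ ∃ e, (e ∈ es ∨ G.inv e ∈ es) ∧ G.base e = G.base x ∧
      G.base (G.inv e) = G'.base x ∧ G'.base e = G.base x ∧ G'.base (G.inv e) = G'.base x := by
  induction es generalizing G with
  | nil => cases h; exact .inl rfl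
  | cons e es ih =>
    obtain ⟨G₁, h1, h2⟩ := h
    obtain ⟨hd, hp⟩ := List.pairwise_cons.1 hp
    have hinv : G₁.inv = G.inv := by
      obtain ⟨-, -, -, a, b, -, -, h, -⟩ := h1; exact h
    obtain ⟨c1, c2, c3⟩ := h1.base_eq_or
    have hfix : ∀ f, (∀ v, v = G.base e ∨ v = G.base (G.inv e) → G.base f ≠ v) →
        G₁.base f = G.base f := by
      intro f hf
      rcases c3 f with h | ⟨h, -⟩ | ⟨h, -⟩
      exacts [h, absurd h (hf _ (.inl rfl)), absurd h (hf _ (.inr rfl))]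
    have hne : ∀ f ∈ es, (∀ v, v = G.base e ∨ v = G.base (G.inv e) → G.base f ≠ v) ∧
        (∀ v, v = G.base e ∨ v = G.base (G.inv e) → G.base (G.inv f) ≠ v) := by
      intro f hf
      have := Set.disjoint_left.1 (hd f hf)
      exact ⟨fun v hv h => this hv (.inl h.symm), fun v hv h => this hv (.inr h.symm)⟩
    have hsame : ∀ f, f ∈ es ∨ G.inv f ∈ es →
        G₁.base f = G.base f ∧ G₁.base (G.inv f) = G.base (G.inv f) := by
      rintro f (hf | hf)
      · exact ⟨hfix _ (hne f hf).1, hfix _ (hne f hf).2⟩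
      · have := (hne _ hf).2
        rw [G.inv_inv] at this
        exact ⟨hfix _ this, hfix _ (hne _ hf).1⟩
    -- The remaining moves avoid both ends of `e`, so what is attached there after the first move
    -- stays there.
    have hfr := h2.frame (S := {v | v ≠ G.base e ∧ v ≠ G.base (G.inv e)}) (by
      intro f hf
      obtain ⟨s1, s2⟩ := hsame f (.inl hf)
      obtain ⟨n1, n2⟩ := hne f hf
      rw [hinv, s1, s2]
      exact ⟨⟨n1 _ (.inl rfl), n1 _ (.inr rfl)⟩, ⟨n2 _ (.inl rfl), n2 _ (.inr rfl)⟩⟩)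
    have hkeep : ∀ f, G₁.base f = G.base e ∨ G₁.base f = G.base (G.inv e) →
        G'.base f = G₁.base f := by
      intro f hf
      exact (hfr f).2 fun h => hf.elim h.1 h.2
    have k1 := (hkeep e (.inl c1)).trans c1
    have k2 := (hkeep _ (.inr c2)).trans c2
    rcases c3 x with h | ⟨h, h'⟩ | ⟨h, h'⟩
    · have hp' : es.Pairwise G₁.DisjointEdges := by
        refine hp.imp_of_mem fun {a b} ha hb hab => ?_
        unfold DisjointEdges at hab ⊢
        rwa [hinv, (hsame a (.inl ha)).1, (hsame a (.inl ha)).2, (hsame b (.inl hb)).1,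
          (hsame b (.inl hb)).2]
      rcases ih hp' h2 with h' | ⟨f, hf, f1, f2, f3, f4⟩
      · exact .inl (h'.trans h)
      · rw [hinv] at hf f2 f4
        rw [(hsame f hf).1, h] at f1
        rw [(hsame f hf).2] at f2
        rw [h] at f3
        exact .inr ⟨f, hf.imp (List.mem_cons_of_mem _) (List.mem_cons_of_mem _), f1, f2, f3, f4⟩
    · have := hkeep x (.inr h')
      exact .inr ⟨e, .inl (by simp), h.symm, by rw [this, h'], by rw [k1, h],
        by rw [k2, this, h']⟩
    · have := hkeep x (.inl h')
      exact .inr ⟨G.inv e, .inr (by simp [G.inv_inv]), h.symm, by rw [this, h', G.inv_inv],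
        by rw [k2, h], by rw [this, h', G.inv_inv, k1]⟩

namespace SimultaneousWhiteheadMove

variable {G G' : HalfEdgeGraph V H}

theorem inv_eq (h : G.SimultaneousWhiteheadMove G') : G'.inv = G.inv := by
  obtain ⟨es, -, h⟩ := h; exact h.inv_eq

theorem edist_base_le (h : G.SimultaneousWhiteheadMove G') (x : H) :
    G.skeleton.edist (G.base x) (G'.base x) ≤ 1 ∧
      G'.skeleton.edist (G.base x) (G'.base x) ≤ 1 := by
  have hinv := h.inv_eq
  obtain ⟨es, hp, h⟩ := h
  rcases h.base_eq_or hp x with h | ⟨e, -, h1, h2, h3, h4⟩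
  · rw [h]; simp
  · refine ⟨?_, ?_⟩
    · rw [← h1, ← h2]; exact G.edist_skeleton_le e
    · rw [← h3, ← h4, ← hinv]; exact G'.edist_skeleton_le e

/-- The edge of `k` is present in both graphs, and each of its two ends has shifted by at most one
edge. -/
theorem edist_le (h : G.SimultaneousWhiteheadMove G') {x y : V} (hxy : G.skeleton.Adj x y) :
    G'.skeleton.edist x y ≤ 3 := by
  obtain ⟨-, k, rfl, rfl⟩ := skeleton_adj_iff.1 hxy
  have h1 := (h.edist_base_le k).2
  have h2 := (h.edist_base_le (G.inv k)).2
  have h3 := G'.edist_skeleton_le k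
  rw [h.inv_eq] at h3
  rw [SimpleGraph.edist_comm] at h2
  refine SimpleGraph.edist_triangle.trans ((add_le_add SimpleGraph.edist_triangle le_rfl).trans
    (add_le_add (add_le_add h1 h3) h2)) |>.trans ?_
  norm_num

theorem edist_le' (h : G.SimultaneousWhiteheadMove G') {x y : V} (hxy : G'.skeleton.Adj x y) :
    G.skeleton.edist x y ≤ 3 := by
  obtain ⟨-, k, rfl, rfl⟩ := skeleton_adj_iff.1 hxy
  have h1 := (h.edist_base_le k).1
  have h2 := (h.edist_base_le (G.inv k)).1
  have h3 := G.edist_skeleton_le k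
  rw [h.inv_eq]
  rw [SimpleGraph.edist_comm] at h1
  refine SimpleGraph.edist_triangle.trans ((add_le_add SimpleGraph.edist_triangle le_rfl).trans
    (add_le_add (add_le_add h1 h3) h2)) |>.trans ?_
  norm_num

theorem ediam_le (h : G.SimultaneousWhiteheadMove G') :
    G'.skeleton.ediam ≤ (3 : ℕ) * G.skeleton.ediam ∧
      G.skeleton.ediam ≤ (3 : ℕ) * G'.skeleton.ediam :=
  ⟨SimpleGraph.ediam_le_mul_of_surjective Function.surjective_id (by norm_num)
      fun _ _ hxy => h.edist_le hxy,
    SimpleGraph.ediam_le_mul_of_surjective Function.surjective_id (by norm_num)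
      fun _ _ hxy => h.edist_le' hxy⟩

end SimultaneousWhiteheadMove

theorem connected_iff (G : HalfEdgeGraph V H) : G.Connected ↔ G.skeleton.Connected := by
  rw [SimpleGraph.connected_iff, Connected, and_comm]
  refine and_congr_left fun _ => forall₂_congr fun u v => ?_
  rw [SimpleGraph.reachable_iff_reflTransGen]
  constructor
  · intro h
    induction h with
    | refl => exact .refl
    | @tail v w _ h ih =>
      by_cases hne : v = w
      · exact hne ▸ ih
      · exact ih.tail (skeleton_adj_iff.2 ⟨hne, h⟩)
  · exact Relation.ReflTransGen.mono (fun x y hxy => (skeleton_adj_iff.1 hxy).2) u v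

theorem SimultaneousWhiteheadMove.connected {G G' : HalfEdgeGraph V H}
    (h : G.SimultaneousWhiteheadMove G') (hG : G.Connected) : G'.Connected := by
  rw [connected_iff] at hG ⊢
  have := hG.nonempty
  refine ⟨fun u v => ?_⟩
  obtain ⟨w⟩ := hG.preconnected u v
  induction w with
  | nil => exact .refl _
  | cons huv _ ih =>
    refine SimpleGraph.Reachable.trans ?_ ih
    by_contra hn
    have := h.edist_le huv
    rw [SimpleGraph.edist_eq_top_of_not_reachable hn] at this
    exact absurd this (by decide)

theorem Isomorphic.ediam_le {G : HalfEdgeGraph V H} {G' : HalfEdgeGraph V' H'}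
    (h : G.Isomorphic G') : G'.skeleton.ediam ≤ G.skeleton.ediam := by
  obtain ⟨φ, η, h1, h2⟩ := h
  have := SimpleGraph.ediam_le_mul_of_surjective (S := G.skeleton) (T := G'.skeleton) φ.surjective
    (c := 1) (by norm_num) fun x y hxy => by
      obtain ⟨-, k, rfl, rfl⟩ := skeleton_adj_iff.1 hxy
      rw [← h1, ← h1, ← h2]
      exact G'.edist_skeleton_le _
  simpa using this

end HalfEdgeGraph

/-! ### Upper bounds, and passage to unmarked graphs -/

namespace MarkedTrivalentGraph

open HalfEdgeGraph

variable {g p : ℕ} {L : Type}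

/-- The isomorphism class of a marked graph. -/
def toSpace (A : MarkedTrivalentGraph g p L) : LabeledGraphSpace g p L := Quotient.mk _ A

theorem toSpace_surjective :
    Function.Surjective (toSpace : MarkedTrivalentGraph g p L → LabeledGraphSpace g p L) :=
  Quotient.mk_surjective

/-- The marked graph that arises by a simultaneous Whitehead move. -/
def move (A : MarkedTrivalentGraph g p L) (G : HalfEdgeGraph A.V A.H)
    (h : A.graph.SimultaneousWhiteheadMove G) : MarkedTrivalentGraph g p L where
  V := A.V
  H := A.H
  finite_V := A.finite_V
  finite_H := A.finite_H
  graph := G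
  connected := h.connected A.connected
  rank_eq := by
    rw [← A.rank_eq, rank, rank, edges, edges, h.inv_eq]
  valence_eq v := by rw [h.valence_eq]; exact A.valence_eq v
  card_one := by simp only [h.valence_eq]; exact A.card_one
  card_three := by simp only [h.valence_eq]; exact A.card_three
  label := A.label
  label_injective := A.label_injective
  range_label := by simp only [h.valence_eq]; exact A.range_label

theorem edist_move_le (A : MarkedTrivalentGraph g p L) (G : HalfEdgeGraph A.V A.H)
    (h : A.graph.SimultaneousWhiteheadMove G) :
    (labeledMoves g p L).edist A.toSpace (A.move G h).toSpace ≤ 1 := by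
  by_cases hne : A.toSpace = (A.move G h).toSpace
  · rw [← hne, SimpleGraph.edist_self]; simp
  · exact (SimpleGraph.edist_eq_one_iff_adj.2 ((SimpleGraph.fromRel_adj ..).2
      ⟨hne, .inl ⟨A, A.move G h, rfl, rfl, G, h, .refl _ _⟩⟩)).le

theorem exists_of_reach {n : ℕ} {t s : LeafTree (L ⊕ (Fin g × Bool))} (h : t.Reach n s)
    (A : MarkedTrivalentGraph g p L) {e : L ⊕ (Fin g × Bool) → A.H}
    (hA : A.graph.IsCut A.label e) (ht : A.graph.IsTree e t) :
    ∃ (B : MarkedTrivalentGraph g p L) (e' : L ⊕ (Fin g × Bool) → B.H),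
      B.graph.IsCut B.label e' ∧ B.graph.IsTree e' s ∧
      (labeledMoves g p L).edist A.toSpace B.toSpace ≤ n := by
  induction n generalizing A t with
  | zero => cases h; exact ⟨A, e, hA, ht, by simp⟩
  | succ n ih =>
    obtain ⟨u, hu, h⟩ := h
    obtain ⟨G, hG, hGu⟩ := ht.exists_move hu
    obtain ⟨B, e', h1, h2, h3⟩ := ih (t := u) h (A.move G hG.simultaneous) (e := e)
      -- Half-edges move only between trivalent vertices, so the legs stay at their labels.
      ⟨fun i => by
        change G.base (G.inv _) = A.label i
        rw [hG.inv_eq, hG.base_eq, hA.1]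
        rw [hA.1, Set.mem_ofPred_eq, A.valence_label]
        norm_num, fun j b => by
        change G.inv _ = _
        rw [hG.inv_eq, hA.2]⟩ hGu
    refine ⟨B, e', h1, h2, ?_⟩
    refine SimpleGraph.edist_triangle.trans
      ((add_le_add (A.edist_move_le G hG.simultaneous) h3).trans ?_)
    rw [add_comm]; push_cast; rfl

theorem card_label (A : MarkedTrivalentGraph g p L) : Nat.card L = p := by
  rw [← A.card_one, Nat.card_congr (Equiv.ofInjective _ A.label_injective), A.range_label]
  rfl

end MarkedTrivalentGraph

open HalfEdgeGraph in
/-- Every marked graph is close to one that is glued from a fixed shallow tree. -/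
theorem exists_shallow_tree {g p m : ℕ} (L : Type) (hgp : 0 < 2 * (g : ℤ) - 2 + (p : ℤ))
    (hL : Nat.card L = p) [Finite L] (hm : 2 * g + p ≤ 2 ^ m) :
    ∃ s : LeafTree (L ⊕ (Fin g × Bool)), s.height ≤ m ∧
      ∀ A : MarkedTrivalentGraph g p L, ∃ (B : MarkedTrivalentGraph g p L)
        (e : L ⊕ (Fin g × Bool) → B.H), B.graph.IsCut B.label e ∧ B.graph.IsTree e s ∧
        (∀ a, a ∈ s.labels) ∧ (labeledMoves g p L).edist A.toSpace B.toSpace ≤ (29 * m : ℕ) := by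
  have := Fintype.ofFinite L
  have hcard : (Finset.univ : Finset (L ⊕ (Fin g × Bool))).card = 2 * g + p := by
    rw [Finset.card_univ, Fintype.card_sum, ← Nat.card_eq_fintype_card, hL]
    simp; omega
  obtain ⟨s, hs, hr⟩ := LeafTree.exists_common_reach
    (Finset.univ : Finset (L ⊕ (Fin g × Bool))) (L := m) (by omega)
    (Finset.card_pos.1 (by omega))
  refine ⟨s, hs, fun A => ?_⟩
  obtain ⟨e, t, h1, h2, h3, h4⟩ := A.exists_isTree hgp
  have hrt := hr t h3 (by simpa using h4)
  obtain ⟨B, e', b1, b2, b3⟩ := A.exists_of_reach hrt h1 h2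
  exact ⟨B, e', b1, b2, fun a => hrt.labels_perm.mem_iff.1 (h4 a), b3⟩

open HalfEdgeGraph in
-- Both graphs are moved to graphs glued from the same tree, which are isomorphic; hence twice the
-- constant 29.
theorem edist_labeledMoves_le {g p m : ℕ} {L : Type} (hgp : 0 < 2 * (g : ℤ) - 2 + (p : ℤ))
    (hm : 2 * g + p ≤ 2 ^ m) (X Y : LabeledGraphSpace g p L) :
    (labeledMoves g p L).edist X Y ≤ (58 * m : ℕ) := by
  obtain ⟨A, rfl⟩ := MarkedTrivalentGraph.toSpace_surjective X
  obtain ⟨B, rfl⟩ := MarkedTrivalentGraph.toSpace_surjective Y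
  have := A.finite_L
  obtain ⟨s, -, hs⟩ := exists_shallow_tree L hgp A.card_label hm
  obtain ⟨A', e, a1, a2, ha, a3⟩ := hs A
  obtain ⟨B', e', b1, b2, -, b3⟩ := hs B
  have hAB : A'.toSpace = B'.toSpace :=
    Quotient.sound (A'.labeledIsomorphic_of_isTree hgp B' a1 b1 a2 b2 ha)
  rw [SimpleGraph.edist_comm, ← hAB] at b3
  refine SimpleGraph.edist_triangle.trans ((add_le_add a3 b3).trans ?_)
  norm_cast; omega

/-- Forget the marking. -/
def LabeledGraphSpace.forget {g p : ℕ} {L : Type} :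
    LabeledGraphSpace g p L → UnmarkedGraphSpace g p :=
  Quotient.map MarkedTrivalentGraph.toTrivalentGraph fun _ _ ⟨φ, η, h1, h2, _⟩ => ⟨φ, η, h1, h2⟩

theorem LabeledGraphSpace.forget_surjective {g p : ℕ} {L : Type} [Finite L]
    (hL : Nat.card L = p) :
    Function.Surjective (LabeledGraphSpace.forget : LabeledGraphSpace g p L → _) := by
  intro X
  induction X using Quotient.inductionOn with | _ A =>
  have := A.finite_V
  obtain ⟨ψ⟩ : Nonempty (L ≃ {v // A.graph.valence v = 1}) :=
    (Finite.card_eq).1 (hL.trans A.card_one.symm)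
  refine ⟨Quotient.mk _ ⟨A, fun i => (ψ i).1, fun i j hij => ψ.injective (Subtype.ext hij), ?_⟩,
    rfl⟩
  ext v
  constructor
  · rintro ⟨i, rfl⟩; exact (ψ i).2
  · intro hv; exact ⟨ψ.symm ⟨v, hv⟩, by simp⟩

theorem LabeledGraphSpace.edist_forget_le {g p : ℕ} {L : Type} (X Y : LabeledGraphSpace g p L)
    (h : (labeledMoves g p L).Adj X Y) :
    (unmarkedMoves g p).edist X.forget Y.forget ≤ (1 : ℕ) := by
  have key : ∀ X Y : LabeledGraphSpace g p L, X.Move Y → X.forget.Move Y.forget := by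
    rintro X Y ⟨A, B, rfl, rfl, G, hG, φ, η, h1, h2, -⟩
    exact ⟨A.toTrivalentGraph, B.toTrivalentGraph, rfl, rfl, G, hG, φ, η, h1, h2⟩
  by_cases hne : X.forget = Y.forget
  · rw [hne, SimpleGraph.edist_self]; simp
  · refine (SimpleGraph.edist_eq_one_iff_adj.2 ((SimpleGraph.fromRel_adj ..).2
      ⟨hne, ?_⟩)).le
    exact ((SimpleGraph.fromRel_adj ..).1 h).2.imp (key _ _) (key _ _)

theorem ediam_labeledMoves_le {g p m : ℕ} (L : Type) (hgp : 0 < 2 * (g : ℤ) - 2 + (p : ℤ))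
    (hm : 2 * g + p ≤ 2 ^ m) : (labeledMoves g p L).ediam ≤ (58 * m : ℕ) :=
  SimpleGraph.ediam_le_iff.2 fun _ _ => edist_labeledMoves_le hgp hm _ _

theorem ediam_unmarkedMoves_le {g p : ℕ} (L : Type) [Finite L] (hL : Nat.card L = p) :
    (unmarkedMoves g p).ediam ≤ (labeledMoves g p L).ediam := by
  simpa using SimpleGraph.ediam_le_mul_of_surjective
    (LabeledGraphSpace.forget_surjective (g := g) hL) (c := 1) (by norm_num)
    LabeledGraphSpace.edist_forget_le

/-- The combinatorial diameter of the graphs of a class. -/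
noncomputable def UnmarkedGraphSpace.width {g p : ℕ} : UnmarkedGraphSpace g p → ℕ∞ :=
  Quotient.lift (fun A : TrivalentGraph g p => A.graph.skeleton.ediam) fun _ _ h =>
    le_antisymm (Setoid.symm h).ediam_le (HalfEdgeGraph.Isomorphic.ediam_le h)

theorem UnmarkedGraphSpace.width_le_of_adj {g p : ℕ} {X Y : UnmarkedGraphSpace g p}
    (h : (unmarkedMoves g p).Adj X Y) : Y.width ≤ (3 : ℕ) * X.width := by
  have key : ∀ X Y : UnmarkedGraphSpace g p, X.Move Y →
      Y.width ≤ (3 : ℕ) * X.width ∧ X.width ≤ (3 : ℕ) * Y.width := by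
    rintro X Y ⟨A, B, rfl, rfl, G, hG, hiso⟩
    have h1 := hiso.ediam_le
    have h2 : G.skeleton.ediam ≤ B.graph.skeleton.ediam :=
      ((HalfEdgeGraph.isomorphic_iff _ _).2
        ((HalfEdgeGraph.isomorphic_iff _ _).1 hiso).symm).ediam_le
    have h3 := hG.ediam_le
    exact ⟨h1.trans h3.1, h3.2.trans (by gcongr; exact h2)⟩
  rcases ((SimpleGraph.fromRel_adj ..).1 h).2 with h | h
  exacts [(key _ _ h).1, (key _ _ h).2]

theorem UnmarkedGraphSpace.width_le_of_walk {g p : ℕ} {X Y : UnmarkedGraphSpace g p}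
    (w : (unmarkedMoves g p).Walk X Y) : Y.width ≤ (3 ^ w.length : ℕ) * X.width := by
  induction w with
  | nil => simp
  | cons h w ih =>
    refine ih.trans ?_
    rw [SimpleGraph.Walk.length_cons, pow_succ, Nat.cast_mul, mul_assoc]
    gcongr
    exact width_le_of_adj h

/-! ### Counting edges, and isomorphism invariants that separate points -/

namespace HalfEdgeGraph

variable {V H V' H' L : Type}

theorem two_mul_card_edges (G : HalfEdgeGraph V H) [Finite H] :
    2 * Nat.card G.edges = Nat.card H := by
  classical
  have := Fintype.ofFinite H
  have h1 : Nat.card G.edges =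
      (Finset.univ.image fun h => s(h, G.inv h)).card := by
    rw [Nat.card_coe_set_eq, ← Set.ncard_coe_finset]
    simp [edges]
  rw [h1, Nat.card_eq_fintype_card, ← Finset.card_univ,
    Finset.card_eq_sum_card_image (fun h => s(h, G.inv h)) Finset.univ,
    Finset.sum_const_nat (m := 2), mul_comm]
  intro q hq
  obtain ⟨h, -, rfl⟩ := Finset.mem_image.1 hq
  rw [Finset.card_eq_two]
  refine ⟨h, G.inv h, (G.inv_ne h).symm, ?_⟩
  ext x
  simp only [Finset.mem_filter, Finset.mem_univ, true_and, Finset.mem_insert,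
    Finset.mem_singleton, Sym2.eq_iff]
  constructor
  · rintro (h | h)
    exacts [.inl h.1, .inr h.1]
  · rintro (rfl | rfl)
    · simp
    · simp [G.inv_inv]

theorem reachable_base (G : HalfEdgeGraph V H) (h : H) :
    G.skeleton.Reachable (G.base h) (G.base (G.inv h)) := by
  by_contra hn
  have := G.edist_skeleton_le h
  rw [SimpleGraph.edist_eq_top_of_not_reachable hn] at this
  exact absurd this (by decide)

theorem Isomorphic.exists_loop {G : HalfEdgeGraph V H} {G' : HalfEdgeGraph V' H'}
    (h : G.Isomorphic G') (hG : ∃ x, G.base x = G.base (G.inv x)) :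
    ∃ x, G'.base x = G'.base (G'.inv x) := by
  obtain ⟨φ, η, h1, h2⟩ := h
  obtain ⟨x, hx⟩ := hG
  exact ⟨η x, by rw [h2, h1, h1, hx]⟩

theorem Isomorphic.exists_inner {G : HalfEdgeGraph V H} {G' : HalfEdgeGraph V' H'}
    (h : G.Isomorphic G')
    (hG : ∃ v, G.valence v = 3 ∧ ∀ x, G.base x = v → G.valence (G.base (G.inv x)) = 3) :
    ∃ v, G'.valence v = 3 ∧ ∀ x, G'.base x = v → G'.valence (G'.base (G'.inv x)) = 3 := by
  obtain ⟨φ, η, h1, h2⟩ := h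
  have hval : ∀ v, G'.valence (φ v) = G.valence v := fun v =>
    (Nat.card_congr (η.subtypeEquiv fun x => by rw [h1, φ.apply_eq_iff_eq])).symm
  obtain ⟨v, hv, hx⟩ := hG
  refine ⟨φ v, by rw [hval, hv], fun y hy => ?_⟩
  obtain ⟨x, rfl⟩ := η.surjective y
  rw [h1, φ.apply_eq_iff_eq] at hy
  rw [h2, h1, hval, hx x hy]

theorem LabeledIsomorphic.exists_common_neighbor {G : HalfEdgeGraph V H} {l : L → V}
    {G' : HalfEdgeGraph V' H'} {l' : L → V'} (h : G.LabeledIsomorphic l G' l') {i j : L}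
    (hG : ∃ x y, G.base x = l i ∧ G.base y = l j ∧ G.base (G.inv x) = G.base (G.inv y)) :
    ∃ x y, G'.base x = l' i ∧ G'.base y = l' j ∧ G'.base (G'.inv x) = G'.base (G'.inv y) := by
  obtain ⟨φ, η, h1, h2, h3⟩ := h
  obtain ⟨x, y, hx, hy, hxy⟩ := hG
  exact ⟨η x, η y, by rw [h1, h3, hx], by rw [h1, h3, hy], by rw [h2, h2, h1, h1, hxy]⟩

end HalfEdgeGraph

open HalfEdgeGraph

/-! ### Graphs glued from caterpillar trees -/

section Caterpillar

variable {g p m : ℕ} {L : Type}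

/-- The vertex of a caterpillar tree with `m + 1` trivalent vertices to which the `k`-th end is
attached. -/
def caterpillarAttach (m : ℕ) (k : Fin (m + 3)) : Fin (m + 1) :=
  -- Truncation at both sides attaches the ends 0 and 1 to the first vertex and the ends `m + 1` and
  -- `m + 2` to the last one.
  ⟨min (k - 1) m, by omega⟩

/-- The graph obtained from a caterpillar tree with `m + 3` ends by gluing pairs of ends, and
labeling the remaining ones. -/
def caterpillarGraph (π : L ⊕ (Fin g × Bool) ≃ Fin (m + 3)) :
    HalfEdgeGraph (Fin (m + 1) ⊕ L) ((Fin m × Bool) ⊕ (Fin (m + 3) ⊕ L)) where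
  inv h := match h with
    | .inl (i, b) => .inl (i, !b)
    | .inr (.inl k) => match π.symm k with
      | .inl l => .inr (.inr l)
      | .inr (j, b) => .inr (.inl (π (.inr (j, !b))))
    | .inr (.inr l) => .inr (.inl (π (.inl l)))
  base h := match h with
    | .inl (i, b) => .inl (bif b then i.succ else i.castSucc)
    | .inr (.inl k) => .inl (caterpillarAttach m k)
    | .inr (.inr l) => .inr l
  inv_inv h := by
    rcases h with ⟨i, b⟩ | k | l
    · simp
    · obtain ⟨(l | ⟨j, b⟩), rfl⟩ := π.surjective k <;> simp
    · simp
  inv_ne h := by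
    rcases h with ⟨i, b⟩ | k | l
    · simp
    · obtain ⟨(l | ⟨j, b⟩), rfl⟩ := π.surjective k <;> simp
    · simp

variable (π : L ⊕ (Fin g × Bool) ≃ Fin (m + 3))

theorem caterpillarGraph_isTripod (v : Fin (m + 1)) :
    (caterpillarGraph π).IsTripod (.inl v)
      (if h : v.1 = 0 then .inr (.inl 0) else .inl (⟨v - 1, by omega⟩, true))
      (.inr (.inl v.succ.castSucc))
      (if h : v.1 = m then .inr (.inl (Fin.last _)) else .inl (⟨v, by omega⟩, false)) := by
  have hv := v.2
  refine ⟨?_, ?_, ?_, ?_⟩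
  · split_ifs
    · simp only [ne_eq, Sum.inr.injEq, Sum.inl.injEq, Fin.ext_iff, Fin.val_zero,
        Fin.val_castSucc, Fin.val_succ]
      omega
    · simp
  · split_ifs
    · simp only [ne_eq, Sum.inr.injEq, Sum.inl.injEq, Fin.ext_iff, Fin.val_zero, Fin.val_last]
      omega
    all_goals simp
  · split_ifs
    · simp only [ne_eq, Sum.inr.injEq, Sum.inl.injEq, Fin.ext_iff, Fin.val_last,
        Fin.val_castSucc, Fin.val_succ]
      omega
    · simp
  · rintro (⟨i, b⟩ | k | l)
    · have hi := i.2
      rcases b <;> split_ifs <;> simp [caterpillarGraph, Fin.ext_iff] <;> omega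
    · have hk := k.2
      split_ifs <;> simp only [caterpillarGraph, caterpillarAttach, Fin.ext_iff, Sum.inl.injEq,
        Sum.inr.injEq, Fin.val_zero, Fin.val_last, Fin.val_castSucc, Fin.val_succ,
        false_or, or_false] <;> omega
    · split_ifs <;> simp [caterpillarGraph]

theorem caterpillarGraph_valence_inl (v : Fin (m + 1)) :
    (caterpillarGraph π).valence (.inl v) = 3 := (caterpillarGraph_isTripod π v).valence_eq

theorem caterpillarGraph_valence_inr (l : L) : (caterpillarGraph π).valence (.inr l) = 1 := by
  refine Nat.card_eq_one_iff_unique.2 ⟨⟨?_⟩, ⟨⟨.inr (.inr l), rfl⟩⟩⟩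
  rintro ⟨x, hx⟩ ⟨y, hy⟩
  rcases x with ⟨i, b⟩ | k | x <;> rcases y with ⟨i', b'⟩ | k' | y <;>
    simp [caterpillarGraph] at hx hy
  subst hx hy; rfl

theorem caterpillarGraph_connected : (caterpillarGraph π).Connected := by
  rw [connected_iff]
  have key : ∀ v, (caterpillarGraph π).skeleton.Reachable (.inl 0) v := by
    have h1 : ∀ v : Fin (m + 1), (caterpillarGraph π).skeleton.Reachable (.inl 0) (.inl v) := by
      intro v
      induction v using Fin.induction with
      | zero => exact .refl _
      | succ i ih => exact ih.trans ((caterpillarGraph π).reachable_base (.inl (i, false)))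
    rintro (v | l)
    · exact h1 v
    · exact (h1 _).trans ((caterpillarGraph π).reachable_base (.inr (.inr l))).symm
  have : Nonempty (Fin (m + 1) ⊕ L) := ⟨.inl 0⟩
  exact ⟨fun u v => (key u).symm.trans (key v)⟩

/-- The caterpillar graph as a marked graph. -/
def caterpillar [Finite L] (hL : Nat.card L = p) (hm : 2 * g + p = m + 3) :
    MarkedTrivalentGraph g p L where
  V := Fin (m + 1) ⊕ L
  H := (Fin m × Bool) ⊕ (Fin (m + 3) ⊕ L)
  finite_V := inferInstance
  finite_H := inferInstance
  graph := caterpillarGraph π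
  connected := caterpillarGraph_connected π
  rank_eq := by
    have h1 := (caterpillarGraph π).two_mul_card_edges
    simp only [Nat.card_sum, Nat.card_prod, Nat.card_eq_fintype_card (α := Bool),
      Nat.card_eq_fintype_card (α := Fin _), Fintype.card_fin, Fintype.card_bool, hL] at h1
    simp only [rank, Nat.card_sum, Nat.card_eq_fintype_card (α := Fin _), Fintype.card_fin, hL]
    push_cast; omega
  valence_eq v := by
    rcases v with v | l
    · exact .inr (caterpillarGraph_valence_inl π v)
    · exact .inl (caterpillarGraph_valence_inr π l)
  card_one := by
    rw [← hL]
    refine Nat.card_congr (Equiv.ofBijective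
      (fun l => ⟨.inr l, caterpillarGraph_valence_inr π l⟩) ⟨?_, ?_⟩).symm
    · intro l l' h; simpa using h
    · rintro ⟨v | l, hv⟩
      · rw [caterpillarGraph_valence_inl] at hv; omega
      · exact ⟨l, rfl⟩
  card_three := by
    have : Nat.card {v // (caterpillarGraph π).valence v = 3} = Nat.card (Fin (m + 1)) := by
      refine Nat.card_congr (Equiv.ofBijective
        (fun v => ⟨.inl v, caterpillarGraph_valence_inl π v⟩) ⟨?_, ?_⟩).symm
      · intro l l' h; simpa using h
      · rintro ⟨v | l, hv⟩
        · exact ⟨v, rfl⟩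
        · rw [caterpillarGraph_valence_inr] at hv; omega
    rw [this, Nat.card_eq_fintype_card, Fintype.card_fin]
    push_cast; omega
  label := .inr
  label_injective := Sum.inr_injective
  range_label := by
    ext v
    rcases v with v | l
    · simp [caterpillarGraph_valence_inl]
    · simp [caterpillarGraph_valence_inr]

theorem caterpillarGraph_inv_inr (l : L) :
    (caterpillarGraph π).inv (.inr (.inr l)) = .inr (.inl (π (.inl l))) := rfl

theorem caterpillarGraph_inv_label (l : L) :
    (caterpillarGraph π).inv (.inr (.inl (π (.inl l)))) = .inr (.inr l) := by
  simp [caterpillarGraph]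

theorem caterpillarGraph_inv_glued (j : Fin g) (b : Bool) :
    (caterpillarGraph π).inv (.inr (.inl (π (.inr (j, b))))) =
      .inr (.inl (π (.inr (j, !b)))) := by
  simp [caterpillarGraph]

theorem caterpillarGraph_exists_loop_iff :
    (∃ x, (caterpillarGraph π).base x = (caterpillarGraph π).base ((caterpillarGraph π).inv x)) ↔
      ∃ j b, caterpillarAttach m (π (.inr (j, b))) = caterpillarAttach m (π (.inr (j, !b))) := by
  constructor
  · rintro ⟨(⟨i, b⟩ | k | l), hx⟩
    · rcases b <;> simp [caterpillarGraph, Fin.ext_iff] at hx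
    · obtain ⟨(l | ⟨j, b⟩), rfl⟩ := π.surjective k
      · rw [caterpillarGraph_inv_label] at hx
        simp [caterpillarGraph] at hx
      · rw [caterpillarGraph_inv_glued] at hx
        exact ⟨j, b, Sum.inl_injective hx⟩
    · rw [caterpillarGraph_inv_inr] at hx
      simp [caterpillarGraph] at hx
  · rintro ⟨j, b, h⟩
    refine ⟨.inr (.inl (π (.inr (j, b)))), ?_⟩
    rw [caterpillarGraph_inv_glued]
    exact congrArg Sum.inl h

theorem caterpillarGraph_common_neighbor_iff (i j : L) :
    (∃ x y, (caterpillarGraph π).base x = .inr i ∧ (caterpillarGraph π).base y = .inr j ∧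
      (caterpillarGraph π).base ((caterpillarGraph π).inv x) =
        (caterpillarGraph π).base ((caterpillarGraph π).inv y)) ↔
      caterpillarAttach m (π (.inl i)) = caterpillarAttach m (π (.inl j)) := by
  constructor
  · rintro ⟨x, y, hx, hy, hxy⟩
    rcases x with ⟨i', b⟩ | k | x <;> simp [caterpillarGraph] at hx
    rcases y with ⟨i', b⟩ | k | y <;> simp [caterpillarGraph] at hy
    subst hx hy
    exact Sum.inl_injective hxy
  · intro h
    exact ⟨.inr (.inr i), .inr (.inr j), rfl, rfl, congrArg Sum.inl h⟩

/-- Without glued ends, every vertex of the path carries a leg. -/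
theorem caterpillarGraph_not_exists_inner (π : L ⊕ (Fin 0 × Bool) ≃ Fin (m + 3)) :
    ¬ ∃ v, (caterpillarGraph π).valence v = 3 ∧ ∀ x, (caterpillarGraph π).base x = v →
      (caterpillarGraph π).valence
        ((caterpillarGraph π).base ((caterpillarGraph π).inv x)) = 3 := by
  rintro ⟨v | l, hv, h⟩
  · have h1 := h _ (caterpillarGraph_isTripod π v).base_b
    obtain ⟨(l | ⟨j, b⟩), hl⟩ := π.surjective v.succ.castSucc
    · rw [← hl, caterpillarGraph_inv_label] at h1
      have h2 := caterpillarGraph_valence_inr π l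
      exact absurd (h1.symm.trans h2) (by norm_num)
    · exact j.elim0
  · rw [caterpillarGraph_valence_inr] at hv; omega

end Caterpillar

theorem SimpleGraph.Walk.sub_le_length {α : Type*} {S : SimpleGraph α} {f : α → ℤ}
    (hf : ∀ x y, S.Adj x y → f y - f x ≤ 1) {x y : α} (w : S.Walk x y) :
    f y - f x ≤ w.length := by
  induction w with
  | nil => simp
  | cons h w ih =>
    have := hf _ _ h
    rw [SimpleGraph.Walk.length_cons]; push_cast; omega

/-- The standard order of the ends: the labels come first, and then the pairs. -/
noncomputable def standardOrder {g p m : ℕ} {L : Type} [Finite L] (hL : Nat.card L = p)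
    (hm : 2 * g + p = m + 3) : L ⊕ (Fin g × Bool) ≃ Fin (m + 3) :=
  (Equiv.sumCongr (Finite.equivFinOfCardEq hL)
    ((Equiv.prodCongr (Equiv.refl _) finTwoEquiv.symm).trans finProdFinEquiv)).trans
    (finSumFinEquiv.trans (finCongr (by omega)))

section StandardOrder

variable {g p m : ℕ} {L : Type} [Finite L] (hL : Nat.card L = p) (hm : 2 * g + p = m + 3)

theorem standardOrder_inl (i : L) :
    (standardOrder hL hm (.inl i)).1 = (Finite.equivFinOfCardEq hL i).1 := by
  simp [standardOrder]

theorem standardOrder_inr (j : Fin g) (b : Bool) :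
    (standardOrder hL hm (.inr (j, b))).1 = p + 2 * j + (if b then 1 else 0) := by
  have h : (finTwoEquiv.symm b).1 = if b then 1 else 0 := by rcases b <;> rfl
  simp only [standardOrder, Equiv.trans_apply, Equiv.sumCongr_apply, Sum.map_inr,
    finSumFinEquiv_apply_right, finCongr_apply, Fin.val_cast, Fin.val_natAdd,
    Equiv.prodCongr_apply, Prod.map_apply, finProdFinEquiv_apply_val, h, Equiv.refl_apply]
  omega

/-- Ends that are glued are consecutive in the standard order, so gluing creates no shortcut: the
position `f` along the path changes by at most one along each edge. -/
theorem le_ediam_caterpillar :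
    (m : ℕ∞) ≤ (caterpillarGraph (standardOrder hL hm)).skeleton.ediam := by
  set G := caterpillarGraph (standardOrder hL hm) with hG
  let f : Fin (m + 1) ⊕ L → ℤ := Sum.elim (fun v => v.1) fun l =>
    (caterpillarAttach m (standardOrder hL hm (.inl l))).1
  have hf : ∀ x y, G.skeleton.Adj x y → f y - f x ≤ 1 := by
    intro x y hxy
    obtain ⟨-, h, rfl, rfl⟩ := skeleton_adj_iff.1 hxy
    rcases h with ⟨i, b⟩ | k | l
    · rcases b <;> simp [hG, f, caterpillarGraph]
    · obtain ⟨(l | ⟨j, b⟩), rfl⟩ := (standardOrder hL hm).surjective k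
      · rw [hG, caterpillarGraph_inv_label]
        simp [f, caterpillarGraph]
      · rw [hG, caterpillarGraph_inv_glued]
        have h1 := standardOrder_inr hL hm j b
        have h2 := standardOrder_inr hL hm j (!b)
        simp only [f, caterpillarGraph, Sum.elim_inl, caterpillarAttach]
        rcases b <;> simp only [Bool.not_true, Bool.not_false, if_true, Bool.false_eq_true,
          if_false] at h1 h2 ⊢ <;> omega
    · rw [hG, caterpillarGraph_inv_inr]
      simp [f, caterpillarGraph]
  have hc : G.skeleton.Connected := (connected_iff _).1 (caterpillarGraph_connected _)
  obtain ⟨w, hw⟩ := hc.exists_walk_length_eq_edist (.inl 0) (.inl (Fin.last m))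
  refine le_trans ?_ (SimpleGraph.edist_le_ediam (u := .inl 0) (v := .inl (Fin.last m)))
  rw [← hw]
  have := w.sub_le_length hf
  simp [f] at this
  exact_mod_cast this

end StandardOrder

/-! ### Graphs glued from shallow trees -/

theorem HalfEdgeGraph.Branch.edist_le {V H Λ : Type} {G : HalfEdgeGraph V H} {e : Λ → H} {k : H}
    {t : LeafTree Λ} {vs : List V} (h : G.Branch e k t vs) :
    (∀ v ∈ vs, G.skeleton.edist (G.base (G.inv k)) v ≤ t.height) ∧
      ∀ a ∈ t.labels, G.skeleton.edist (G.base (G.inv k)) (G.base (G.inv (e a))) ≤ t.height := by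
  induction h with
  | leaf a => simp [LeafTree.labels, LeafTree.height]
  | @node k x y l r v vs ws ht _ _ h1 h2 =>
    have hl : ∀ u, G.skeleton.edist (G.base (G.inv x)) u ≤ l.height →
        G.skeleton.edist (G.base (G.inv k)) u ≤ (LeafTree.node l r).height := by
      intro u hu
      have h := G.edist_skeleton_le x
      rw [ht.base_b, ← ht.base_a] at h
      refine SimpleGraph.edist_triangle.trans ((add_le_add h hu).trans ?_)
      simp only [LeafTree.height]; norm_cast; omega
    have hr : ∀ u, G.skeleton.edist (G.base (G.inv y)) u ≤ r.height →
        G.skeleton.edist (G.base (G.inv k)) u ≤ (LeafTree.node l r).height := by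
      intro u hu
      have h := G.edist_skeleton_le y
      rw [ht.base_c, ← ht.base_a] at h
      refine SimpleGraph.edist_triangle.trans ((add_le_add h hu).trans ?_)
      simp only [LeafTree.height]; norm_cast; omega
    refine ⟨fun u hu => ?_, fun a ha => ?_⟩
    · simp only [List.mem_cons, List.mem_append] at hu
      rcases hu with rfl | hu | hu
      · rw [ht.base_a]; simp
      · exact hl u (h1.1 u hu)
      · exact hr u (h2.1 u hu)
    · rcases List.mem_append.1 ha with ha | ha
      · exact hl _ (h1.2 a ha)
      · exact hr _ (h2.2 a ha)

/-- Every vertex is joined within one of the two subtrees to an end of the root edge, by a path no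
longer than the height of this subtree. Two such paths and the root edge suffice. -/
theorem MarkedTrivalentGraph.ediam_le_of_isTree {g p : ℕ} {L : Type}
    (A : MarkedTrivalentGraph g p L) {e : L ⊕ (Fin g × Bool) → A.H}
    {t : LeafTree (L ⊕ (Fin g × Bool))} (hA : A.graph.IsCut A.label e)
    (h : A.graph.IsTree e t) (ht : ∀ a, a ∈ t.labels) :
    A.graph.skeleton.ediam ≤ (2 * t.height : ℕ) := by
  obtain ⟨l, r, k, vs, ws, rfl, b1, b2, -, hv⟩ := h
  have h1 := b1.edist_le
  have h2 := b2.edist_le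
  rw [A.graph.inv_inv] at h2
  have key : ∀ v, A.graph.skeleton.edist (A.graph.base (A.graph.inv k)) v ≤ l.height ∨
      A.graph.skeleton.edist (A.graph.base k) v ≤ r.height := by
    intro v
    rcases A.valence_eq v with hv1 | hv3
    · obtain ⟨i, rfl⟩ := A.exists_label hv1
      rw [← hA.1]
      exact (List.mem_append.1 (ht (.inl i))).imp (h1.2 _) (h2.2 _)
    · exact (List.mem_append.1 ((hv v).2 hv3)).imp (h1.1 _) (h2.1 _)
  have hk := A.graph.edist_skeleton_le k
  refine SimpleGraph.ediam_le_iff.2 fun u v => ?_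
  have tri : ∀ {a b : A.V} {x y z : ℕ}, A.graph.skeleton.edist a u ≤ x →
      A.graph.skeleton.edist a b ≤ y → A.graph.skeleton.edist b v ≤ z →
      x + y + z ≤ 2 * (LeafTree.node l r).height →
      A.graph.skeleton.edist u v ≤ (2 * (LeafTree.node l r).height : ℕ) := by
    intro a b x y z hx hy hz hxyz
    rw [SimpleGraph.edist_comm] at hx
    refine SimpleGraph.edist_triangle.trans (add_le_add (SimpleGraph.edist_triangle.trans
      (add_le_add hx hy)) hz) |>.trans ?_
    exact_mod_cast hxyz
  have hh : (LeafTree.node l r).height = max l.height r.height + 1 := rfl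
  rcases key u with hu | hu <;> rcases key v with hv | hv
  · exact tri hu (y := 0) (by simp) hv (by omega)
  · exact tri hu (y := 1) (by rw [SimpleGraph.edist_comm]; exact_mod_cast hk) hv (by omega)
  · exact tri hu (y := 1) (by exact_mod_cast hk) hv (by omega)
  · exact tri hu (y := 0) (by simp) hv (by omega)

/-- The lower bound for the diameter that comes from the combinatorial diameter of graphs. -/
theorem le_three_pow_diam {g p m M D : ℕ} (hm : 2 * g + p = m + 3) (hM : 2 * g + p ≤ 2 ^ M)
    (hD : (unmarkedMoves g p).ediam ≤ D) : m ≤ 3 ^ D * (2 * M) := by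
  have hgp : 0 < 2 * (g : ℤ) - 2 + (p : ℤ) := by omega
  have hL : Nat.card (Fin p) = p := by simp
  let A := caterpillar (standardOrder hL hm) hL hm
  obtain ⟨s, hs, hB⟩ := exists_shallow_tree (Fin p) hgp hL hM
  obtain ⟨B, e, b1, b2, b3, -⟩ := hB A
  let X : UnmarkedGraphSpace g p := B.toSpace.forget
  let Y : UnmarkedGraphSpace g p := A.toSpace.forget
  have hX : X.width ≤ (2 * s.height : ℕ) := B.ediam_le_of_isTree b1 b2 b3
  have hY : (m : ℕ∞) ≤ Y.width := le_ediam_caterpillar hL hm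
  have hXY : (unmarkedMoves g p).edist X Y ≤ D := SimpleGraph.edist_le_ediam.trans hD
  obtain ⟨w, hw⟩ := SimpleGraph.exists_walk_of_edist_ne_top
    (ne_top_of_le_ne_top (ENat.natCast_ne_top D) hXY)
  rw [← hw] at hXY
  have hXY : w.length ≤ D := by exact_mod_cast hXY
  have h1 := hY.trans ((UnmarkedGraphSpace.width_le_of_walk w).trans (mul_le_mul_right hX _))
  have h2 : m ≤ 3 ^ w.length * (2 * s.height) := by exact_mod_cast h1
  calc m ≤ 3 ^ w.length * (2 * s.height) := h2
    _ ≤ 3 ^ D * (2 * M) := by gcongr; norm_num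

/-! ### Distinct points of the spaces -/

/-- In the standard order the last pair is glued to a loop at the last vertex. After exchanging the
first and the last end there are no loops at all. -/
theorem nontrivial_unmarked_of_pos {g p m : ℕ} (hm : 2 * g + p = m + 3) (hg : 0 < g)
    (hm1 : 0 < m) : Nontrivial (UnmarkedGraphSpace g p) := by
  have hL : Nat.card (Fin p) = p := by simp
  let π := standardOrder hL hm
  let π' := π.trans (Equiv.swap 0 (Fin.last (m + 2)))
  refine ⟨(caterpillar π hL hm).toSpace.forget, (caterpillar π' hL hm).toSpace.forget, ?_⟩
  intro h
  have hiso : (caterpillarGraph π).Isomorphic (caterpillarGraph π') := Quotient.exact h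
  have h1 := hiso.exists_loop ((caterpillarGraph_exists_loop_iff π).2
    ⟨⟨g - 1, by omega⟩, false, by
      have h1 := standardOrder_inr hL hm ⟨g - 1, by omega⟩ false
      have h2 := standardOrder_inr hL hm ⟨g - 1, by omega⟩ true
      simp only [caterpillarAttach, Fin.mk.injEq, Bool.not_false, π]
      rw [h1, h2]; simp; omega⟩)
  obtain ⟨j, b, hj⟩ := (caterpillarGraph_exists_loop_iff π').1 h1
  have hval : ∀ k : Fin (m + 3), (Equiv.swap 0 (Fin.last (m + 2)) k).1 =
      if k.1 = 0 then m + 2 else if k.1 = m + 2 then 0 else k.1 := by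
    intro k
    rw [Equiv.swap_apply_def]
    simp only [Fin.ext_iff, Fin.val_zero, Fin.val_last]
    split_ifs <;> simp_all
  have h1 := standardOrder_inr hL hm j b
  have h2 := standardOrder_inr hL hm j (!b)
  have hjg := j.2
  simp only [caterpillarAttach, Fin.mk.injEq, π', Equiv.trans_apply, hval] at hj
  simp only [π, h1, h2] at hj
  rcases b <;> simp only [Bool.not_false, Bool.not_true, if_true, Bool.false_eq_true, if_false]
    at hj <;> split_ifs at hj <;> omega

/-- The tree whose leaves are attached to a path. -/
def LeafTree.comb {α : Type} : α → List α → LeafTree α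
  | x, [] => leaf x
  | x, y :: l => node (leaf x) (comb y l)

theorem LeafTree.labels_comb {α : Type} (x : α) (l : List α) : (comb x l).labels = x :: l := by
  induction l generalizing x with
  | nil => rfl
  | cons y l ih => simp [comb, labels, ih]

/-- Every tree is realized by a marked graph. -/
theorem MarkedTrivalentGraph.exists_of_tree {g p : ℕ} {L : Type}
    (hgp : 0 < 2 * (g : ℤ) - 2 + (p : ℤ)) (A : MarkedTrivalentGraph g p L)
    {t : LeafTree (L ⊕ (Fin g × Bool))} (ht : t.labels.Nodup) (hmem : ∀ a, a ∈ t.labels) :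
    ∃ (B : MarkedTrivalentGraph g p L) (e : L ⊕ (Fin g × Bool) → B.H),
      B.graph.IsCut B.label e ∧ B.graph.IsTree e t := by
  have := A.finite_L
  have := Fintype.ofFinite L
  obtain ⟨e, t', h1, h2, h3, h4⟩ := A.exists_isTree hgp
  -- Any realized tree is rewritten into `t` by way of the common tree. The number of steps is
  -- immaterial, so the crude bound N ≤ 2^N will do.
  obtain ⟨s, -, hs⟩ := LeafTree.exists_common_reach (Finset.univ : Finset (L ⊕ (Fin g × Bool)))
    Nat.lt_two_pow_self.le ⟨_, Finset.mem_univ (t.labels[0]'t.labels_length_pos)⟩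
  obtain ⟨B, e', b1, b2, -⟩ := A.exists_of_reach
    ((hs t' h3 (by simpa using h4)).trans (hs t ht (by simpa using hmem)).symm) h1 h2
  exact ⟨B, e', b1, b2⟩

/-- Six ends leave room for a trivalent vertex with three trivalent neighbors, which a caterpillar
tree does not have. -/
theorem nontrivial_unmarked_zero {p : ℕ} (hp : 6 ≤ p) : Nontrivial (UnmarkedGraphSpace 0 p) := by
  have hL : Nat.card (Fin p) = p := by simp
  obtain ⟨m, hm⟩ : ∃ m, 2 * 0 + p = m + 3 := ⟨p - 3, by omega⟩
  let A := caterpillar (standardOrder hL hm) hL hm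
  have hlen : (Finset.univ : Finset (Fin p ⊕ (Fin 0 × Bool))).toList.length = p := by simp
  have hnd := Finset.nodup_toList (Finset.univ : Finset (Fin p ⊕ (Fin 0 × Bool)))
  have hall : ∀ a, a ∈ (Finset.univ : Finset (Fin p ⊕ (Fin 0 × Bool))).toList := by simp
  revert hlen hnd hall
  rcases (Finset.univ : Finset (Fin p ⊕ (Fin 0 × Bool))).toList with
    _ | ⟨a, _ | ⟨b, _ | ⟨c, _ | ⟨d, _ | ⟨x, _ | ⟨y, l⟩⟩⟩⟩⟩⟩ <;>
    intro hlen hnd hall <;> try (simp at hlen; omega)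
  obtain ⟨B, e, b1, b2⟩ := A.exists_of_tree (by omega)
    (t := .node (.node (.node (.leaf a) (.leaf b)) (.node (.leaf c) (.leaf d)))
      (.comb x (y :: l))) (by simpa [LeafTree.labels, LeafTree.labels_comb] using hnd)
    (by simpa [LeafTree.labels, LeafTree.labels_comb] using hall)
  refine ⟨B.toSpace.forget, A.toSpace.forget, fun h => ?_⟩
  have hiso : B.graph.Isomorphic (caterpillarGraph (standardOrder hL hm)) := Quotient.exact h
  refine caterpillarGraph_not_exists_inner _ (hiso.exists_inner ?_)
  obtain ⟨l, r, k, vs, ws, heq, c1, c2, -, -⟩ := b2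
  cases heq
  have top : ∀ {k : B.H} {s t : LeafTree (Fin p ⊕ (Fin 0 × Bool))} {us : List B.V},
      B.graph.Branch e k (.node s t) us → B.graph.valence (B.graph.base (B.graph.inv k)) = 3 := by
    intro k s t us h
    cases h with
    | node ht _ _ => rw [ht.base_a, ht.valence_eq]
  cases c1 with
  | @node _ x y _ _ v _ _ ht d1 d2 =>
  refine ⟨v, ht.valence_eq, fun z hz => ?_⟩
  rcases (ht.base_iff z).1 hz with rfl | rfl | rfl
  exacts [top c2, top d1, top d2]

/-- The labels at the ends 0 and 1 have a common neighbor, but no longer so after the ends 1 and 2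
are exchanged. -/
theorem nontrivial_labeled_zero {p : ℕ} {L : Type} [Finite L] (hL : Nat.card L = p)
    (hp : 4 ≤ p) : Nontrivial (LabeledGraphSpace 0 p L) := by
  obtain ⟨m, hm⟩ : ∃ m, 2 * 0 + p = m + 3 := ⟨p - 3, by omega⟩
  let π := standardOrder hL hm
  let π' := π.trans (Equiv.swap ⟨1, by omega⟩ ⟨2, by omega⟩)
  let ψ := Finite.equivFinOfCardEq hL
  let i := ψ.symm ⟨0, by omega⟩
  let j := ψ.symm ⟨1, by omega⟩
  have hi : π (.inl i) = ⟨0, by omega⟩ := by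
    apply Fin.ext
    rw [standardOrder_inl]; simp [i, ψ]
  have hj : π (.inl j) = ⟨1, by omega⟩ := by
    apply Fin.ext
    rw [standardOrder_inl]; simp [j, ψ]
  refine ⟨(caterpillar π hL hm).toSpace, (caterpillar π' hL hm).toSpace, fun h => ?_⟩
  have hiso : (caterpillarGraph π).LabeledIsomorphic .inr (caterpillarGraph π') .inr :=
    Quotient.exact h
  have h1 := hiso.exists_common_neighbor ((caterpillarGraph_common_neighbor_iff π i j).2 (by
    rw [hi, hj]; simp [caterpillarAttach]))
  have h2 := (caterpillarGraph_common_neighbor_iff π' i j).1 h1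
  simp only [π', Equiv.trans_apply, hi, hj, Equiv.swap_apply_left] at h2
  rw [Equiv.swap_apply_of_ne_of_ne (by simp) (by simp)] at h2
  simp [caterpillarAttach] at h2
  omega

/-! ### Numerical constants and conclusion -/

/-- The numerical form of the two bounds for the diameter. -/
theorem diam_bounds_numeric {N n M : ℕ} (hn : 2 ≤ n) (hN : N ≤ 2 * n) (hM : M = Nat.clog 2 N) :
    ((58 * M : ℕ) : ℝ) ≤ 290 * Real.log n := by
  have hlog2 : (0.6931471803 : ℝ) < Real.log 2 := Real.log_two_gt_d9
  -- For N > 1 one has 2^M < 2N ≤ 4n ≤ n³. The constant then follows from 3 · 58 / log 2 < 290.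
  have h1 : 2 ^ M ≤ n ^ 3 := by
    rcases Nat.lt_or_ge 1 N with h | h
    · have h2 := Nat.pow_pred_clog_lt_self (b := 2) (by norm_num) h
      have h3 : 0 < Nat.clog 2 N := Nat.clog_pos (by norm_num) h
      rw [← hM] at h2 h3
      obtain ⟨k, rfl⟩ : ∃ k, M = k + 1 := ⟨M - 1, by omega⟩
      rw [Nat.pred_succ] at h2
      calc 2 ^ (k + 1) = 2 * 2 ^ k := by ring
        _ ≤ 2 * (2 * n) := by omega
        _ = 2 * 2 * n := by ring
        _ ≤ n * n * n := by gcongr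
        _ = n ^ 3 := by ring
    · rw [hM, Nat.clog_of_right_le_one h]
      exact Nat.one_le_pow _ _ (by omega)
  have h2 : (M : ℝ) * Real.log 2 ≤ 3 * Real.log n := by
    have h3 : ((2 : ℝ)) ^ M ≤ (n : ℝ) ^ 3 := by exact_mod_cast h1
    have h4 := Real.log_le_log (by positivity) h3
    rwa [Real.log_pow, Real.log_pow] at h4
  have hM0 : (0 : ℝ) ≤ M := Nat.cast_nonneg M
  have h5 : (M : ℝ) * 0.6931471803 ≤ M * Real.log 2 := by gcongr
  push_cast
  nlinarith

theorem sq_le_three_mul_two_pow (k : ℕ) : (k + 1) ^ 2 ≤ 3 * 2 ^ k := by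
  induction k using Nat.strong_induction_on with
  | _ k ih =>
    rcases k with _ | _ | _ | k
    · norm_num
    · norm_num
    · norm_num
    · have := ih (k + 2) (by omega)
      have h : (k + 2 + 1 + 1) ^ 2 ≤ 2 * (k + 2 + 1) ^ 2 := by
        ring_nf; omega
      rw [pow_succ 2 (k + 2)]
      exact h.trans (by omega)

/-- Squaring N ≤ 8(k+1)3^D and using (k+1)² ≤ 3 · 2^k < 3N absorbs the logarithmic factor and leaves
N ≤ 192 · 9^D. Since D ≥ 1, the factor 192 is at most 9^(3D). -/
theorem log_le_of_le_three_pow {N n M D : ℕ} (hn : 2 ≤ n) (hnN : n ≤ N) (hN : 4 ≤ N)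
    (hM : M = Nat.clog 2 N) (hD : 1 ≤ D) (h : N - 3 ≤ 3 ^ D * (2 * M)) :
    1 / 290 * Real.log n ≤ D := by
  have h2 := Nat.pow_pred_clog_lt_self (b := 2) (by norm_num) (show 1 < N by omega)
  have h3 : 0 < Nat.clog 2 N := Nat.clog_pos (by norm_num) (by omega)
  rw [← hM] at h2 h3
  obtain ⟨k, rfl⟩ : ∃ k, M = k + 1 := ⟨M - 1, by omega⟩
  rw [Nat.pred_succ] at h2
  have h4 := sq_le_three_mul_two_pow k
  have h5 : N ≤ 8 * (k + 1) * 3 ^ D := by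
    have : N ≤ 4 * (N - 3) := by omega
    calc N ≤ 4 * (N - 3) := this
      _ ≤ 4 * (3 ^ D * (2 * (k + 1))) := by gcongr
      _ = 8 * (k + 1) * 3 ^ D := by ring
  have h6 : N * N ≤ 192 * 9 ^ D * N := by
    calc N * N ≤ (8 * (k + 1) * 3 ^ D) * (8 * (k + 1) * 3 ^ D) := Nat.mul_le_mul h5 h5
      _ = 64 * (k + 1) ^ 2 * (3 * 3) ^ D := by rw [mul_pow]; ring
      _ ≤ 64 * (3 * N) * (3 * 3) ^ D := by gcongr; omega
      _ = 192 * 9 ^ D * N := by norm_num; ring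
  have h7 : N ≤ 192 * 9 ^ D := Nat.le_of_mul_le_mul_right h6 (by omega)
  have h8 : n ≤ 9 ^ (4 * D) := by
    calc n ≤ N := hnN
      _ ≤ 192 * 9 ^ D := h7
      _ ≤ 9 ^ (3 * D) * 9 ^ D := by
        gcongr
        calc 192 ≤ 9 ^ (3 * 1) := by norm_num
          _ ≤ 9 ^ (3 * D) := Nat.pow_le_pow_right (by norm_num) (by omega)
      _ = 9 ^ (4 * D) := by rw [← pow_add]; congr 1; omega
  have h9 : Real.log n ≤ (4 * D : ℕ) * Real.log 9 := by
    rw [← Real.log_pow]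
    exact Real.log_le_log (by positivity) (by exact_mod_cast h8)
  have h10 : Real.log 9 ≤ 8 := by
    have := Real.log_le_sub_one_of_pos (show (0 : ℝ) < 9 by norm_num)
    linarith
  have hD0 : (0 : ℝ) ≤ D := Nat.cast_nonneg D
  have h11 : ((4 * D : ℕ) : ℝ) * Real.log 9 ≤ (4 * D : ℕ) * 8 := by gcongr
  push_cast at h9 h11
  linarith

section Bounds

variable {α : Type*} {S : SimpleGraph α} {g p n : ℕ}

theorem diamAtMost_of_ediam_le (hn : 2 ≤ n) (hgp : 2 * g + p ≤ 2 * n)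
    (h : S.ediam ≤ (58 * Nat.clog 2 (2 * g + p) : ℕ)) : DiamAtMost S (290 * Real.log n) := by
  have htop : S.ediam ≠ ⊤ := ne_top_of_le_ne_top (ENat.natCast_ne_top _) h
  refine ⟨htop, le_trans ?_ (diam_bounds_numeric hn hgp rfl)⟩
  have : S.diam ≤ 58 * Nat.clog 2 (2 * g + p) := by
    rw [SimpleGraph.diam]
    exact ENat.toNat_le_of_le_natCast h
  exact_mod_cast this

/-- Nontriviality supplies D ≥ 1, without which the constants could not be absorbed for small
graphs. -/
theorem diamAtLeast_of_ediam_le (hn : 2 ≤ n) (hn' : n ≤ 2 * g + p) (h4 : 4 ≤ 2 * g + p)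
    [Nontrivial α] (htop : S.ediam ≠ ⊤) (h : (unmarkedMoves g p).ediam ≤ S.ediam) :
    DiamAtLeast S (1 / 290 * Real.log n) := by
  refine ⟨htop, log_le_of_le_three_pow hn hn' h4 rfl
    (Nat.one_le_iff_ne_zero.2 (SimpleGraph.diam_ne_zero_of_ediam_ne_top htop)) ?_⟩
  refine le_three_pow_diam (by omega) (Nat.le_pow_clog (by norm_num) _) (h.trans ?_)
  rw [SimpleGraph.diam, ENat.natCast_toNat htop]

end Bounds

theorem labeledMoves_bounds {g p n : ℕ} {L : Type} [Finite L] (hL : Nat.card L = p)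
    (hgp : 0 < 2 * (g : ℤ) - 2 + (p : ℤ)) (hn : 2 ≤ n) (hn' : n ≤ 2 * g + p)
    (hn2 : 2 * g + p ≤ 2 * n) :
    DiamAtMost (labeledMoves g p L) (290 * Real.log n) ∧
      (4 ≤ 2 * g + p → DiamAtLeast (labeledMoves g p L) (1 / 290 * Real.log n)) := by
  have h1 := ediam_labeledMoves_le L hgp (Nat.le_pow_clog (b := 2) (by norm_num) (2 * g + p))
  have h2 := diamAtMost_of_ediam_le hn hn2 h1
  refine ⟨h2, fun h4 => ?_⟩
  have : Nontrivial (LabeledGraphSpace g p L) := by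
    rcases Nat.eq_zero_or_pos g with rfl | hg
    · exact nontrivial_labeled_zero hL (by omega)
    · have := nontrivial_unmarked_of_pos (g := g) (p := p) (m := 2 * g + p - 3) (by omega) hg
        (by omega)
      exact (LabeledGraphSpace.forget_surjective hL).nontrivial
  exact diamAtLeast_of_ediam_le hn hn' h4 h2.1 (ediam_unmarkedMoves_le L hL)

theorem unmarkedMoves_bounds {g p n : ℕ} (hgp : 0 < 2 * (g : ℤ) - 2 + (p : ℤ)) (hn : 2 ≤ n)
    (hn' : n ≤ 2 * g + p) (hn2 : 2 * g + p ≤ 2 * n) :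
    DiamAtMost (unmarkedMoves g p) (290 * Real.log n) ∧
      (4 ≤ 2 * g + p → (g = 0 → 6 ≤ p) →
        DiamAtLeast (unmarkedMoves g p) (1 / 290 * Real.log n)) := by
  have h1 := (ediam_unmarkedMoves_le (g := g) (Fin p) (by simp)).trans
    (ediam_labeledMoves_le (Fin p) hgp (Nat.le_pow_clog (b := 2) (by norm_num) (2 * g + p)))
  have h2 := diamAtMost_of_ediam_le hn hn2 h1
  refine ⟨h2, fun h4 h6 => ?_⟩
  have : Nontrivial (UnmarkedGraphSpace g p) := by
    rcases Nat.eq_zero_or_pos g with rfl | hg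
    · exact nontrivial_unmarked_zero (h6 rfl)
    · exact nontrivial_unmarked_of_pos (m := 2 * g + p - 3) (by omega) hg (by omega)
  exact diamAtLeast_of_ediam_le hn hn' h4 h2.1 le_rfl

theorem mainTheorem4 :
    ∃ K : ℝ, 0 < K ∧ ∀ g p : ℕ, 0 < 2 * (g : ℤ) - 2 + (p : ℤ) →
      (DiamAtMost (markedMoves g p) (K * Real.log ((g : ℝ) + (p : ℝ))) ∧
        ((g, p) ∉ ({(0, 3), (1, 1)} : Set (ℕ × ℕ)) →
          DiamAtLeast (markedMoves g p) (1 / K * Real.log ((g : ℝ) + (p : ℝ))))) ∧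
      (DiamAtMost (unmarkedMoves g p) (K * Real.log ((g : ℝ) + (p : ℝ))) ∧
        ((g, p) ∉ ({(0, 3), (0, 4), (0, 5), (1, 1)} : Set (ℕ × ℕ)) →
          DiamAtLeast (unmarkedMoves g p) (1 / K * Real.log ((g : ℝ) + (p : ℝ))))) ∧
      (DiamAtMost (treeMoves (g + p)) (K * Real.log ((g : ℝ) + (p : ℝ))) ∧
        DiamAtLeast (treeMoves (g + p)) (1 / K * Real.log ((g : ℝ) + (p : ℝ)))) := by
  refine ⟨290, by norm_num, fun g p hgp => ?_⟩
  have hcast : (g : ℝ) + (p : ℝ) = ((g + p : ℕ) : ℝ) := by push_cast; rfl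
  have hn : 2 ≤ g + p := by omega
  rw [hcast]
  have h1 := labeledMoves_bounds (L := Fin p) (by simp) hgp hn (by omega) (by omega)
  have h2 := unmarkedMoves_bounds hgp hn (by omega) (by omega)
  -- For trees the number of ends is `g + p + 2`, which is at most `2 * (g + p)` because `g + p ≥
  -- 2`.
  have h3 := labeledMoves_bounds (g := 0) (p := g + p + 2) (n := g + p)
    (L := Option (Fin (g + p + 1))) (by simp) (by push_cast; omega) hn (by omega) (by omega)
  -- Among the admissible pairs, `4 ≤ 2 * g + p` fails exactly for (0, 3) and (1, 1); in rank 0 the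
  -- condition `6 ≤ p` excludes also (0, 4) and (0, 5).
  simp only [Set.mem_insert_iff, Set.mem_singleton_iff, Prod.mk.injEq, not_or]
  refine ⟨⟨h1.1, fun h => h1.2 ?_⟩, ⟨h2.1, fun h => h2.2 ?_ ?_⟩, h3.1, h3.2 (by omega)⟩ <;> omega
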